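/- **Cellular data.** Let $A=\bigoplus_{z\in\mathbb Z}A_z$ be a finite-dimensional $\mathbb Z$-graded unital $\mathbb C$-algebra which is a *graded cellular algebra with a highest weight theory*: there are a finite poset $(\mathscr P,\trianglerighteq)$, finite sets $\mathcal T(\lambda,\mu)$ (empty unless $\lambda\trianglerighteq\mu$), with $\mathcal T(\lambda)=\bigsqcup_\mu\mathcal T(\lambda,\mu)$, a function $\deg:\bigsqcup_\lambda\mathcal T(\lambda)\to\mathbb Z$, and a $\mathbb C$-basis $\{c^\lambda_{ST}\mid\lambda\in\mathscr P,\ S,T\in\mathcal T(\lambda)\}$ of $A$ such that (1) $c^\lambda_{ST}$ is homogeneous of degree $\deg S+\deg T$; (2) for $a\in A$ there are scalars $r_{SU}(a)$, independent of $T$, with $a\,c^\lambda_{ST}\equiv\sum_U r_{SU}(a)c^\lambda_{UT}$ modulo $A^{\triangleright\lambda}=\langle c^\nu_{QR}\mid\nu\triangleright\lambda\rangle_{\mathbb C}$; (3) the linear map $c^\lambda_{ST}\mapsto c^\lambda_{TS}$ is an anti-isomorphism; (4) $1_A=\sum_{\mu\in\mathscr P}1_\mu$ with orthogonal idempotents $1_\mu$,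 and $1_\mu c^\lambda_{ST}1_\nu=c^\lambda_{ST}$ for $S\in\mathcal T(\lambda,\mu)$, $T\in\mathcal T(\lambda,\nu)$; (5) $\mathcal T(\lambda,\lambda)$ has exactly one element $T^\lambda$, and $c^\lambda_{T^\lambda T^\lambda}=1_\lambda$. Let $\Delta(\lambda)$ be the standard module, with basis $\{c_S\mid S\in\mathcal T(\lambda)\}$, $\deg c_S=\deg S$, and $a\,c_S=\sum_U r_{SU}(a)c_U$. Let $L(\lambda)$ be its quotient by the radical of the form given by $c^\lambda_{US}c^\lambda_{TV}\equiv\langle c_S,c_T\rangle c^\lambda_{UV}$ modulo $A^{\triangleright\lambda}$. Put $L_\mu(\lambda)=1_\mu L(\lambda)$ and $\operatorname{Dim}M=\sum_k(\dim M_k)t^k$. With $M\langle k\rangle_z=M_{z-k}$, put $d_{\lambda\mu}(t)=\sum_k[\Delta(\lambda):L(\mu)\langle k\rangle]t^k$, where the brackets denote graded composition multiplicities. **Geometry.** Let $E_r=\bigoplus_{i=1}^r\mathbb R\varepsilon_i$ with $\langle\varepsilon_i,\varepsilon_j\rangle=\delta_{ij}$, let $\Phi\subset E_r$ be a reduced crystallographic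 root system (not necessarily spanning) with positive roots $R^+$, and let $\rho\in E_r$, $e\in\mathbb Z_{>0}\cup\{\infty\}$. The hyperplanes are $h_{\alpha,me}=\{x\mid\langle x+\rho,\alpha^\vee\rangle=me\}$ for $\alpha\in R^+$, $m\in\mathbb Z$ (only $m=0$ if $e=\infty$). The group $W^e$ is generated by the reflections $x\mapsto x-(\langle x+\rho,\alpha^\vee\rangle-me)\alpha$. A point is $e$-regular if it lies on no hyperplane, and the origin is assumed to be $e$-regular. Alcoves are the connected components of the set of $e$-regular points. Two alcoves are adjacent if exactly one hyperplane separates them, and $\ell(\mathfrak b)$ is the least number of steps in a chain of adjacent alcoves from the fundamental alcove $\mathfrak a_0\ni 0$ to $\mathfrak b$. For a hyperplane $h$, let $E^-(h)$ and $E^+(h)$ be the open half-spaces which contain and do not contain the origin. **Paths.** A word $w:\{1,\dots,n\}\to\{1,\dots,r\}$ gives the path $\omega$ with points $\omega(k)=\sum_{i\le k}\varepsilon_{w(i)}$, $0\le k\le n$. If $\omega(k)\in h$, we may *reflect* $\omega$, replacing $\omega(i)$ for all $i>k$ by its image under the reflection in $h$; a path is any sequence of points obtained in this way. The degree of a path is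 the sum over its steps of: $+1$ for each hyperplane $h$ with $\omega(k-1)\in h$, $\omega(k)\in E^-(h)$, and $-1$ for each hyperplane $h$ with $\omega(k)\in h$, $\omega(k-1)\in E^+(h)$. A path $\omega$ is *admissible* if all its initial subpaths have degree $0$, any two distinct hyperplanes through a common point $\omega(k)$ are orthogonal, and no hyperplane strictly separates two consecutive points $\omega(k-1),\omega(k)$. **Soergel-path basis.** Assume that $A$ has a *Soergel-path basis of type $\Phi$*: there are $n\ge 0$, an embedding $\mathscr P\hookrightarrow E_r$ (used to identify elements of $\mathscr P$ with points), and for each $\mu\in\mathscr P$ a path $\omega^\mu$ of length $n$ from $0$ to $\mu$ given by a word, all of whose initial subpaths have degree $0$, and which is admissible if $\mu$ is $e$-regular. Every path obtained from some $\omega^\mu$ by a series of reflections ends in a point of $\mathscr P$. With $\operatorname{Path}(\lambda,\mu)$ the set of those obtained from $\omega^\mu$ and ending in $\lambda$, there are degree-preserving bijections $\mathcal T(\lambda,\mu)\to\operatorname{Path}(\lambda,\mu)$ sending $T^\mu$ to $\omega^\mu$. **Algorithms.** For adjacent alcoves $\mathfrak a,\mathfrak a'$ with common wall $s$ and any alcove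 $\mathfrak b=w\cdot\mathfrak a$ ($w\in W^e$), put $s\cdot\mathfrak b=w\cdot\mathfrak a'$. For a function $f$ on alcoves with values in $\mathbb Z[t,t^{-1}]$ put $(fC_s)(s\cdot\mathfrak b)=f(\mathfrak b)+t^{-1}f(s\cdot\mathfrak b)$ if $\ell(s\cdot\mathfrak b)>\ell(\mathfrak b)$, and $f(\mathfrak b)+t\,f(s\cdot\mathfrak b)$ if $\ell(s\cdot\mathfrak b)<\ell(\mathfrak b)$. *Soergel's algorithm*: $n_{\mathfrak a_0}(\mathfrak b)=\delta_{\mathfrak a_0\mathfrak b}$. For $\mathfrak a'\ne\mathfrak a_0$ choose an adjacent alcove $\mathfrak a$ with $\ell(\mathfrak a)<\ell(\mathfrak a')$, let $s$ be the wall between them, $n'_{\mathfrak a'}=n_{\mathfrak a}C_s$, and $$n_{\mathfrak a'}(\mathfrak b)=n'_{\mathfrak a'}(\mathfrak b)-\sum_{\ell(\mathfrak d)<\ell(\mathfrak a')}\bigl(n'_{\mathfrak a'}(\mathfrak d)|_{t=0}\bigr)\,n_{\mathfrak d}(\mathfrak b),$$ where $|_{t=0}$ is the coefficient of $t^0$.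 *Alcove series of $\omega^\mu$*: let $A_k$ be the alcove of minimal length contained in $E^+(h)$ for every hyperplane $h$ met by $\omega^\mu(0),\dots,\omega^\mu(k)$; an alcove series is a chain $\mathfrak a_0,\mathfrak a_1,\dots,\mathfrak a_N$ of adjacent alcoves of increasing length through all the $A_k$ with $\mathfrak a_N=A_n$. *Character algorithm* along an alcove series: $e_{\mathfrak a_0}(\mathfrak b)=\delta_{\mathfrak a_0\mathfrak b}$ and, with $s_i$ the wall between $\mathfrak a_i$ and $\mathfrak a_{i+1}$, $$e_{\mathfrak a_{i+1}}(s_i\cdot\mathfrak c)=(t+t^{-1})\,e_{\mathfrak a_i}(s_i\cdot\mathfrak c)+e_{\mathfrak a_i}(\mathfrak c)+\sum_{\mathfrak d\ne\mathfrak c,\ \ell(s_i\cdot\mathfrak d)>\ell(\mathfrak d)}\bigl((n_{\mathfrak d}C_{s_i})(s_i\cdot\mathfrak c)|_{t=0}\bigr)\,e_{\mathfrak a_i}(\mathfrak d)$$ if $\ell(s_i\cdot\mathfrak c)>\ell(\mathfrak c)$, and $e_{\mathfrak a_{i+1}}(s_i\cdot\mathfrak c)=0$ otherwise. For $e$-regular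 points $\mu\in\mathfrak a$, $\lambda\in\mathfrak b$ put $n_\mu(\lambda)=n_{\mathfrak a}(\mathfrak b)$ if $\lambda\in W^e\cdot\mu$ and $n_\mu(\lambda)=0$ otherwise. For an $e$-regular $\mu\in\mathscr P$ with alcove series $\mathfrak a_0,\dots,\mathfrak a_N$ of $\omega^\mu$, put $e_\mu(\lambda)=e_{\mathfrak a_N}(\mathfrak b)$ if $\lambda\in W^e\cdot\mu$ and $e_\mu(\lambda)=0$ otherwise. **Theorem.** Suppose that $d_{\lambda\mu}(t)\in t\,\mathbb N_0[t]$ for all $\lambda\ne\mu$ in $\mathscr P$. Then every alcove other than $\mathfrak a_0$ has an adjacent alcove of smaller length, and for every choice of such alcoves in Soergel's algorithm and all $e$-regular $\lambda,\mu\in\mathscr P$ (in particular for all $\lambda,\mu$ labelling simple modules in an $e$-regular block) $$d_{\lambda\mu}(t)=n_\mu(\lambda).$$ Moreover $\omega^\mu$ has an alcove series, each alcove series of $\omega^\mu$ ends in the alcove of $\mu$, and computed along any of them $$\operatorname{Dim}L_\mu(\lambda)=e_\mu(\lambda).$$ -/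

import Mathlib

open scoped LaurentPolynomial InnerProductSpace

noncomputable section

/-! ### Graded modules: graded submodules, graded composition multiplicities, graded dimension -/

section GradedModules

variable {A : Type*} [Ring A] [Algebra ℂ A]
variable {M : Type*} [AddCommGroup M] [Module ℂ M] [Module A M] [IsScalarTower ℂ A M]
variable {L : Type*} [AddCommGroup L] [Module ℂ L] [Module A L] [IsScalarTower ℂ A L]

/-- An `A`-submodule `N` of a graded module `M = ⨁ M_z` is graded if `N = ⨁ (N ∩ M_z)`. -/
def IsGradedSubmodule (ℳ : ℤ → Submodule ℂ M) (N : Submodule A M) : Prop :=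
  N.restrictScalars ℂ = ⨆ z, N.restrictScalars ℂ ⊓ ℳ z

/-- The ordered set of graded `A`-submodules of `M`. -/
abbrev GradedSubmodule (A : Type*) [Ring A] [Algebra ℂ A] {M : Type*} [AddCommGroup M]
    [Module ℂ M] [Module A M] [IsScalarTower ℂ A M] (ℳ : ℤ → Submodule ℂ M) : Type _ :=
  {N : Submodule A M // IsGradedSubmodule ℳ N}

/-- `N₂ / N₁ ≅ L⟨k⟩` as graded modules, where `L⟨k⟩_z = L_{z - k}`. -/
def IsShiftedFactor (ℳ : ℤ → Submodule ℂ M) (ℒ : ℤ → Submodule ℂ L)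
    (N₁ N₂ : Submodule A M) (k : ℤ) : Prop :=
  ∃ φ : (↥N₂ ⧸ N₁.submoduleOf N₂) ≃ₗ[A] L,
    ∀ (z : ℤ) (x : ↥N₂), (x : M) ∈ ℳ z → φ (Submodule.Quotient.mk x) ∈ ℒ (z - k)

/-- A series of graded submodules of `M`, each maximal among the graded submodules properly
contained in the next one. -/
abbrev GradedChain (A : Type*) [Ring A] [Algebra ℂ A] {M : Type*} [AddCommGroup M]
    [Module ℂ M] [Module A M] [IsScalarTower ℂ A M] (ℳ : ℤ → Submodule ℂ M) : Type _ :=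
  RelSeries {p : GradedSubmodule A ℳ × GradedSubmodule A ℳ | p.1 ⋖ p.2}

/-- A graded composition series of `M` runs from `0` to `M`. -/
def IsGradedCompositionSeries (ℳ : ℤ → Submodule ℂ M) (s : GradedChain A ℳ) : Prop :=
  s.head.1 = ⊥ ∧ s.last.1 = ⊤

open Classical in
/-- The multiplicity `[M : L⟨k⟩]` of `L⟨k⟩` as a graded composition factor of `M`, counted in a
graded composition series of `M` (by Jordan--Hölder any of them gives the same number). -/
def gradedMultiplicity (A : Type*) [Ring A] [Algebra ℂ A]
    {M : Type*} [AddCommGroup M] [Module ℂ M] [Module A M] [IsScalarTower ℂ A M]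
    {L : Type*} [AddCommGroup L] [Module ℂ L] [Module A L] [IsScalarTower ℂ A L]
    (ℳ : ℤ → Submodule ℂ M) (ℒ : ℤ → Submodule ℂ L) (k : ℤ) : ℕ :=
  if h : ∃ s : GradedChain A ℳ, IsGradedCompositionSeries ℳ s then
    Nat.card {i : Fin h.choose.length //
      IsShiftedFactor ℳ ℒ (h.choose i.castSucc).1 (h.choose i.succ).1 k}
  else 0

/-- The graded dimension `∑_k (dim M_k) t^k` of a finite-dimensional graded space. -/
def gradedDim {V : Type*} [AddCommGroup V] [Module ℂ V] (𝒱 : ℤ → Submodule ℂ V) : ℤ[T;T⁻¹] :=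
  ∑ᶠ k : ℤ, (Module.finrank ℂ (𝒱 k) : ℤ) • LaurentPolynomial.T k

end GradedModules

/-! ### Graded cellular algebras with a highest weight theory -/

/-- A cell datum making the graded algebra `A` into a graded cellular algebra with a highest weight
theory, with weight poset `P`; here `μ ≤ lam` is `lam ⊵ μ`. -/
structure GradedCellularHW {A : Type*} [Ring A] [Algebra ℂ A] (𝒜 : ℤ → Submodule ℂ A)
    [GradedAlgebra 𝒜] (P : Type*) [Fintype P] [PartialOrder P] where
  /-- the set `𝒯(lam, μ)` -/
  Tab : P → P → Type*
  finite_tab : ∀ lam μ, Finite (Tab lam μ)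
  /-- `𝒯(lam, μ)` is only present for `lam ⊵ μ` -/
  le_of_tab : ∀ {lam μ}, Tab lam μ → μ ≤ lam
  deg : ∀ {lam μ}, Tab lam μ → ℤ
  /-- the basis elements `c^lam_{S T}`, `S, T ∈ 𝒯(lam) = ⋃_μ 𝒯(lam, μ)` -/
  c : Module.Basis (Σ lam, (Σ μ, Tab lam μ) × (Σ μ, Tab lam μ)) ℂ A
  c_mem : ∀ (lam) (S T : Σ μ, Tab lam μ), c ⟨lam, S, T⟩ ∈ 𝒜 (deg S.2 + deg T.2)
  /-- `a c_{S T} ≡ ∑_U r_{S U}(a) c_{U T}` modulo `A^{▷ lam}`, with `r` independent of `T` -/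
  exists_action : ∀ (lam) (S : Σ μ, Tab lam μ) (a : A), ∃ r : (Σ μ, Tab lam μ) → ℂ,
    ∀ T : Σ μ, Tab lam μ, a * c ⟨lam, S, T⟩ - ∑ᶠ U, r U • c ⟨lam, U, T⟩ ∈
      Submodule.span ℂ {x | ∃ ν, lam < ν ∧ ∃ Q R : Σ μ, Tab ν μ, x = c ⟨ν, Q, R⟩}
  /-- the linear map `c_{S T} ↦ c_{T S}` is an anti-isomorphism -/
  anti : ∀ a b : A,
    c.constr ℂ (fun i => c ⟨i.1, i.2.2, i.2.1⟩) (a * b) =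
      c.constr ℂ (fun i => c ⟨i.1, i.2.2, i.2.1⟩) b *
        c.constr ℂ (fun i => c ⟨i.1, i.2.2, i.2.1⟩) a
  /-- the weight idempotents `1_μ` -/
  idem : P → A
  idem_mul_self : ∀ μ, idem μ * idem μ = idem μ
  idem_mul_of_ne : ∀ μ ν, μ ≠ ν → idem μ * idem ν = 0
  sum_idem : ∑ μ, idem μ = 1
  idem_c_idem : ∀ (lam) (S T : Σ μ, Tab lam μ),
    idem S.1 * c ⟨lam, S, T⟩ * idem T.1 = c ⟨lam, S, T⟩
  /-- the unique element `T^lam` of `𝒯(lam, lam)` -/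
  top : ∀ lam, Tab lam lam
  eq_top : ∀ lam (S : Tab lam lam), S = top lam
  c_top : ∀ lam, c ⟨lam, ⟨lam, top lam⟩, ⟨lam, top lam⟩⟩ = idem lam

namespace GradedCellularHW

variable {A : Type*} [Ring A] [Algebra ℂ A] {𝒜 : ℤ → Submodule ℂ A} [GradedAlgebra 𝒜]
variable {P : Type*} [Fintype P] [PartialOrder P] (D : GradedCellularHW 𝒜 P)

/-- `𝒯(lam) = ⋃_μ 𝒯(lam, μ)` -/
abbrev Tabs (lam : P) : Type _ := Σ μ, D.Tab lam μ

instance (lam : P) : Fintype (D.Tabs lam) :=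
  have : ∀ μ, Finite (D.Tab lam μ) := D.finite_tab lam
  Fintype.ofFinite _

instance (lam : P) : DecidableEq (D.Tabs lam) := Classical.decEq _

/-- `T^lam` as an element of `𝒯(lam)` -/
def topTab (lam : P) : D.Tabs lam := ⟨lam, D.top lam⟩

/-- `A^{▷ lam}` -/
def above (lam : P) : Submodule ℂ A :=
  Submodule.span ℂ {x | ∃ ν, lam < ν ∧ ∃ Q R : Σ μ, D.Tab ν μ, x = D.c ⟨ν, Q, R⟩}

/-- The structure constants `r_{S U}(a)`: the coefficient of `c_{U T}` in `a c_{S T}`, read off at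
`T = T^lam`. -/
def r (lam : P) (S U : D.Tabs lam) (a : A) : ℂ :=
  D.c.repr (a * D.c ⟨lam, S, D.topTab lam⟩) ⟨lam, U, D.topTab lam⟩

/-- The anti-involution `*` of `A`. -/
def star : A →ₗ[ℂ] A := D.c.constr ℂ (fun i => D.c ⟨i.1, i.2.2, i.2.1⟩)

theorem repr_above (lam : P) (U V : D.Tabs lam) {x : A} (hx : x ∈ D.above lam) :
    D.c.repr x ⟨lam, U, V⟩ = 0 := by
  induction hx using Submodule.span_induction with
  | mem x h =>
    obtain ⟨ν, hν, Q, R, rfl⟩ := h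
    rw [Module.Basis.repr_self]
    refine Finsupp.single_eq_of_ne fun h => ?_
    exact hν.ne (congrArg Sigma.fst h)
  | zero => simp
  | add x y _ _ hx hy => simp [hx, hy]
  | smul z x _ hx => simp [hx]

theorem repr_sum (lam : P) (f : D.Tabs lam → ℂ) (T U : D.Tabs lam) :
    D.c.repr (∑ V, f V • D.c ⟨lam, V, T⟩) ⟨lam, U, T⟩ = f U := by
  rw [map_sum, Finsupp.finsetSum_apply, Finset.sum_eq_single U]
  · simp
  · intro V _ hV
    rw [map_smul, Finsupp.smul_apply, Module.Basis.repr_self, Finsupp.single_eq_of_ne, smul_zero]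
    intro h
    apply hV
    simpa using h.symm
  · simp

theorem action (lam : P) (S : D.Tabs lam) (a : A) (T : D.Tabs lam) :
    a * D.c ⟨lam, S, T⟩ - ∑ U, D.r lam S U a • D.c ⟨lam, U, T⟩ ∈ D.above lam := by
  obtain ⟨q, hq⟩ := D.exists_action lam S a
  have hq' : ∀ T, a * D.c ⟨lam, S, T⟩ - ∑ U, q U • D.c ⟨lam, U, T⟩ ∈ D.above lam := by
    intro T
    have := hq T
    rwa [finsum_eq_sum_of_fintype] at this
  have key : ∀ U, D.r lam S U a = q U := by
    intro U
    have h := D.repr_above lam U (D.topTab lam) (hq' (D.topTab lam))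
    rw [map_sub, Finsupp.sub_apply, sub_eq_zero] at h
    rw [r, h, repr_sum]
  simp only [key]
  exact hq' T

theorem mul_above (lam : P) (a : A) {x : A} (hx : x ∈ D.above lam) : a * x ∈ D.above lam := by
  induction hx using Submodule.span_induction with
  | mem x h =>
    obtain ⟨ν, hν, Q, R, rfl⟩ := h
    have h1 := D.action ν Q a R
    have h2 : D.above ν ≤ D.above lam :=
      Submodule.span_mono fun y ⟨κ, hκ, h⟩ => ⟨κ, hν.trans hκ, h⟩
    have h3 : ∑ U, D.r ν Q U a • D.c ⟨ν, U, R⟩ ∈ D.above lam :=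
      Submodule.sum_mem _ fun U _ => Submodule.smul_mem _ _ (Submodule.subset_span ⟨ν, hν, U, R, rfl⟩)
    simpa using Submodule.add_mem _ (h2 h1) h3
  | zero => simp
  | add x y _ _ hx hy => rw [mul_add]; exact Submodule.add_mem _ hx hy
  | smul z x _ hx => rw [mul_smul_comm]; exact Submodule.smul_mem _ _ hx

theorem r_one (lam : P) (S U : D.Tabs lam) : D.r lam S U 1 = if S = U then 1 else 0 := by
  rw [r, one_mul, Module.Basis.repr_self]
  by_cases h : S = U
  · simp [h]
  · rw [if_neg h]
    refine Finsupp.single_eq_of_ne fun h' => h ?_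
    simpa using h'.symm

theorem r_mul (lam : P) (S U : D.Tabs lam) (a b : A) :
    D.r lam S U (a * b) = ∑ V, D.r lam S V b * D.r lam V U a := by
  have h1 := D.repr_above lam U (D.topTab lam)
    (D.mul_above lam a (D.action lam S b (D.topTab lam)))
  rw [mul_sub, map_sub, Finsupp.sub_apply, sub_eq_zero, ← mul_assoc] at h1
  rw [r, h1, Finset.mul_sum, map_sum, Finsupp.finsetSum_apply]
  refine Finset.sum_congr rfl fun V _ => ?_
  rw [mul_smul_comm, map_smul, Finsupp.smul_apply, smul_eq_mul, r, r]

theorem r_add (lam : P) (S U : D.Tabs lam) (a b : A) :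
    D.r lam S U (a + b) = D.r lam S U a + D.r lam S U b := by
  simp [r, add_mul]

theorem r_smul (lam : P) (S U : D.Tabs lam) (z : ℂ) (a : A) :
    D.r lam S U (z • a) = z * D.r lam S U a := by
  simp [r]

/-- The standard module `Δ(lam)`, with basis `𝒯(lam)`: the function `x` stands for
`∑_S x(S) c^lam_S`. -/
def Std (lam : P) : Type _ := D.Tabs lam → ℂ

instance (lam : P) : AddCommGroup (D.Std lam) := inferInstanceAs (AddCommGroup (D.Tabs lam → ℂ))

instance (lam : P) : Module ℂ (D.Std lam) := inferInstanceAs (Module ℂ (D.Tabs lam → ℂ))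

/-- The action `a c_S = ∑_U r_{S U}(a) c_U`. -/
instance (lam : P) : SMul A (D.Std lam) := ⟨fun a x U => ∑ S, x S * D.r lam S U a⟩

theorem smul_apply (lam : P) (a : A) (x : D.Std lam) (U : D.Tabs lam) :
    (a • x) U = ∑ S, x S * D.r lam S U a := rfl

theorem add_apply (lam : P) (x y : D.Std lam) (U : D.Tabs lam) : (x + y) U = x U + y U := rfl

theorem zero_apply (lam : P) (U : D.Tabs lam) : (0 : D.Std lam) U = 0 := rfl

theorem csmul_apply (lam : P) (z : ℂ) (x : D.Std lam) (U : D.Tabs lam) : (z • x) U = z * x U := rfl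

instance (lam : P) : Module A (D.Std lam) where
  one_smul x := by
    funext U
    rw [smul_apply, Finset.sum_eq_single U]
    · simp [r_one]
    · intro S _ hS
      simp [r_one, hS]
    · simp
  mul_smul a b x := by
    funext U
    simp only [smul_apply, r_mul, Finset.mul_sum, Finset.sum_mul]
    rw [Finset.sum_comm]
    refine Finset.sum_congr rfl fun V _ => Finset.sum_congr rfl fun S _ => by ring
  smul_zero a := by
    funext U
    simp [smul_apply, zero_apply]
  smul_add a x y := by
    funext U
    simp [smul_apply, add_apply, add_mul, Finset.sum_add_distrib]
  add_smul a b x := by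
    funext U
    simp [smul_apply, add_apply, r_add, mul_add, Finset.sum_add_distrib]
  zero_smul x := by
    funext U
    simp [smul_apply, zero_apply, r]

instance (lam : P) : IsScalarTower ℂ A (D.Std lam) where
  smul_assoc z a x := by
    funext U
    simp only [smul_apply, csmul_apply, r_smul, Finset.mul_sum]
    refine Finset.sum_congr rfl fun S _ => by ring

/-- The homogeneous component `Δ(lam)_z`, spanned by the `c_S` with `deg S = z`. -/
def stdGrading (lam : P) (z : ℤ) : Submodule ℂ (D.Std lam) where
  carrier := {x | ∀ S : D.Tabs lam, D.deg S.2 ≠ z → x S = 0}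
  add_mem' {x y} hx hy S hS := by rw [add_apply, hx S hS, hy S hS, add_zero]
  zero_mem' _ _ := rfl
  smul_mem' w x hx S hS := by rw [csmul_apply, hx S hS, mul_zero]

/-- The value `⟨c_S, c_T⟩` of the cellular form, from
`c_{U S} c_{T V} ≡ ⟨c_S, c_T⟩ c_{U V}` read off at `U = V = T^lam`. -/
def gram (lam : P) (S T : D.Tabs lam) : ℂ :=
  D.c.repr (D.c ⟨lam, D.topTab lam, S⟩ * D.c ⟨lam, T, D.topTab lam⟩)
    ⟨lam, D.topTab lam, D.topTab lam⟩

/-- The cellular bilinear form on `Δ(lam)`. -/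
def form (lam : P) (x y : D.Std lam) : ℂ := ∑ S, ∑ T, x S * y T * D.gram lam S T

theorem star_c (lam : P) (S T : D.Tabs lam) : D.star (D.c ⟨lam, S, T⟩) = D.c ⟨lam, T, S⟩ := by
  rw [star, Module.Basis.constr_basis]

theorem star_mul (a b : A) : D.star (a * b) = D.star b * D.star a := D.anti a b

theorem star_star (a : A) : D.star (D.star a) = a := by
  have : D.star ∘ₗ D.star = LinearMap.id := by
    refine D.c.ext fun ⟨lam, S, T⟩ => ?_
    simp [star_c]
  exact LinearMap.congr_fun this a

theorem star_above (lam : P) {x : A} (hx : x ∈ D.above lam) : D.star x ∈ D.above lam := by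
  induction hx using Submodule.span_induction with
  | mem x h =>
    obtain ⟨ν, hν, Q, R, rfl⟩ := h
    rw [star_c]
    exact Submodule.subset_span ⟨ν, hν, R, Q, rfl⟩
  | zero => simp
  | add x y _ _ hx hy => rw [map_add]; exact Submodule.add_mem _ hx hy
  | smul z x _ hx => rw [map_smul]; exact Submodule.smul_mem _ _ hx

theorem action_right (lam : P) (S : D.Tabs lam) (a : A) (T : D.Tabs lam) :
    D.c ⟨lam, T, S⟩ * a - ∑ U, D.r lam S U (D.star a) • D.c ⟨lam, T, U⟩ ∈ D.above lam := by
  have h := D.star_above lam (D.action lam S (D.star a) T)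
  simpa [star_mul, star_star, star_c, map_sum] using h

theorem above_mul (lam : P) (a : A) {x : A} (hx : x ∈ D.above lam) : x * a ∈ D.above lam := by
  have h := D.star_above lam (D.mul_above lam (D.star a) (D.star_above lam hx))
  simpa [star_mul, star_star] using h

/-- Both sides are the coefficient of `c_{T^lam T^lam}` in `c_{T^lam S} a c_{T T^lam}`. -/
theorem gram_adjoint (lam : P) (S T : D.Tabs lam) (a : A) :
    ∑ U, D.r lam S U a * D.gram lam U T = ∑ V, D.r lam T V (D.star a) * D.gram lam S V := by
  have h1 := D.repr_above lam (D.topTab lam) (D.topTab lam)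
    (D.above_mul lam (D.c ⟨lam, T, D.topTab lam⟩)
      (D.action_right lam S (D.star a) (D.topTab lam)))
  have h2 := D.repr_above lam (D.topTab lam) (D.topTab lam)
    (D.mul_above lam (D.c ⟨lam, D.topTab lam, S⟩)
      (D.action lam T (D.star a) (D.topTab lam)))
  rw [sub_mul, map_sub, Finsupp.sub_apply, sub_eq_zero, star_star] at h1
  rw [mul_sub, map_sub, Finsupp.sub_apply, sub_eq_zero, ← mul_assoc, h1] at h2
  simpa [Finset.sum_mul, Finset.mul_sum, map_sum, Finsupp.finsetSum_apply, gram] using h2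

theorem form_smul (lam : P) (a : A) (x y : D.Std lam) :
    D.form lam (a • x) y = D.form lam x (D.star a • y) := by
  have h1 : D.form lam (a • x) y =
      ∑ S, ∑ T, x S * y T * ∑ U, D.r lam S U a * D.gram lam U T := by
    simp only [form, smul_apply, Finset.sum_mul, Finset.mul_sum]
    calc _ = ∑ U, ∑ S, ∑ T, x S * D.r lam S U a * y T * D.gram lam U T :=
          Finset.sum_congr rfl fun U _ => Finset.sum_comm
      _ = ∑ S, ∑ U, ∑ T, x S * D.r lam S U a * y T * D.gram lam U T := Finset.sum_comm
      _ = ∑ S, ∑ T, ∑ U, x S * D.r lam S U a * y T * D.gram lam U T :=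
          Finset.sum_congr rfl fun S _ => Finset.sum_comm
      _ = _ := by
          refine Finset.sum_congr rfl fun S _ => Finset.sum_congr rfl fun T _ =>
            Finset.sum_congr rfl fun U _ => by ring
  have h2 : D.form lam x (D.star a • y) =
      ∑ S, ∑ T, x S * y T * ∑ V, D.r lam T V (D.star a) * D.gram lam S V := by
    simp only [form, smul_apply, Finset.sum_mul, Finset.mul_sum]
    refine Finset.sum_congr rfl fun S _ => ?_
    rw [Finset.sum_comm]
    refine Finset.sum_congr rfl fun T _ => Finset.sum_congr rfl fun U _ => by ring
  rw [h1, h2]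
  simp only [gram_adjoint]

/-- The radical of the cellular form. -/
def rad (lam : P) : Submodule A (D.Std lam) where
  carrier := {x | ∀ y, D.form lam x y = 0}
  add_mem' {x x'} hx hx' y := by
    have h : D.form lam (x + x') y = D.form lam x y + D.form lam x' y := by
      simp [form, add_apply, add_mul, Finset.sum_add_distrib]
    rw [h, hx y, hx' y, add_zero]
  zero_mem' y := by simp [form, zero_apply]
  smul_mem' a x hx y := by rw [form_smul]; exact hx _

/-- The simple module `L(lam) = Δ(lam) / rad`. -/
abbrev Simple (lam : P) : Type _ := D.Std lam ⧸ D.rad lam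

/-- The homogeneous component `L(lam)_z`. -/
def simpleGrading (lam : P) (z : ℤ) : Submodule ℂ (D.Simple lam) :=
  (D.stdGrading lam z).map ((D.rad lam).mkQ.restrictScalars ℂ)

/-- The homogeneous component `L_μ(lam)_z` of the weight space `L_μ(lam) = 1_μ L(lam)`. -/
def simpleWeight (lam μ : P) (z : ℤ) : Submodule ℂ (D.Simple lam) :=
  LinearMap.range (Algebra.lsmul ℂ ℂ (D.Simple lam) (D.idem μ)) ⊓ D.simpleGrading lam z

/-- The graded decomposition number `d_{lam μ}(t) = ∑_k [Δ(lam) : L(μ)⟨k⟩] t^k`. -/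
def decompositionNumber (lam μ : P) : ℤ[T;T⁻¹] :=
  ∑ᶠ k : ℤ, (gradedMultiplicity A (D.stdGrading lam) (D.simpleGrading μ) k : ℤ) •
    LaurentPolynomial.T k

/-- The graded character value `Dim L_μ(lam)`. -/
def simpleCharacter (lam μ : P) : ℤ[T;T⁻¹] := gradedDim (D.simpleWeight lam μ)

end GradedCellularHW

/-! ### The alcove geometry -/

/-- `E_r`, with orthonormal basis `ε_1, …, ε_r` -/
abbrev ESpace (r : ℕ) : Type := EuclideanSpace ℝ (Fin r)

/-- The coroot `α^∨ = 2 α / ⟨α, α⟩`. -/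
def coroot {r : ℕ} (α : ESpace r) : ESpace r := (2 / ⟪α, α⟫_ℝ) • α

/-- A (reduced, crystallographic) root system `Φ` in `E_r`, not necessarily spanning, with a choice
of positive roots, a shift `ρ` and a parameter `e ∈ ℕ ∪ {∞}`, such that the origin lies on none of
the hyperplanes `⟨x + ρ, α^∨⟩ = m e`. -/
structure AlcoveGeometry (r : ℕ) where
  Φ : Finset (ESpace r)
  zero_notMem : 0 ∉ Φ
  reflection_mem : ∀ α ∈ Φ, ∀ β ∈ Φ, β - ⟪β, coroot α⟫_ℝ • α ∈ Φ
  integral : ∀ α ∈ Φ, ∀ β ∈ Φ, ∃ m : ℤ, ⟪β, coroot α⟫_ℝ = m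
  reduced : ∀ α ∈ Φ, ∀ c : ℝ, c • α ∈ Φ → c = 1 ∨ c = -1
  /-- the positive roots -/
  pos : Finset (ESpace r)
  pos_spec : ∃ f : ESpace r →ₗ[ℝ] ℝ, (∀ α ∈ Φ, f α ≠ 0) ∧ ∀ α, α ∈ pos ↔ α ∈ Φ ∧ 0 < f α
  ρ : ESpace r
  e : ℕ∞
  e_pos : 0 < e
  origin_regular : ∀ α ∈ pos, ∀ m : ℤ, (e = ⊤ → m = 0) → ⟪ρ, coroot α⟫_ℝ ≠ m * (e.toNat : ℝ)

namespace AlcoveGeometry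

variable {r : ℕ} (G : AlcoveGeometry r)

/-- The values `m e`, `m ∈ ℤ`; only `0` if `e = ∞`. -/
def levels : Set ℝ := {x | ∃ m : ℤ, (G.e = ⊤ → m = 0) ∧ x = m * (G.e.toNat : ℝ)}

/-- The hyperplanes `h_{α, m e}`, each given by its positive root `α` and the value `m e`. -/
def hyperplanes : Set (ESpace r × ℝ) := {h | h.1 ∈ G.pos ∧ h.2 ∈ G.levels}

/-- `⟨x + ρ, α^∨⟩ - m e`: zero on the hyperplane `h = h_{α, m e}`, and its sign tells the side. -/
def side (h : ESpace r × ℝ) (x : ESpace r) : ℝ := ⟪x + G.ρ, coroot h.1⟫_ℝ - h.2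

/-- `x ∈ h_{α, m e}` -/
def On (h : ESpace r × ℝ) (x : ESpace r) : Prop := G.side h x = 0

/-- `x ∈ E_r^-(α, m e)`, the side of the origin -/
def InMinus (h : ESpace r × ℝ) (x : ESpace r) : Prop := 0 < G.side h x * G.side h 0

/-- `x ∈ E_r^+(α, m e)`, the side away from the origin -/
def InPlus (h : ESpace r × ℝ) (x : ESpace r) : Prop := G.side h x * G.side h 0 < 0

/-- `x` is `e`-regular: it lies on no hyperplane. -/
def Regular (x : ESpace r) : Prop := ∀ h ∈ G.hyperplanes, ¬ G.On h x

theorem regular_zero : G.Regular 0 := by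
  rintro ⟨α, c⟩ ⟨hα, m, hm, hc⟩ h0
  refine G.origin_regular α hα m hm ?_
  simp only [On, side, zero_add] at h0
  simp only at hc
  linarith

/-- The shifted reflection `x ↦ s_{α, m e}(x + ρ) - ρ = x - (⟨x + ρ, α^∨⟩ - m e) α`. -/
def reflectFun (h : ESpace r × ℝ) (x : ESpace r) : ESpace r := x - G.side h x • h.1

theorem reflectFun_involutive (h : ESpace r × ℝ) : Function.Involutive (G.reflectFun h) := by
  intro x
  by_cases h0 : h.1 = 0
  · simp [reflectFun, h0]
  · have h1 : ⟪h.1, h.1⟫_ℝ ≠ 0 := by simpa using h0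
    have h2 : ⟪h.1, coroot h.1⟫_ℝ = 2 := by
      rw [coroot, inner_smul_right, div_mul_cancel₀ _ h1]
    have h3 : G.side h (G.reflectFun h x) = - G.side h x := by
      have : G.reflectFun h x + G.ρ = (x + G.ρ) - G.side h x • h.1 := by
        simp only [reflectFun]; abel
      rw [side, this, inner_sub_left, real_inner_smul_left, h2]
      simp only [side]
      ring
    rw [reflectFun, h3, reflectFun]
    simp

/-- The shifted reflection as a permutation of `E_r`. -/
def reflect (h : ESpace r × ℝ) : Equiv.Perm (ESpace r) := (G.reflectFun_involutive h).toPerm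

/-- The affine reflection group `W^e`, in its `ρ`-shifted action on `E_r`. -/
def W : Subgroup (Equiv.Perm (ESpace r)) := Subgroup.closure (G.reflect '' G.hyperplanes)

/-- `y ∈ W^e · x` -/
def Linked (x y : ESpace r) : Prop := ∃ w ∈ G.W, w x = y

/-- The set of points lying strictly on the same side of every hyperplane as `x`. -/
def cell (x : ESpace r) : Set (ESpace r) :=
  {y | ∀ h ∈ G.hyperplanes, 0 < G.side h x * G.side h y}

/-- The alcoves: the facets containing the `e`-regular points. -/
def Alcove : Type := {a : Set (ESpace r) // ∃ x, G.Regular x ∧ a = G.cell x}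

/-- The alcove of an `e`-regular point. -/
def alcoveOf (x : ESpace r) (hx : G.Regular x) : G.Alcove := ⟨G.cell x, x, hx, rfl⟩

/-- The fundamental alcove, which contains the origin. -/
def fundamental : G.Alcove := G.alcoveOf 0 G.regular_zero

/-- The hyperplane `h` separates the alcoves `a` and `b`. -/
def Separates (h : ESpace r × ℝ) (a b : G.Alcove) : Prop :=
  ∀ x ∈ a.1, ∀ y ∈ b.1, G.side h x * G.side h y < 0

theorem alcove_nonempty (a : G.Alcove) : a.1.Nonempty := by
  obtain ⟨s, x, hx, rfl⟩ := a
  exact ⟨x, fun h hh => by have := hx h hh; exact mul_self_pos.2 this⟩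

/-- Two alcoves are adjacent if they have a common wall, that is, if exactly one hyperplane
separates them. -/
def adjacency : SimpleGraph G.Alcove where
  Adj a b := ∃! h, h ∈ G.hyperplanes ∧ G.Separates h a b
  symm := ⟨by
    rintro a b ⟨h, ⟨h1, h2⟩, h3⟩
    refine ⟨h, ⟨h1, fun x hx y hy => by rw [mul_comm]; exact h2 y hy x hx⟩, ?_⟩
    rintro k ⟨k1, k2⟩
    exact h3 k ⟨k1, fun x hx y hy => by rw [mul_comm]; exact k2 y hy x hx⟩⟩
  loopless := ⟨by
    rintro a ⟨h, ⟨_, h2⟩, _⟩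
    obtain ⟨x, hx⟩ := G.alcove_nonempty a
    exact absurd (h2 x hx x hx) (not_lt.2 (mul_self_nonneg _))⟩

/-- The length `ℓ(a)`: the least number of steps in a chain of adjacent alcoves from the fundamental
alcove to `a`. -/
def len (a : G.Alcove) : ℕ := G.adjacency.dist G.fundamental a

open Classical in
/-- For adjacent alcoves `a, a'` with common wall `s`, the alcove `s · b`: the image of `b` in the
wall of `b` which lies in the `W^e`-orbit of the wall between `a` and `a'`. In other words, if
`b = w · a` with `w ∈ W^e`, then `s · b = w · a'`. -/
def cross (a a' b : G.Alcove) : G.Alcove :=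
  if h : ∃ b' : G.Alcove, ∃ w ∈ G.W, w '' a.1 = b.1 ∧ w '' a'.1 = b'.1 then h.choose else b

/-! ### Paths -/

/-- The path of length `n` from the origin with steps `ε_{w(1)}, …, ε_{w(n)}`. -/
def wordPath {n : ℕ} (w : Fin n → Fin r) (k : Fin (n + 1)) : ESpace r :=
  ∑ i : Fin n with i.castSucc < k, EuclideanSpace.single (w i) (1 : ℝ)

/-- `s^k_{α, m e} · ω`: apply the reflection in `h` to all the points of `ω` after `ω(k)`. -/
def reflectAt {n : ℕ} (h : ESpace r × ℝ) (k : Fin (n + 1)) (ω : Fin (n + 1) → ESpace r)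
    (i : Fin (n + 1)) : ESpace r :=
  if i ≤ k then ω i else G.reflect h (ω i)

/-- `ω'` is the reflection of `ω` in a hyperplane through one of its points. -/
def ReflectionStep {n : ℕ} (ω ω' : Fin (n + 1) → ESpace r) : Prop :=
  ∃ h ∈ G.hyperplanes, ∃ k, G.On h (ω k) ∧ ω' = G.reflectAt h k ω

/-- `ω'` is obtained from `ω` by a series of reflections. -/
def PathEquiv {n : ℕ} (ω ω' : Fin (n + 1) → ESpace r) : Prop :=
  Relation.ReflTransGen G.ReflectionStep ω ω'

/-- The paths which end in `x` and are obtained from `ω` by a series of reflections. -/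
def PathsTo {n : ℕ} (ω : Fin (n + 1) → ESpace r) (x : ESpace r) : Type :=
  {ω' : Fin (n + 1) → ESpace r // G.PathEquiv ω ω' ∧ ω' (Fin.last n) = x}

open Classical in
/-- The contribution `d_α` of a step from `x` to `y`: `+1` for a step off a hyperplane to the side of
the origin, `-1` for a step on to a hyperplane from the side away from the origin, else `0`. -/
def stepDegree (α x y : ESpace r) : ℤ :=
  (if ∃ c ∈ G.levels, G.On (α, c) x ∧ G.InMinus (α, c) y then 1 else 0) -
    (if ∃ c ∈ G.levels, G.On (α, c) y ∧ G.InPlus (α, c) x then 1 else 0)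

/-- The degree of the subpath `ω_{≤ k}`. -/
def degUpTo {n : ℕ} (ω : Fin (n + 1) → ESpace r) (k : Fin (n + 1)) : ℤ :=
  ∑ i : Fin n with i.castSucc < k, ∑ α ∈ G.pos, G.stepDegree α (ω i.castSucc) (ω i.succ)

/-- The degree of a path. -/
def deg {n : ℕ} (ω : Fin (n + 1) → ESpace r) : ℤ := G.degUpTo ω (Fin.last n)

/-- Admissible paths. The last condition says that a path going from one side of a hyperplane to the
other has a point on the hyperplane; it holds for instance whenever all the numbers
`⟨ρ, α^∨⟩` are integers and all the numbers `⟨ε_i, α^∨⟩` are `0`, `1` or `-1`. -/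
structure IsAdmissible {n : ℕ} (ω : Fin (n + 1) → ESpace r) : Prop where
  deg_eq_zero : ∀ k, G.degUpTo ω k = 0
  orthogonal : ∀ k, ∀ h ∈ G.hyperplanes, ∀ h' ∈ G.hyperplanes, h ≠ h' →
    G.On h (ω k) → G.On h' (ω k) → ⟪h.1, coroot h'.1⟫_ℝ = 0
  no_jump : ∀ i : Fin n, ∀ h ∈ G.hyperplanes,
    0 ≤ G.side h (ω i.castSucc) * G.side h (ω i.succ)

/-! ### Soergel's algorithm and the character algorithm -/

open Classical in
/-- The pattern with a single entry `1`, in the alcove `a`. -/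
def delta (a b : G.Alcove) : ℤ[T;T⁻¹] := if b = a then 1 else 0

open Classical in
/-- One step of the algorithm without cancellation, through the wall between `a` and `a'`: with
`s` the corresponding reflection, the new value at `s · b` is `f(b) + t^{-1} f(s · b)` if
`ℓ(s · b) > ℓ(b)`, and `f(b) + t f(s · b)` if `ℓ(s · b) < ℓ(b)`. Here `c = s · b`. -/
def soergelStep (a a' : G.Alcove) (f : G.Alcove → ℤ[T;T⁻¹]) (c : G.Alcove) : ℤ[T;T⁻¹] :=
  f (G.cross a a' c) +
    (if G.len (G.cross a a' c) < G.len c then LaurentPolynomial.T (-1)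
      else LaurentPolynomial.T 1) * f c

/-- `p` chooses, for each alcove other than the fundamental one, an adjacent alcove of smaller
length. Following `p` down to the fundamental alcove gives for each alcove the chain of alcoves along
which Soergel's algorithm is run. -/
def IsDescent (p : G.Alcove → G.Alcove) : Prop :=
  ∀ a, a ≠ G.fundamental → G.adjacency.Adj (p a) a ∧ G.len (p a) < G.len a

open Classical in
/-- Soergel's algorithm: `n_a(b)`, computed from `n_{p(a)}` by one step followed by the subtraction of
`(n'_a(d)|_{t=0}) n_d` for all alcoves `d` with `ℓ(d) < ℓ(a)`. -/
def soergelN (p : G.Alcove → G.Alcove) (a : G.Alcove) : G.Alcove → ℤ[T;T⁻¹] :=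
  if _h : G.len (p a) < G.len a then
    fun b => G.soergelStep (p a) a (soergelN p (p a)) b -
      ∑ᶠ d : {d : G.Alcove // G.len d < G.len a},
        (G.soergelStep (p a) a (soergelN p (p a)) d.1).coeff 0 • soergelN p d.1 b
  else G.delta a
termination_by G.len a
decreasing_by
  all_goals first | exact _h | exact d.2

open Classical in
/-- The character algorithm along a chain of alcoves `g 0, g 1, …`: the function `e_{g i}`. With `s`
the reflection in the wall between `g i` and `g (i + 1)`, and `c = s · z` shorter than `z`, the new
value at `z` is `(t + t^{-1}) e(z) + e(c)` plus the contributions `(n'_{s · d}(z)|_{t=0}) e(d)` of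
the patterns `n_z` that Soergel's algorithm splits off from the patterns `n_d`, `d ≠ c`,
`ℓ(s · d) > ℓ(d)`. The new value at the other alcoves is `0`. -/
def charE (p : G.Alcove → G.Alcove) (g : ℕ → G.Alcove) : ℕ → G.Alcove → ℤ[T;T⁻¹]
  | 0 => G.delta (g 0)
  | i + 1 => fun z =>
    if G.len (G.cross (g i) (g (i + 1)) z) < G.len z then
      (LaurentPolynomial.T 1 + LaurentPolynomial.T (-1)) * charE p g i z +
        charE p g i (G.cross (g i) (g (i + 1)) z) +
        ∑ᶠ d : {d : G.Alcove // d ≠ G.cross (g i) (g (i + 1)) z ∧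
            G.len d < G.len (G.cross (g i) (g (i + 1)) d)},
          (G.soergelStep (g i) (g (i + 1)) (G.soergelN p d.1) z).coeff 0 • charE p g i d.1
    else 0

/-- `a` is the alcove `A_k` of `ω`: of minimal length among the alcoves which lie beyond all the
hyperplanes that `ω` has met up to the point `ω(k)`. -/
def IsAlcoveAt {n : ℕ} (ω : Fin (n + 1) → ESpace r) (k : Fin (n + 1)) (a : G.Alcove) : Prop :=
  (∀ h ∈ G.hyperplanes, (∃ i ≤ k, G.On h (ω i)) → ∀ x ∈ a.1, G.InPlus h x) ∧
  ∀ b : G.Alcove,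
    (∀ h ∈ G.hyperplanes, (∃ i ≤ k, G.On h (ω i)) → ∀ x ∈ b.1, G.InPlus h x) → G.len a ≤ G.len b

/-- `g 0, …, g N` is an alcove series of `ω`: a chain of adjacent alcoves of increasing length, from
the fundamental alcove to the last alcove `A_n` of `ω`, through all the alcoves `A_k` of `ω`. (If no
step of `ω` is on to more than one hyperplane, then the `g i` are just the `A_k`.) -/
structure IsAlcoveSeries {n : ℕ} (ω : Fin (n + 1) → ESpace r) (N : ℕ) (g : ℕ → G.Alcove) :
    Prop where
  init : g 0 = G.fundamental
  adj : ∀ i < N, G.adjacency.Adj (g i) (g (i + 1)) ∧ G.len (g i) < G.len (g (i + 1))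
  mem : ∀ k, ∃ i ≤ N, G.IsAlcoveAt ω k (g i)
  finish : G.IsAlcoveAt ω (Fin.last n) (g N)

open Classical in
/-- `n_μ(lam)` for `e`-regular points: the value of `n` at their alcoves within a linkage class, and
`0` for points which are not linked. -/
def pointN (p : G.Alcove → G.Alcove) (μ lam : ESpace r) (hμ : G.Regular μ) (hlam : G.Regular lam) :
    ℤ[T;T⁻¹] :=
  if G.Linked μ lam then G.soergelN p (G.alcoveOf μ hμ) (G.alcoveOf lam hlam) else 0

open Classical in
/-- `e_μ(lam)` for `e`-regular points, computed along an alcove series `g 0, …, g N` which ends in the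
alcove of `μ`. -/
def pointE (p : G.Alcove → G.Alcove) (N : ℕ) (g : ℕ → G.Alcove) (μ lam : ESpace r)
    (hlam : G.Regular lam) : ℤ[T;T⁻¹] :=
  if G.Linked μ lam then G.charE p g N (G.alcoveOf lam hlam) else 0

end AlcoveGeometry

/-! ### Soergel-path bases -/

/-- A Soergel-path basis of type `Φ` of the graded cellular algebra `A` with cell datum `D`, for paths
of length `n`. -/
structure SoergelPathBasis {A : Type*} [Ring A] [Algebra ℂ A] {𝒜 : ℤ → Submodule ℂ A}
    [GradedAlgebra 𝒜] {P : Type*} [Fintype P] [PartialOrder P] (D : GradedCellularHW 𝒜 P)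
    {r : ℕ} (G : AlcoveGeometry r) (n : ℕ) where
  /-- the embedding of the weight poset in `E_r` -/
  pt : P ↪ ESpace r
  /-- the distinguished path `ω^μ`, given by its steps -/
  word : P → Fin n → Fin r
  word_end : ∀ μ, AlcoveGeometry.wordPath (word μ) (Fin.last n) = pt μ
  word_deg : ∀ μ k, G.degUpTo (AlcoveGeometry.wordPath (word μ)) k = 0
  admissible : ∀ μ, G.Regular (pt μ) → G.IsAdmissible (AlcoveGeometry.wordPath (word μ))
  /-- the weights include the end points of all the paths obtained from the `ω^μ` -/
  end_mem : ∀ μ ω, G.PathEquiv (AlcoveGeometry.wordPath (word μ)) ω →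
    ∃ lam, pt lam = ω (Fin.last n)
  /-- the bijections `𝒯(lam, μ) → Path(lam, μ)` -/
  toPath : ∀ lam μ, D.Tab lam μ ≃ G.PathsTo (AlcoveGeometry.wordPath (word μ)) (pt lam)
  deg_toPath : ∀ lam μ (S : D.Tab lam μ), G.deg (toPath lam μ S).1 = D.deg S
  toPath_top : ∀ μ, (toPath μ μ (D.top μ)).1 = AlcoveGeometry.wordPath (word μ)

end

/-! For a regular `μ` the graded dimension of `1_μ Δ(λ)` is computed twice. Composition factors give
`∑_κ d_{λκ} Dim L_μ(κ)` (`sum_T_deg`). The path basis gives the sum of `t^{deg}` over the paths that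
arise from `ω^μ` by reflections and end in `λ`. Such paths correspond to the sets of hyperplanes
along which `ω^μ` is folded, and their degrees are the exponents in the expansion of a product
`C_{s_1} ⋯ C_{s_N}` along an alcove series (`IsAlcoveSeries.sum_paths`).

This needs `ω^μ` to meet each hyperplane during a single interval of time and to pass from the side
of the origin to the other side. It does, because `ω^μ` is the only path in `Path(μ, μ)` and has
degree zero (`isTransversal_of_admissible`).

Since `W^e` acts simply transitively on the alcoves, functions on alcoves with finite support form
the regular module of its Hecke algebra. Soergel's algorithm produces the Kazhdan-Lusztig basis
`n_a`, which is characterised by bar invariance and by entries in `t ℤ[t]` off the diagonal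
(`exists_isKL`). The character algorithm expands the product in this basis, with coefficients
invariant under `t ↦ t⁻¹` (`exists_charE`).

Hence, on the linkage class of `μ`, `∑_κ Dim L_μ(κ) d_{·κ} = ∑_b e(b) n_b`. The cellular form makes
`Dim L_μ(κ)` invariant under `t ↦ t⁻¹` (`invert_simpleCharacter`). By induction from larger to
smaller weights, the columns `d_{·κ}` with `κ > μ` are already Kazhdan-Lusztig elements, and their
terms can be subtracted. What remains is `d_{·μ}`, written as a combination of the `n_b` with
self-dual coefficients. It has the entry `1` at `μ` and, by hypothesis, entries in `t ℤ[t]`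
elsewhere, so it is `n_μ` (`eq_single_of_linearCombination`). Comparing coefficients then gives `Dim
L_μ = e_μ`. -/

namespace AlcoveGeometry

variable {r : ℕ} (G : AlcoveGeometry r)

/-! ### Roots and hyperplanes -/

theorem mem_roots_of_pos {α : ESpace r} (h : α ∈ G.pos) : α ∈ G.Φ := by
  obtain ⟨f, _, hf⟩ := G.pos_spec
  exact ((hf α).1 h).1

theorem root_ne_zero {α : ESpace r} (h : α ∈ G.Φ) : α ≠ 0 := fun h0 => G.zero_notMem (h0 ▸ h)

theorem inner_coroot_self {α : ESpace r} (h : α ≠ 0) : ⟪α, coroot α⟫_ℝ = 2 := by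
  have h1 : ⟪α, α⟫_ℝ ≠ 0 := by simpa using h
  rw [coroot, inner_smul_right, div_mul_cancel₀ _ h1]

theorem coroot_ne_zero {α : ESpace r} (h : α ≠ 0) : coroot α ≠ 0 := by
  intro h0
  have := inner_coroot_self h
  simp [h0] at this

theorem neg_root_mem {α : ESpace r} (h : α ∈ G.Φ) : -α ∈ G.Φ := by
  have := G.reflection_mem α h α h
  rw [inner_coroot_self (G.root_ne_zero h)] at this
  convert this using 1
  module

theorem pos_or_neg_pos {α : ESpace r} (h : α ∈ G.Φ) : α ∈ G.pos ∨ -α ∈ G.pos := by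
  obtain ⟨f, h0, hf⟩ := G.pos_spec
  rcases lt_or_gt_of_ne (h0 α h) with h1 | h1
  · exact Or.inr ((hf _).2 ⟨G.neg_root_mem h, by simpa using h1⟩)
  · exact Or.inl ((hf _).2 ⟨h, h1⟩)

theorem pos_eq_of_smul {α β : ESpace r} (hα : α ∈ G.pos) (hβ : β ∈ G.pos) {c : ℝ}
    (h : β = c • α) : β = α := by
  obtain ⟨f, h0, hf⟩ := G.pos_spec
  rcases G.reduced α (G.mem_roots_of_pos hα) c (h ▸ G.mem_roots_of_pos hβ) with h1 | h1
  · simp [h, h1]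
  · have h2 := ((hf α).1 hα).2
    have h3 := ((hf β).1 hβ).2
    rw [h, h1] at h3
    simp at h3
    linarith

theorem coroot_neg (α : ESpace r) : coroot (-α) = -coroot α := by
  simp [coroot]

/-- A reflection is an isometry, so the normalising factor `2 / ⟪β, β⟫` of the coroot does not
change. -/
theorem coroot_reflection {α β : ESpace r} (hα : α ≠ 0) :
    coroot (β - ⟪β, coroot α⟫_ℝ • α) = coroot β - ⟪α, coroot β⟫_ℝ • coroot α := by
  have h1 : ⟪α, α⟫_ℝ ≠ 0 := by simpa using hα
  have h2 : ⟪β - ⟪β, coroot α⟫_ℝ • α, β - ⟪β, coroot α⟫_ℝ • α⟫_ℝ = ⟪β, β⟫_ℝ := by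
    simp only [coroot, inner_sub_left, inner_sub_right, real_inner_smul_left,
      real_inner_smul_right, real_inner_comm β α]
    field_simp
    ring
  rw [coroot, h2]
  simp only [coroot, real_inner_smul_right, real_inner_comm β α]
  rw [smul_sub, smul_smul, smul_smul]
  congr 2
  ring

/-- The linear part of the reflection in `h`. -/
noncomputable def linReflect (α v : ESpace r) : ESpace r := v - ⟪v, coroot α⟫_ℝ • α

theorem reflect_apply (h : ESpace r × ℝ) (x : ESpace r) :
    G.reflect h x = x - G.side h x • h.1 := rfl

theorem reflect_add_smul (k : ESpace r × ℝ) (x v : ESpace r) (c : ℝ) :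
    G.reflect k (x - c • v) = G.reflect k x - c • linReflect k.1 v := by
  simp only [reflect_apply, side, linReflect]
  have : x - c • v + G.ρ = (x + G.ρ) - c • v := by abel
  rw [this, inner_sub_left, real_inner_smul_left]
  module

theorem reflect_reflect (h : ESpace r × ℝ) (x : ESpace r) : G.reflect h (G.reflect h x) = x :=
  G.reflectFun_involutive h x

theorem reflect_mul_self (h : ESpace r × ℝ) : G.reflect h * G.reflect h = 1 :=
  Equiv.ext fun x => G.reflect_reflect h x

theorem reflect_inv (h : ESpace r × ℝ) : (G.reflect h)⁻¹ = G.reflect h :=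
  inv_eq_of_mul_eq_one_left (G.reflect_mul_self h)

theorem hyperplane_ne_zero {h : ESpace r × ℝ} (hh : h ∈ G.hyperplanes) : h.1 ≠ 0 :=
  G.root_ne_zero (G.mem_roots_of_pos hh.1)

/-- The level of a reflected hyperplane is an integral combination of two levels. For `e = ∞` every
level is `0`, and this is preserved. -/
theorem levels_sub {c d : ℝ} (hc : c ∈ G.levels) (hd : d ∈ G.levels) (m : ℤ) :
    c - d * m ∈ G.levels := by
  obtain ⟨i, hi, rfl⟩ := hc
  obtain ⟨j, hj, rfl⟩ := hd
  refine ⟨i - j * m, fun h => by rw [hi h, hj h]; simp, ?_⟩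
  push_cast
  ring

theorem levels_neg {c : ℝ} (hc : c ∈ G.levels) : -c ∈ G.levels := by
  obtain ⟨i, hi, rfl⟩ := hc
  exact ⟨-i, fun h => by rw [hi h]; simp, by push_cast; ring⟩

/-- Hyperplanes are indexed by positive roots only. If the reflected root is negative, root and
level are both negated, and `ε` records this sign. It cancels in products of two side values, which
is all that separation depends on. -/
theorem reflect_hyperplane {k h : ESpace r × ℝ} (hk : k ∈ G.hyperplanes) (hh : h ∈ G.hyperplanes) :
    ∃ h' ∈ G.hyperplanes, ∃ ε : ℝ, ε * ε = 1 ∧ h'.1 = ε • linReflect k.1 h.1 ∧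
      ∀ x, G.side h' (G.reflect k x) = ε * G.side h x := by
  have hk0 := G.hyperplane_ne_zero hk
  obtain ⟨m, hm⟩ := G.integral h.1 (G.mem_roots_of_pos hh.1) k.1 (G.mem_roots_of_pos hk.1)
  have key : ∀ x, ⟪G.reflect k x + G.ρ, coroot (linReflect k.1 h.1)⟫_ℝ - (h.2 - k.2 * m) =
      G.side h x := by
    intro x
    rw [linReflect, coroot_reflection hk0, reflect_apply]
    have : x - G.side k x • k.1 + G.ρ = (x + G.ρ) - G.side k x • k.1 := by abel
    rw [this]
    simp only [inner_sub_left, inner_sub_right, real_inner_smul_left, real_inner_smul_right, hm,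
      inner_coroot_self hk0, side]
    ring
  have hmem : linReflect k.1 h.1 ∈ G.Φ :=
    G.reflection_mem _ (G.mem_roots_of_pos hk.1) _ (G.mem_roots_of_pos hh.1)
  have hl := G.levels_sub hh.2 hk.2 m
  rcases G.pos_or_neg_pos hmem with h1 | h1
  · exact ⟨(linReflect k.1 h.1, h.2 - k.2 * m), ⟨h1, hl⟩, 1, by simp, by simp, fun x => by
      rw [one_mul]; exact key x⟩
  · refine ⟨(-linReflect k.1 h.1, -(h.2 - k.2 * m)), ⟨h1, G.levels_neg hl⟩, -1, by simp, by simp,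
      fun x => ?_⟩
    rw [← key x]
    simp only [side, coroot_neg, inner_neg_right]
    ring

theorem reflect_mem_W {h : ESpace r × ℝ} (hh : h ∈ G.hyperplanes) : G.reflect h ∈ G.W :=
  Subgroup.subset_closure ⟨h, hh, rfl⟩

/-- The image is described both by its sides and by conjugation of its reflection. The second
description determines it, by `reflect_injOn`, so that identities between images of hyperplanes
become identities in the group. -/
theorem exists_image_hyperplane {w : Equiv.Perm (ESpace r)} (hw : w ∈ G.W) :
    ∀ h ∈ G.hyperplanes, ∃ h' ∈ G.hyperplanes, (∃ ε : ℝ, ε * ε = 1 ∧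
      ∀ x, G.side h' (w x) = ε * G.side h x) ∧ G.reflect h' = w * G.reflect h * w⁻¹ := by
  induction hw using Subgroup.closure_induction'' with
  | one => exact fun h hh => ⟨h, hh, ⟨1, by simp, by simp⟩, by simp⟩
  | mem x hx =>
    obtain ⟨k, hk, rfl⟩ := hx
    intro h hh
    obtain ⟨h', hh', ε, hε, h1, h2⟩ := G.reflect_hyperplane hk hh
    refine ⟨h', hh', ⟨ε, hε, h2⟩, ?_⟩
    rw [eq_mul_inv_iff_mul_eq]
    ext1 x
    rw [Equiv.Perm.mul_apply, Equiv.Perm.mul_apply, reflect_apply, h2, h1, G.reflect_apply h x,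
      reflect_add_smul, smul_smul]
    congr 2
    linear_combination G.side h x * hε
  | inv_mem x hx =>
    obtain ⟨k, hk, rfl⟩ := hx
    rw [reflect_inv]
    intro h hh
    obtain ⟨h', hh', ε, hε, h1, h2⟩ := G.reflect_hyperplane hk hh
    refine ⟨h', hh', ⟨ε, hε, h2⟩, ?_⟩
    rw [eq_mul_inv_iff_mul_eq]
    ext1 x
    rw [Equiv.Perm.mul_apply, Equiv.Perm.mul_apply, reflect_apply, h2, h1, G.reflect_apply h x,
      reflect_add_smul, smul_smul]
    congr 2
    linear_combination G.side h x * hε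
  | mul x y hx hy ihx ihy =>
    intro h hh
    obtain ⟨h1, hh1, ⟨ε, hε, h2⟩, h3⟩ := ihy h hh
    obtain ⟨h4, hh4, ⟨δ, hδ, h5⟩, h6⟩ := ihx h1 hh1
    refine ⟨h4, hh4, ⟨δ * ε, by linear_combination hε * (δ * δ) + hδ, fun x => ?_⟩, ?_⟩
    · rw [Equiv.Perm.mul_apply, h5, h2, mul_assoc]
    · rw [h6, h3]; group

/-- The origin is regular, so a reflection moves it by a nonzero multiple of the root. Since the
root system is reduced this displacement determines the positive root, and then its size determines
the level. -/
theorem reflect_injOn : Set.InjOn G.reflect G.hyperplanes := by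
  intro h hh k hk e
  have h1 : ∀ x, G.side h x • h.1 = G.side k x • k.1 := by
    intro x
    have := congrArg (fun w : Equiv.Perm (ESpace r) => w x) e
    simpa only [reflect_apply, sub_right_inj] using this
  have h2 : h.1 = k.1 := by
    have h0 := G.regular_zero h hh
    have := h1 0
    refine G.pos_eq_of_smul hk.1 hh.1 (c := (G.side h 0)⁻¹ * G.side k 0) ?_
    rw [mul_smul, ← this, smul_smul, inv_mul_cancel₀ h0, one_smul]
  have h3 := h1 0
  rw [← h2] at h3
  have h4 := smul_left_injective ℝ (G.hyperplane_ne_zero hh) h3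
  simp only [side, h2] at h4
  exact Prod.ext h2 (by linarith)

theorem On_iff_reflect {h : ESpace r × ℝ} (hh : h ∈ G.hyperplanes) (x : ESpace r) :
    G.On h x ↔ G.reflect h x = x := by
  rw [On, reflect_apply, sub_eq_self, smul_eq_zero]
  simp [G.hyperplane_ne_zero hh]

/-- The set of hyperplanes as a type. -/
abbrev Hyp : Type := {h : ESpace r × ℝ // h ∈ G.hyperplanes}

/-- The image of a hyperplane under an element of `W^e`. -/
noncomputable def act (w : G.W) (h : G.Hyp) : G.Hyp :=
  ⟨(G.exists_image_hyperplane w.2 h.1 h.2).choose,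
    (G.exists_image_hyperplane w.2 h.1 h.2).choose_spec.1⟩

theorem act_side (w : G.W) (h : G.Hyp) : ∃ ε : ℝ, ε * ε = 1 ∧
    ∀ x, G.side (G.act w h).1 (w.1 x) = ε * G.side h.1 x :=
  (G.exists_image_hyperplane w.2 h.1 h.2).choose_spec.2.1

/-- The reflection in a hyperplane, as an element of `W^e`. -/
noncomputable def refl (h : G.Hyp) : G.W := ⟨G.reflect h.1, G.reflect_mem_W h.2⟩

theorem refl_act (w : G.W) (h : G.Hyp) : G.refl (G.act w h) = w * G.refl h * w⁻¹ :=
  Subtype.ext (G.exists_image_hyperplane w.2 h.1 h.2).choose_spec.2.2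

theorem refl_injective : Function.Injective G.refl := fun h k e =>
  Subtype.ext (G.reflect_injOn h.2 k.2 (congrArg Subtype.val e))

theorem refl_mul_self (h : G.Hyp) : G.refl h * G.refl h = 1 :=
  Subtype.ext (G.reflect_mul_self h.1)

theorem refl_inv (h : G.Hyp) : (G.refl h)⁻¹ = G.refl h :=
  inv_eq_of_mul_eq_one_left (G.refl_mul_self h)

theorem act_mul (w v : G.W) (h : G.Hyp) : G.act (w * v) h = G.act w (G.act v h) :=
  G.refl_injective (by simp only [refl_act]; group)

theorem act_one (h : G.Hyp) : G.act 1 h = h :=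
  G.refl_injective (by simp only [refl_act]; group)

theorem act_refl_self (h : G.Hyp) : G.act (G.refl h) h = h :=
  G.refl_injective (by rw [refl_act]; group)

theorem act_inv_act (w : G.W) (h : G.Hyp) : G.act w⁻¹ (G.act w h) = h := by
  rw [← act_mul, inv_mul_cancel, act_one]

theorem act_act_inv (w : G.W) (h : G.Hyp) : G.act w (G.act w⁻¹ h) = h := by
  rw [← act_mul, mul_inv_cancel, act_one]

theorem act_injective (w : G.W) : Function.Injective (G.act w) :=
  Function.LeftInverse.injective (G.act_inv_act w)

/-- The product of the two side functions is invariant under `W^e`. -/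
theorem act_side_mul (w : G.W) (h : G.Hyp) (x y : ESpace r) :
    G.side (G.act w h).1 (w.1 x) * G.side (G.act w h).1 (w.1 y) = G.side h.1 x * G.side h.1 y := by
  obtain ⟨ε, hε, h1⟩ := G.act_side w h
  rw [h1, h1]
  linear_combination G.side h.1 x * G.side h.1 y * hε

theorem act_On (w : G.W) (h : G.Hyp) (x : ESpace r) :
    G.On (G.act w h).1 (w.1 x) ↔ G.On h.1 x := by
  have := G.act_side_mul w h x x
  rw [On, On, ← mul_self_eq_zero, this, mul_self_eq_zero]

theorem side_reflect_self (h : G.Hyp) (x : ESpace r) :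
    G.side h.1 ((G.refl h).1 x) = - G.side h.1 x := by
  change G.side h.1 (x - G.side h.1 x • h.1.1) = _
  have : x - G.side h.1 x • h.1.1 + G.ρ = (x + G.ρ) - G.side h.1 x • h.1.1 := by abel
  rw [side, this, inner_sub_left, real_inner_smul_left,
    inner_coroot_self (G.hyperplane_ne_zero h.2)]
  simp only [side]
  ring

/-! ### Separation -/

/-- The hyperplanes separating two points. -/
def sep (x y : ESpace r) : Set G.Hyp := {h | G.side h.1 x * G.side h.1 y < 0}

theorem mem_sep {x y : ESpace r} {h : G.Hyp} :
    h ∈ G.sep x y ↔ G.side h.1 x * G.side h.1 y < 0 := Iff.rfl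

theorem sep_comm (x y : ESpace r) : G.sep x y = G.sep y x := by
  ext h; rw [mem_sep, mem_sep, mul_comm]

theorem sep_self (x : ESpace r) : G.sep x x = ∅ :=
  Set.eq_empty_of_forall_notMem fun _ h => absurd (G.mem_sep.1 h) (not_lt.2 (mul_self_nonneg _))

theorem act_mem_sep (w : G.W) (h : G.Hyp) (x y : ESpace r) :
    G.act w h ∈ G.sep (w.1 x) (w.1 y) ↔ h ∈ G.sep x y := by
  rw [mem_sep, mem_sep, act_side_mul]

theorem act_image_sep (w : G.W) (x y : ESpace r) :
    G.act w '' G.sep x y = G.sep (w.1 x) (w.1 y) := by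
  ext h
  constructor
  · rintro ⟨k, hk, rfl⟩
    exact (G.act_mem_sep w k x y).2 hk
  · intro hh
    refine ⟨G.act w⁻¹ h, ?_, G.act_act_inv w h⟩
    rwa [← G.act_mem_sep w, act_act_inv]

theorem regular_side {x : ESpace r} (hx : G.Regular x) (h : G.Hyp) : G.side h.1 x ≠ 0 :=
  hx h.1 h.2

theorem mul_neg_iff_xor {a b c : ℝ} (ha : a ≠ 0) (hb : b ≠ 0) (hc : c ≠ 0) :
    a * c < 0 ↔ ¬ (a * b < 0 ↔ b * c < 0) := by
  rcases lt_or_gt_of_ne ha with h1 | h1 <;> rcases lt_or_gt_of_ne hb with h2 | h2 <;>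
    rcases lt_or_gt_of_ne hc with h3 | h3 <;>
    simp [mul_neg_iff, h1, h2, h3, h1.not_gt, h2.not_gt, h3.not_gt]

/-- Signs multiply, so `sep x z` is the symmetric difference of `sep x y` and `sep y z`. All
counting of lengths rests on this form. -/
theorem mem_sep_trans {x y z : ESpace r} (hx : G.Regular x) (hy : G.Regular y) (hz : G.Regular z)
    (h : G.Hyp) : h ∈ G.sep x z ↔ ¬ (h ∈ G.sep x y ↔ h ∈ G.sep y z) :=
  mul_neg_iff_xor (G.regular_side hx h) (G.regular_side hy h) (G.regular_side hz h)

theorem regular_smul (w : G.W) {x : ESpace r} (hx : G.Regular x) : G.Regular (w.1 x) := by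
  intro h hh h0
  refine G.regular_side hx (G.act w⁻¹ ⟨h, hh⟩) ?_
  rw [← On, ← G.act_On w, act_act_inv]
  exact h0

theorem levels_finite (u v : ℝ) : (G.levels ∩ Set.Icc u v).Finite := by
  by_cases he : G.e = ⊤
  · refine (Set.finite_singleton (0 : ℝ)).subset ?_
    rintro c ⟨⟨m, hm, rfl⟩, _⟩
    simp [hm he]
  · have h1 : 1 ≤ G.e.toNat := by
      have h2 := G.e_pos
      obtain ⟨k, hk⟩ := ENat.ne_top_iff_exists.1 he
      rw [← hk] at h2 ⊢
      simpa [Nat.one_le_iff_ne_zero, pos_iff_ne_zero] using h2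
    have h2 : (1 : ℝ) ≤ G.e.toNat := by exact_mod_cast h1
    refine ((Set.finite_Icc (-(⌈|u|⌉ + ⌈|v|⌉)) (⌈|u|⌉ + ⌈|v|⌉)).image
      (fun m : ℤ => (m : ℝ) * (G.e.toNat : ℝ))).subset ?_
    rintro c ⟨⟨m, _, rfl⟩, h3, h4⟩
    refine ⟨m, ?_, rfl⟩
    have h5 : |(m : ℝ)| ≤ |u| + |v| := by
      calc |(m : ℝ)| = |(m : ℝ)| * 1 := by ring
        _ ≤ |(m : ℝ)| * G.e.toNat := by gcongr
        _ = |(m : ℝ) * G.e.toNat| := by rw [abs_mul, Nat.abs_cast]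
        _ ≤ |u| + |v| := by
          rw [abs_le]
          constructor <;> [have := neg_abs_le u; have := le_abs_self v] <;>
            [have := abs_nonneg v; have := abs_nonneg u] <;> linarith
    have h6 : |m| ≤ ⌈|u|⌉ + ⌈|v|⌉ := by
      have := Int.le_ceil |u|
      have := Int.le_ceil |v|
      have : (|m| : ℝ) ≤ ((⌈|u|⌉ + ⌈|v|⌉ : ℤ) : ℝ) := by
        push_cast
        linarith
      exact_mod_cast this
    exact Set.mem_Icc.2 (abs_le.1 h6)

/-- There are finitely many roots, and for each of them the level of a separating hyperplane lies
between the pairings of the two points with the coroot. -/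
theorem sep_finite (x y : ESpace r) : (G.sep x y).Finite := by
  have : (⋃ α ∈ G.pos, (fun c : ℝ => (α, c)) '' (G.levels ∩
      Set.Icc (min ⟪x + G.ρ, coroot α⟫_ℝ ⟪y + G.ρ, coroot α⟫_ℝ)
        (max ⟪x + G.ρ, coroot α⟫_ℝ ⟪y + G.ρ, coroot α⟫_ℝ))).Finite :=
    G.pos.finite_toSet.biUnion fun α _ => (G.levels_finite _ _).image _
  refine Set.Finite.of_finite_image (f := Subtype.val) (this.subset ?_) Subtype.val_injective.injOn
  rintro _ ⟨⟨⟨α, c⟩, hα, hc⟩, hs, rfl⟩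
  refine Set.mem_biUnion hα ⟨c, ⟨hc, ?_⟩, rfl⟩
  simp only [mem_sep, side, mul_neg_iff] at hs
  rw [Set.mem_Icc, min_le_iff, le_max_iff]
  rcases hs with ⟨h1, h2⟩ | ⟨h1, h2⟩
  · exact ⟨Or.inr (by linarith), Or.inl (by linarith)⟩
  · exact ⟨Or.inl (by linarith), Or.inr (by linarith)⟩

/-- Around a point, the hyperplanes not through that point stay away from it. -/
theorem exists_gap (x : ESpace r) : ∃ δ : ℝ, 0 < δ ∧ ∀ h : G.Hyp, ¬ G.On h.1 x →
    δ ≤ |G.side h.1 x| := by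
  have key : ∀ α : ESpace r, ∃ δ : ℝ, 0 < δ ∧ ∀ c ∈ G.levels, G.side (α, c) x ≠ 0 →
      δ ≤ |G.side (α, c) x| := by
    intro α
    set v := ⟪x + G.ρ, coroot α⟫_ℝ with hv
    have hf := (G.levels_finite (v - 1) (v + 1)).subset
      (t := (G.levels ∩ Set.Icc (v - 1) (v + 1)) \ {v}) Set.sdiff_subset
    have h1 : v ∈ ((G.levels ∩ Set.Icc (v - 1) (v + 1)) \ {v})ᶜ := by simp
    obtain ⟨ε, hε, h2⟩ := Metric.isOpen_iff.1 hf.isClosed.isOpen_compl v h1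
    -- The `ε`-ball avoids the other levels in the window of radius `1` around `v`; the bound `1`
    -- keeps `c` in that window.
    refine ⟨min ε 1, lt_min hε one_pos, fun c hc h0 => ?_⟩
    by_contra h3
    rw [not_le, lt_min_iff] at h3
    simp only [side, ← hv] at h3 h0
    have h4 : c ∈ Metric.ball v ε := by
      rw [Metric.mem_ball, dist_comm, Real.dist_eq]; exact h3.1
    refine h2 h4 ⟨⟨hc, ?_⟩, fun h => h0 (by rw [Set.mem_singleton_iff.1 h]; ring)⟩
    have := abs_lt.1 h3.2
    constructor <;> linarith
  choose δ hδ h1 using key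
  by_cases hne : G.pos.Nonempty
  · refine ⟨G.pos.inf' hne δ, (Finset.lt_inf'_iff hne).2 fun α _ => hδ α, fun h hh => ?_⟩
    exact (Finset.inf'_le _ h.2.1).trans (h1 h.1.1 h.1.2 h.2.2 hh)
  · exact ⟨1, one_pos, fun h => absurd ⟨h.1.1, h.2.1⟩ hne⟩

theorem side_add (h : ESpace r × ℝ) (x v : ESpace r) :
    G.side h (x + v) = G.side h x + ⟪v, coroot h.1⟫_ℝ := by
  simp only [side]
  rw [add_right_comm, inner_add_left]
  ring

/-- A small step does not change the side with respect to the hyperplanes not through `x`. -/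
theorem exists_small_step (x v : ESpace r) : ∃ ε : ℝ, 0 < ε ∧ ∀ h : G.Hyp, ¬ G.On h.1 x →
    0 < G.side h.1 x * G.side h.1 (x + ε • v) ∧ 0 < G.side h.1 x * G.side h.1 (x - ε • v) := by
  obtain ⟨δ, hδ, h1⟩ := G.exists_gap x
  set B : ℝ := ∑ α ∈ G.pos, |⟪v, coroot α⟫_ℝ| with hB
  have hB0 : 0 ≤ B := Finset.sum_nonneg fun _ _ => abs_nonneg _
  -- `B` bounds the rate at which any side function changes along `v`, so this step changes it by at
  -- most half the gap `δ`. The summand `1` avoids a division by zero.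
  refine ⟨δ / (2 * (B + 1)), by positivity, fun h hh => ?_⟩
  have h2 := h1 h hh
  have h3 : |⟪v, coroot h.1.1⟫_ℝ| ≤ B :=
    Finset.single_le_sum (f := fun α => |⟪v, coroot α⟫_ℝ|) (fun _ _ => abs_nonneg _) h.2.1
  have h4 : |δ / (2 * (B + 1)) * ⟪v, coroot h.1.1⟫_ℝ| < |G.side h.1 x| := by
    rw [abs_mul, abs_of_nonneg (by positivity)]
    calc δ / (2 * (B + 1)) * |⟪v, coroot h.1.1⟫_ℝ| ≤ δ / (2 * (B + 1)) * (B + 1) := by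
          gcongr; linarith
      _ = δ / 2 := by field_simp
      _ < |G.side h.1 x| := by linarith
  rw [sub_eq_add_neg, ← smul_neg, side_add, side_add, real_inner_smul_left, real_inner_smul_left,
    inner_neg_left]
  set s := G.side h.1 x
  set u := δ / (2 * (B + 1)) * ⟪v, coroot h.1.1⟫_ℝ with hu
  rw [mul_neg, ← hu]
  rcases abs_cases s with ⟨h5, h6⟩ | ⟨h5, h6⟩ <;> rw [h5, abs_lt] at h4
  · constructor <;> apply mul_pos <;> linarith
  · constructor <;> apply mul_pos_of_neg_of_neg <;> linarith

end AlcoveGeometry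

/-! ### Galleries, and the length of an alcove as a number of separating hyperplanes. -/

namespace AlcoveGeometry

variable {r : ℕ} (G : AlcoveGeometry r)

/-! ### Alcoves and the action of `W^e` on them -/

theorem mem_cell {x y : ESpace r} :
    y ∈ G.cell x ↔ ∀ h : G.Hyp, 0 < G.side h.1 x * G.side h.1 y :=
  ⟨fun h k => h k.1 k.2, fun h k hk => h ⟨k, hk⟩⟩

theorem regular_of_mem {a : G.Alcove} {x : ESpace r} (hx : x ∈ a.1) : G.Regular x := by
  obtain ⟨_, y, hy, rfl⟩ := a
  intro h hh h0
  have := hx h hh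
  rw [On] at h0
  simp [h0] at this

theorem mem_cell_self {x : ESpace r} (hx : G.Regular x) : x ∈ G.cell x :=
  fun h hh => mul_self_pos.2 (hx h hh)

theorem sep_eq_empty_iff {x y : ESpace r} (hx : G.Regular x) (hy : G.Regular y) :
    G.sep x y = ∅ ↔ y ∈ G.cell x := by
  rw [mem_cell, Set.eq_empty_iff_forall_notMem]
  refine forall_congr' fun h => ?_
  rw [mem_sep, not_lt]
  exact ⟨fun h1 => lt_of_le_of_ne h1
    (mul_ne_zero (G.regular_side hx h) (G.regular_side hy h)).symm, le_of_lt⟩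

theorem sep_eq_empty_of_mem {a : G.Alcove} {x y : ESpace r} (hx : x ∈ a.1) (hy : y ∈ a.1) :
    G.sep x y = ∅ := by
  have hx' := G.regular_of_mem hx
  have hy' := G.regular_of_mem hy
  obtain ⟨_, z, hz, rfl⟩ := a
  ext h
  rw [G.mem_sep_trans hx' hz hy', G.sep_comm x z, (G.sep_eq_empty_iff hz hx').2 hx,
    (G.sep_eq_empty_iff hz hy').2 hy]
  simp

theorem sep_congr {a b : G.Alcove} {x x' y y' : ESpace r} (hx : x ∈ a.1) (hx' : x' ∈ a.1)
    (hy : y ∈ b.1) (hy' : y' ∈ b.1) : G.sep x y = G.sep x' y' := by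
  ext h
  rw [G.mem_sep_trans (G.regular_of_mem hx) (G.regular_of_mem hx') (G.regular_of_mem hy),
    G.mem_sep_trans (G.regular_of_mem hx') (G.regular_of_mem hy') (G.regular_of_mem hy),
    G.sep_eq_empty_of_mem hx hx', G.sep_eq_empty_of_mem hy' hy]
  simp

/-- A point of an alcove. -/
noncomputable def pt (a : G.Alcove) : ESpace r := (G.alcove_nonempty a).some

theorem pt_mem (a : G.Alcove) : G.pt a ∈ a.1 := (G.alcove_nonempty a).some_mem

theorem pt_regular (a : G.Alcove) : G.Regular (G.pt a) := G.regular_of_mem (G.pt_mem a)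

/-- The hyperplanes separating two alcoves. -/
noncomputable def asep (a b : G.Alcove) : Set G.Hyp := G.sep (G.pt a) (G.pt b)

theorem asep_eq {a b : G.Alcove} {x y : ESpace r} (hx : x ∈ a.1) (hy : y ∈ b.1) :
    G.asep a b = G.sep x y := G.sep_congr (G.pt_mem a) hx (G.pt_mem b) hy

theorem asep_comm (a b : G.Alcove) : G.asep a b = G.asep b a := G.sep_comm _ _

theorem asep_self (a : G.Alcove) : G.asep a a = ∅ := G.sep_self _

theorem asep_finite (a b : G.Alcove) : (G.asep a b).Finite := G.sep_finite _ _

theorem mem_asep_trans (a b c : G.Alcove) (h : G.Hyp) :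
    h ∈ G.asep a c ↔ ¬ (h ∈ G.asep a b ↔ h ∈ G.asep b c) :=
  G.mem_sep_trans (G.pt_regular a) (G.pt_regular b) (G.pt_regular c) h

theorem mem_alcoveOf {x : ESpace r} (hx : G.Regular x) : x ∈ (G.alcoveOf x hx).1 :=
  G.mem_cell_self hx

theorem eq_of_asep_eq_empty {a b : G.Alcove} (h : G.asep a b = ∅) : a = b := by
  have key : ∀ {a b : G.Alcove}, G.asep a b = ∅ → b.1 ⊆ a.1 := by
    intro a b h y hy
    obtain ⟨_, x, hx, rfl⟩ := a
    rw [← G.sep_eq_empty_iff hx (G.regular_of_mem hy)]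
    rw [← h]
    exact (G.asep_eq (G.mem_cell_self hx) hy).symm
  exact Subtype.ext ((key (by rwa [asep_comm])).antisymm (key h))

theorem eq_alcoveOf {a : G.Alcove} {x : ESpace r} (hx : x ∈ a.1) :
    a = G.alcoveOf x (G.regular_of_mem hx) := by
  apply G.eq_of_asep_eq_empty
  rw [G.asep_eq hx (G.mem_alcoveOf _), sep_self]

theorem separates_iff (a b : G.Alcove) (h : G.Hyp) :
    G.Separates h.1 a b ↔ h ∈ G.asep a b := by
  constructor
  · exact fun hs => hs _ (G.pt_mem a) _ (G.pt_mem b)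
  · intro hs x hx y hy
    rw [G.asep_eq hx hy] at hs
    exact hs

theorem adj_iff (a b : G.Alcove) : G.adjacency.Adj a b ↔ ∃ h, G.asep a b = {h} := by
  constructor
  · rintro ⟨h, ⟨h1, h2⟩, h3⟩
    refine ⟨⟨h, h1⟩, Set.ext fun k => ⟨fun hk => ?_, ?_⟩⟩
    · exact Subtype.ext (h3 k.1 ⟨k.2, (G.separates_iff a b k).2 hk⟩)
    · rintro rfl
      exact (G.separates_iff a b _).1 h2
  · rintro ⟨h, hh⟩
    refine ⟨h.1, ⟨h.2, (G.separates_iff a b h).2 (hh ▸ rfl)⟩, ?_⟩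
    rintro k ⟨k1, k2⟩
    have : (⟨k, k1⟩ : G.Hyp) ∈ G.asep a b := (G.separates_iff a b ⟨k, k1⟩).1 k2
    rw [hh] at this
    exact congrArg Subtype.val this

theorem image_cell (w : G.W) (x : ESpace r) : w.1 '' G.cell x = G.cell (w.1 x) := by
  ext y
  constructor
  · rintro ⟨z, hz, rfl⟩
    rw [mem_cell] at hz ⊢
    intro h
    rw [← G.act_act_inv w h, act_side_mul]
    exact hz _
  · intro hy
    refine ⟨w.1⁻¹ y, ?_, by simp⟩
    rw [mem_cell] at hy ⊢
    intro h
    rw [← G.act_side_mul w]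
    simpa using hy (G.act w h)

noncomputable instance : MulAction G.W G.Alcove where
  smul w a := ⟨w.1 '' a.1, by
    obtain ⟨_, x, hx, rfl⟩ := a
    exact ⟨w.1 x, G.regular_smul w hx, G.image_cell w x⟩⟩
  one_smul a := Subtype.ext (by change (1 : Equiv.Perm (ESpace r)) '' a.1 = a.1; simp)
  mul_smul w v a := Subtype.ext (by
    change (w.1 * v.1) '' a.1 = w.1 '' (v.1 '' a.1)
    rw [← Set.image_comp]; rfl)

theorem smul_mem {w : G.W} {a : G.Alcove} {x : ESpace r} (hx : x ∈ a.1) : w.1 x ∈ (w • a).1 :=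
  ⟨x, hx, rfl⟩

theorem act_image_asep (w : G.W) (a b : G.Alcove) :
    G.act w '' G.asep a b = G.asep (w • a) (w • b) := by
  rw [G.asep_eq (G.smul_mem (G.pt_mem a)) (G.smul_mem (G.pt_mem b)), asep, act_image_sep]

theorem refl_separates (h : G.Hyp) (a : G.Alcove) : h ∈ G.asep a (G.refl h • a) := by
  rw [G.asep_eq (G.pt_mem a) (G.smul_mem (G.pt_mem a)), mem_sep, side_reflect_self]
  have := mul_self_pos.2 (G.regular_side (G.pt_regular a) h)
  linarith

theorem side_lineMap (h : ESpace r × ℝ) (x y : ESpace r) (t : ℝ) :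
    G.side h (x + t • (y - x)) = (1 - t) * G.side h x + t * G.side h y := by
  rw [side_add, real_inner_smul_left]
  have : ⟪y - x, coroot h.1⟫_ℝ = G.side h y - G.side h x := by
    simp only [side, inner_sub_left, inner_add_left]; ring
  rw [this]; ring

/-- Two alcoves separated by the single hyperplane `h` are mirror images in `h`. -/
theorem refl_smul_of_asep {a b : G.Alcove} {h : G.Hyp} (hab : G.asep a b = {h}) :
    G.refl h • a = b := by
  set x := G.pt a
  set y := G.pt b
  have hs : h ∈ G.sep x y := by
    have : h ∈ G.asep a b := hab ▸ rfl
    exact this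
  rw [mem_sep] at hs
  set s := G.side h.1 x
  set u := G.side h.1 y
  have hsu : s - u ≠ 0 := fun h0 => by
    rw [sub_eq_zero.1 h0] at hs; exact absurd hs (not_lt.2 (mul_self_nonneg _))
  -- The segment from `x` to `y` meets `h` at the parameter `t`. The meeting point `z` lies on no
  -- other hyperplane, so the two points `z ± ε α` belong to `a` and `b`, and the reflection
  -- exchanges them.
  set t := s / (s - u) with ht
  have ht01 : 0 < t ∧ t < 1 := by
    rcases mul_neg_iff.1 hs with ⟨h1, h2⟩ | ⟨h1, h2⟩
    · exact ⟨div_pos h1 (by linarith), by rw [ht, div_lt_one (by linarith)]; linarith⟩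
    · exact ⟨div_pos_of_neg_of_neg h1 (by linarith),
        by rw [ht, div_lt_one_of_neg (by linarith)]; linarith⟩
  set z := x + t • (y - x) with hz
  have hzh : G.side h.1 z = 0 := by
    rw [hz, side_lineMap]
    change (1 - t) * s + t * u = 0
    rw [ht]; field_simp; ring
  have hzk : ∀ k : G.Hyp, k ≠ h → 0 < G.side k.1 x * G.side k.1 z ∧
      0 < G.side k.1 y * G.side k.1 z ∧ ¬ G.On k.1 z := by
    intro k hk
    have h1 : k ∉ G.sep x y := by
      change k ∉ G.asep a b
      rw [hab]; exact hk
    rw [mem_sep, not_lt] at h1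
    have h2 : 0 < G.side k.1 x * G.side k.1 y := lt_of_le_of_ne h1
      (mul_ne_zero (G.regular_side (G.pt_regular a) k) (G.regular_side (G.pt_regular b) k)).symm
    have h3 := mul_self_pos.2 (G.regular_side (G.pt_regular a) k)
    have h4 := mul_self_pos.2 (G.regular_side (G.pt_regular b) k)
    have h5 : 0 < G.side k.1 x * G.side k.1 z := by
      rw [hz, side_lineMap]
      have := mul_pos (sub_pos.2 ht01.2) h3
      have := mul_pos ht01.1 h2
      nlinarith
    refine ⟨h5, ?_, fun h0 => ?_⟩
    · rw [hz, side_lineMap]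
      have := mul_pos (sub_pos.2 ht01.2) h2
      have := mul_pos ht01.1 h4
      nlinarith
    · rw [On] at h0; rw [h0] at h5; simp at h5
  obtain ⟨ε, hε, hstep⟩ := G.exists_small_step z h.1.1
  have h2 := inner_coroot_self (G.hyperplane_ne_zero h.2)
  have hp : G.side h.1 (z + ε • h.1.1) = 2 * ε := by
    rw [side_add, real_inner_smul_left, h2, hzh]; ring
  have hm : G.side h.1 (z - ε • h.1.1) = -(2 * ε) := by
    rw [sub_eq_add_neg, ← neg_smul, side_add, real_inner_smul_left, h2, hzh]; ring
  have hr : (G.refl h).1 (z + ε • h.1.1) = z - ε • h.1.1 := by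
    change (z + ε • h.1.1) - G.side h.1 (z + ε • h.1.1) • h.1.1 = _
    rw [hp]; module
  have hr' : (G.refl h).1 (z - ε • h.1.1) = z + ε • h.1.1 := by
    change (z - ε • h.1.1) - G.side h.1 (z - ε • h.1.1) • h.1.1 = _
    rw [hm]; module
  have hregp : G.Regular (z + ε • h.1.1) := by
    intro k hk h0
    by_cases hkh : (⟨k, hk⟩ : G.Hyp) = h
    · rw [← hkh] at hp
      rw [On] at h0
      rw [← hkh] at h0
      rw [h0] at hp; linarith
    · have := (hstep ⟨k, hk⟩ (hzk _ hkh).2.2).1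
      rw [On] at h0
      rw [h0] at this; simp at this
  have hregm : G.Regular (z - ε • h.1.1) := hr ▸ G.regular_smul (G.refl h) hregp
  -- the two points near `z` lie in `a` and `b`
  have side_of : ∀ {v : ESpace r}, (v = z + ε • h.1.1 ∨ v = z - ε • h.1.1) → ∀ {c : G.Alcove},
      (∀ k : G.Hyp, k ≠ h → 0 < G.side k.1 (G.pt c) * G.side k.1 z) →
      0 < G.side h.1 (G.pt c) * G.side h.1 v → v ∈ c.1 := by
    intro v hv c hc hh
    have hvr : G.Regular v := by rcases hv with rfl | rfl <;> assumption
    rw [G.eq_alcoveOf (G.pt_mem c)]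
    change v ∈ G.cell (G.pt c)
    rw [mem_cell]
    intro k
    by_cases hk : k = h
    · rw [hk]; exact hh
    · have h1 := hc k hk
      have h2 : 0 < G.side k.1 z * G.side k.1 v := by
        rcases hv with rfl | rfl
        exacts [(hstep k (hzk k hk).2.2).1, (hstep k (hzk k hk).2.2).2]
      have h3 : 0 < (G.side k.1 (G.pt c) * G.side k.1 v) * (G.side k.1 z * G.side k.1 z) := by
        calc 0 < (G.side k.1 (G.pt c) * G.side k.1 z) * (G.side k.1 z * G.side k.1 v) :=
              mul_pos h1 h2
          _ = _ := by ring
      exact pos_of_mul_pos_left h3 (mul_self_nonneg _)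
  rcases mul_neg_iff.1 hs with ⟨h3, h4⟩ | ⟨h3, h4⟩
  · have hp' : z + ε • h.1.1 ∈ a.1 := side_of (Or.inl rfl) (fun k hk => (hzk k hk).1)
      (by rw [hp]; exact mul_pos h3 (by linarith))
    have hm' : z - ε • h.1.1 ∈ b.1 := side_of (Or.inr rfl) (fun k hk => (hzk k hk).2.1)
      (by rw [hm]; exact mul_pos_of_neg_of_neg h4 (by linarith))
    have := G.smul_mem (w := G.refl h) hp'
    rw [hr] at this
    rw [G.eq_alcoveOf this, ← G.eq_alcoveOf hm']
  · have hp' : z + ε • h.1.1 ∈ b.1 := side_of (Or.inl rfl) (fun k hk => (hzk k hk).2.1)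
      (by rw [hp]; exact mul_pos h4 (by linarith))
    have hm' : z - ε • h.1.1 ∈ a.1 := side_of (Or.inr rfl) (fun k hk => (hzk k hk).1)
      (by rw [hm]; exact mul_pos_of_neg_of_neg h3 (by linarith))
    have := G.smul_mem (w := G.refl h) hm'
    rw [hr'] at this
    rw [G.eq_alcoveOf this, ← G.eq_alcoveOf hp']

/-! ### Galleries -/

/-- An alcove contains a point from which the segments to `x` cross the hyperplanes one at a time. -/
theorem exists_generic_point {x : ESpace r} (hx : G.Regular x) (b : G.Alcove) :
    ∃ y ∈ b.1, ∀ h ∈ G.sep x (G.pt b), ∀ k ∈ G.sep x (G.pt b), h ≠ k →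
      G.side h.1 x * G.side k.1 y ≠ G.side k.1 x * G.side h.1 y := by
  have hfin := (G.sep_finite x (G.pt b))
  have : Finite (G.sep x (G.pt b)) := hfin
  let ι := {p : G.sep x (G.pt b) × G.sep x (G.pt b) // p.1 ≠ p.2}
  -- The condition to be achieved is that certain affine functions of `y` do not vanish; `cv p` is
  -- their linear part. If it were zero, the two roots would be proportional, hence equal, and then
  -- the levels would agree as well.
  let cv : ι → ESpace r := fun p => G.side p.1.1.1.1 x • coroot p.1.2.1.1.1 -
    G.side p.1.2.1.1 x • coroot p.1.1.1.1.1
  have hcv : ∀ p, cv p ≠ 0 := by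
    rintro ⟨⟨⟨h, hh⟩, ⟨k, hk⟩⟩, hne⟩ h0
    have hne' : h ≠ k := fun h1 => hne (by subst h1; rfl)
    have h1 : G.side h.1 x • coroot k.1.1 = G.side k.1 x • coroot h.1.1 := sub_eq_zero.1 h0
    have hx1 := G.regular_side hx h
    have hx2 := G.regular_side hx k
    have hk0 := G.hyperplane_ne_zero k.2
    have hh0 := G.hyperplane_ne_zero h.2
    have hkk : ⟪k.1.1, k.1.1⟫_ℝ ≠ 0 := by simpa using hk0
    have h2 : k.1.1 = h.1.1 := by
      refine G.pos_eq_of_smul h.2.1 k.2.1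
        (c := (G.side h.1 x * (2 / ⟪k.1.1, k.1.1⟫_ℝ))⁻¹ *
          (G.side k.1 x * (2 / ⟪h.1.1, h.1.1⟫_ℝ))) ?_
      simp only [coroot, smul_smul] at h1
      rw [mul_smul, ← h1, smul_smul, inv_mul_cancel₀, one_smul]
      exact mul_ne_zero hx1 (div_ne_zero two_ne_zero hkk)
    rw [h2] at h1
    have h3 := smul_left_injective ℝ (coroot_ne_zero hh0) h1
    simp only [side, h2] at h3
    exact hne' (Subtype.ext (Prod.ext h2.symm (by linarith)))
  -- Finitely many nonzero linear forms have a common vector on which none vanishes.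
  obtain ⟨v, hv⟩ := Module.Dual.exists_forall_ne_zero_of_forall_exists
    (K := ℝ) (fun p : ι => (innerₗ (ESpace r)) (cv p)) (fun p => ⟨cv p, by
      simpa using hcv p⟩)
  obtain ⟨ε, hε, hstep⟩ := G.exists_small_step (G.pt b) v
  set y := G.pt b
  have hyr := G.pt_regular b
  let L : ι → ℝ → ℝ := fun p τ => G.side p.1.1.1.1 x * G.side p.1.2.1.1 (y + τ • (ε • v)) -
    G.side p.1.2.1.1 x * G.side p.1.1.1.1 (y + τ • (ε • v))
  have hL : ∀ p τ, L p τ = L p 0 + τ * (ε * ⟪cv p, v⟫_ℝ) := by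
    intro p τ
    simp only [L, cv, side_add, real_inner_smul_left, inner_sub_right,
      real_inner_smul_right, zero_mul, add_zero, real_inner_comm v]
    ring
  -- Along the direction `v` each affine function is nonconstant and so vanishes for at most one
  -- `τ`.
  have hbad : (⋃ p : ι, {τ : ℝ | L p τ = 0}).Finite := by
    refine Set.finite_iUnion fun p => ?_
    refine Set.Subsingleton.finite fun τ hτ σ hσ => ?_
    have h1 : L p τ = 0 := hτ
    have h2 : L p σ = 0 := hσ
    rw [hL] at h1 h2
    have h3 : ε * ⟪cv p, v⟫_ℝ ≠ 0 := mul_ne_zero hε.ne' (hv p)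
    have h4 : (τ - σ) * (ε * ⟪cv p, v⟫_ℝ) = 0 := by linarith
    rcases mul_eq_zero.1 h4 with h5 | h5
    · linarith
    · exact absurd h5 h3
  obtain ⟨τ, hτ, hτ'⟩ := ((Set.Ioo_infinite (zero_lt_one' ℝ)).sdiff hbad).nonempty
  refine ⟨y + τ • (ε • v), ?_, ?_⟩
  · rw [G.eq_alcoveOf (G.pt_mem b)]
    change _ ∈ G.cell y
    rw [mem_cell]
    intro h
    have h1 := (hstep h (hyr h.1 h.2)).1
    have h2 : y + τ • (ε • v) = y + τ • ((y + ε • v) - y) := by simp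
    rw [h2, side_lineMap]
    have h3 := mul_self_pos.2 (G.regular_side hyr h)
    have := mul_pos (sub_pos.2 hτ.2) h3
    have := mul_pos hτ.1 h1
    nlinarith
  · intro h hh k hk hne h0
    refine hτ' (Set.mem_iUnion.2 ⟨⟨⟨⟨h, hh⟩, ⟨k, hk⟩⟩, fun h1 => hne ?_⟩, ?_⟩)
    · exact congrArg Subtype.val h1
    · exact sub_eq_zero.2 h0

/-- On the segment from a point of `a` to a generic point of `b` the hyperplanes are crossed at
distinct times. Just after the first crossing the segment lies in an alcove separated from `a` by
that hyperplane alone. -/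
theorem exists_adj_toward {a b : G.Alcove} (hab : a ≠ b) :
    ∃ (a' : G.Alcove) (h : G.Hyp), G.asep a a' = {h} ∧ h ∈ G.asep a b := by
  set x := G.pt a
  have hx := G.pt_regular a
  obtain ⟨y, hy, hgen⟩ := G.exists_generic_point hx b
  have hyr := G.regular_of_mem hy
  have hsep : G.sep x (G.pt b) = G.sep x y := G.sep_congr (G.pt_mem a) (G.pt_mem a) (G.pt_mem b) hy
  have hsep' : G.asep a b = G.sep x y := hsep
  rw [hsep] at hgen
  have hfin := G.sep_finite x y
  have hne : (G.sep x y).Nonempty := by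
    rw [Set.nonempty_iff_ne_empty, ← hsep']
    exact fun h => hab (G.eq_of_asep_eq_empty h)
  -- The time at which the segment crosses `h`.
  let t : G.Hyp → ℝ := fun h => G.side h.1 x / (G.side h.1 x - G.side h.1 y)
  have hsub : ∀ h ∈ G.sep x y, G.side h.1 x - G.side h.1 y ≠ 0 := by
    intro h hh h0
    rw [mem_sep, sub_eq_zero.1 h0] at hh
    exact absurd hh (not_lt.2 (mul_self_nonneg _))
  have hinj : ∀ h ∈ G.sep x y, ∀ k ∈ G.sep x y, h ≠ k → t h ≠ t k := by
    intro h hh k hk hne h0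
    refine hgen h hh k hk hne ?_
    simp only [t] at h0
    rw [div_eq_div_iff (hsub h hh) (hsub k hk)] at h0
    linarith
  have ht01 : ∀ h ∈ G.sep x y, 0 < t h ∧ t h < 1 := by
    intro h hh
    rcases mul_neg_iff.1 (G.mem_sep.1 hh) with ⟨h1, h2⟩ | ⟨h1, h2⟩
    · exact ⟨div_pos h1 (by linarith), (div_lt_one (by linarith)).2 (by linarith)⟩
    · exact ⟨div_pos_of_neg_of_neg h1 (by linarith),
        (div_lt_one_of_neg (by linarith)).2 (by linarith)⟩
  obtain ⟨h, hh, hmin⟩ := Set.exists_min_image (G.sep x y) t hfin hne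
  have hev : ∀ᶠ τ in nhdsWithin (t h) (Set.Ioi (t h)),
      (τ ∈ Set.Ioo (t h) 1) ∧ ∀ k ∈ G.sep x y \ {h}, τ ∈ Set.Ioo (t h) (t k) := by
    refine Filter.Eventually.and (Ioo_mem_nhdsGT (ht01 h hh).2) ?_
    rw [Filter.eventually_all_finite (hfin.subset Set.sdiff_subset)]
    rintro k ⟨hk, hkh⟩
    exact Ioo_mem_nhdsGT (lt_of_le_of_ne (hmin k hk) (hinj h hh k hk fun h0 => hkh h0.symm))
  obtain ⟨τ, ⟨hτ1, hτ2⟩, hτ3⟩ := hev.exists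
  have hτ0 : 0 < τ := (ht01 h hh).1.trans hτ1
  set z := x + τ • (y - x) with hz
  -- the sign of the side of `z` is governed by the position of `τ` relative to `t k`
  have hside : ∀ k ∈ G.sep x y, G.side k.1 x * G.side k.1 z =
      (G.side k.1 x - G.side k.1 y) * G.side k.1 x * (t k - τ) := by
    intro k hk
    rw [hz, side_lineMap]
    have h1 : t k * (G.side k.1 x - G.side k.1 y) = G.side k.1 x := div_mul_cancel₀ _ (hsub k hk)
    linear_combination (-G.side k.1 x) * h1
  have hpos : ∀ k ∈ G.sep x y, 0 < (G.side k.1 x - G.side k.1 y) * G.side k.1 x := by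
    intro k hk
    have h1 := mul_self_pos.2 (G.regular_side hx k)
    rw [mem_sep] at hk
    linarith
  have hh_sep : h ∈ G.sep x z := by
    rw [mem_sep, hside h hh]
    exact mul_neg_of_pos_of_neg (hpos h hh) (by linarith)
  have hother : ∀ k, k ≠ h → 0 < G.side k.1 x * G.side k.1 z := by
    intro k hk
    by_cases hks : k ∈ G.sep x y
    · rw [hside k hks]
      exact mul_pos (hpos k hks) (sub_pos.2 (hτ3 k ⟨hks, hk⟩).2)
    · rw [mem_sep, not_lt] at hks
      rw [hz, side_lineMap]
      have h1 := mul_self_pos.2 (G.regular_side hx k)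
      have := mul_pos (sub_pos.2 hτ2) h1
      have := mul_nonneg hτ0.le hks
      nlinarith
  have hzr : G.Regular z := by
    intro k hk h0
    rw [On] at h0
    by_cases hkh : (⟨k, hk⟩ : G.Hyp) = h
    · rw [mem_sep, ← hkh] at hh_sep
      simp [h0] at hh_sep
    · have := hother ⟨k, hk⟩ hkh
      simp [h0] at this
  refine ⟨G.alcoveOf z hzr, h, ?_, hsep' ▸ hh⟩
  rw [G.asep_eq (G.pt_mem a) (G.mem_alcoveOf hzr)]
  ext k
  constructor
  · intro hk
    by_contra hkh
    exact absurd hk (not_lt.2 (hother k hkh).le)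
  · rintro rfl
    exact hh_sep

/-- The number of hyperplanes separating two alcoves. -/
noncomputable def nsep (a b : G.Alcove) : ℕ := (G.asep a b).ncard

theorem nsep_comm (a b : G.Alcove) : G.nsep a b = G.nsep b a := by rw [nsep, asep_comm, nsep]

theorem nsep_eq_zero {a b : G.Alcove} : G.nsep a b = 0 ↔ a = b := by
  rw [nsep, Set.ncard_eq_zero (G.asep_finite a b)]
  exact ⟨G.eq_of_asep_eq_empty, fun h => h ▸ G.asep_self a⟩

theorem asep_of_adj_mem {a a' b : G.Alcove} {h : G.Hyp} (h1 : G.asep a a' = {h})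
    (h2 : h ∈ G.asep a b) : G.asep a' b = G.asep a b \ {h} := by
  ext k
  rw [G.mem_asep_trans a' a b, G.asep_comm a' a, h1]
  by_cases hk : k = h
  · subst hk; simp [h2]
  · simp [hk]

theorem asep_of_adj_notMem {a a' b : G.Alcove} {h : G.Hyp} (h1 : G.asep a a' = {h})
    (h2 : h ∉ G.asep a b) : G.asep a' b = insert h (G.asep a b) := by
  ext k
  rw [G.mem_asep_trans a' a b, G.asep_comm a' a, h1]
  by_cases hk : k = h
  · subst hk; simp [h2]
  · simp [hk]

theorem nsep_of_adj_mem {a a' b : G.Alcove} {h : G.Hyp} (h1 : G.asep a a' = {h})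
    (h2 : h ∈ G.asep a b) : G.nsep a' b + 1 = G.nsep a b := by
  rw [nsep, G.asep_of_adj_mem h1 h2, Set.ncard_sdiff_singleton_add_one h2 (G.asep_finite a b), nsep]

theorem nsep_of_adj_notMem {a a' b : G.Alcove} {h : G.Hyp} (h1 : G.asep a a' = {h})
    (h2 : h ∉ G.asep a b) : G.nsep a' b = G.nsep a b + 1 := by
  rw [nsep, G.asep_of_adj_notMem h1 h2, Set.ncard_insert_of_notMem h2 (G.asep_finite a b), nsep]

theorem exists_walk (a b : G.Alcove) : ∃ p : G.adjacency.Walk a b, p.length = G.nsep a b := by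
  induction h : G.nsep a b generalizing a with
  | zero =>
    obtain rfl := G.nsep_eq_zero.1 h
    exact ⟨SimpleGraph.Walk.nil, rfl⟩
  | succ m ih =>
    have hab : a ≠ b := fun h0 => by rw [G.nsep_eq_zero.2 h0] at h; simp at h
    obtain ⟨a', k, h1, h2⟩ := G.exists_adj_toward hab
    have h3 := G.nsep_of_adj_mem h1 h2
    obtain ⟨p, hp⟩ := ih a' (by omega)
    exact ⟨SimpleGraph.Walk.cons ((G.adj_iff a a').2 ⟨k, h1⟩) p, by simp [hp]⟩

theorem nsep_le_walk {a b : G.Alcove} (p : G.adjacency.Walk a b) : G.nsep a b ≤ p.length := by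
  induction p with
  | nil => exact (G.nsep_eq_zero.2 rfl).le
  | @cons a a' b hadj p ih =>
    obtain ⟨h, h1⟩ := (G.adj_iff a a').1 hadj
    rw [SimpleGraph.Walk.length_cons]
    by_cases h2 : h ∈ G.asep a b
    · have := G.nsep_of_adj_mem h1 h2; omega
    · have := G.nsep_of_adj_notMem h1 h2; omega

/-- One step of a gallery adds or removes exactly one separating hyperplane, and by
`exists_adj_toward` a step that removes one is always available. -/
theorem dist_eq_nsep (a b : G.Alcove) : G.adjacency.dist a b = G.nsep a b := by
  obtain ⟨p, hp⟩ := G.exists_walk a b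
  apply le_antisymm
  · rw [← hp]; exact SimpleGraph.dist_le p
  · obtain ⟨q, hq⟩ := p.reachable.exists_walk_length_eq_dist
    rw [← hq]; exact G.nsep_le_walk q

theorem len_eq (a : G.Alcove) : G.len a = G.nsep G.fundamental a := G.dist_eq_nsep _ _

theorem len_eq_zero {a : G.Alcove} : G.len a = 0 ↔ a = G.fundamental := by
  rw [len_eq, nsep_eq_zero, eq_comm]

/-- Crossing a wall changes the length by one, according to the side of the origin. -/
theorem len_of_asep_mem {a a' : G.Alcove} {h : G.Hyp} (h1 : G.asep a a' = {h})
    (h2 : h ∈ G.asep G.fundamental a) : G.len a' + 1 = G.len a := by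
  rw [len_eq, len_eq, G.nsep_comm _ a', G.nsep_comm _ a]
  exact G.nsep_of_adj_mem h1 (by rwa [asep_comm])

theorem len_of_asep_notMem {a a' : G.Alcove} {h : G.Hyp} (h1 : G.asep a a' = {h})
    (h2 : h ∉ G.asep G.fundamental a) : G.len a' = G.len a + 1 := by
  rw [len_eq, len_eq, G.nsep_comm _ a', G.nsep_comm _ a]
  exact G.nsep_of_adj_notMem h1 (by rwa [asep_comm])

theorem len_lt_iff {a a' : G.Alcove} {h : G.Hyp} (h1 : G.asep a a' = {h}) :
    G.len a' < G.len a ↔ h ∈ G.asep G.fundamental a := by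
  by_cases h2 : h ∈ G.asep G.fundamental a
  · have := G.len_of_asep_mem h1 h2
    simp only [h2, iff_true]; omega
  · have := G.len_of_asep_notMem h1 h2
    simp only [h2, iff_false]; omega

theorem len_lt_iff' {a a' : G.Alcove} {h : G.Hyp} (h1 : G.asep a a' = {h}) :
    G.len a < G.len a' ↔ h ∉ G.asep G.fundamental a := by
  by_cases h2 : h ∈ G.asep G.fundamental a
  · have := G.len_of_asep_mem h1 h2
    simp only [h2, not_true, iff_false]; omega
  · have := G.len_of_asep_notMem h1 h2
    simp only [h2, not_false_eq_true, iff_true]; omega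

theorem exists_descent : ∃ p, G.IsDescent p := by
  have : ∀ a : G.Alcove, ∃ b, a ≠ G.fundamental → G.adjacency.Adj b a ∧ G.len b < G.len a := by
    intro a
    by_cases ha : a = G.fundamental
    · exact ⟨a, fun h => absurd ha h⟩
    · obtain ⟨b, h, h1, h2⟩ := G.exists_adj_toward ha
      refine ⟨b, fun _ => ⟨((G.adj_iff a b).2 ⟨h, h1⟩).symm, ?_⟩⟩
      rw [G.len_lt_iff h1, asep_comm]; exact h2
  choose p hp using this
  exact ⟨p, hp⟩

end AlcoveGeometry

/-! ### The group `W^e` generated by the reflections in the walls of the fundamental alcove. -/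

namespace AlcoveGeometry

variable {r : ℕ} (G : AlcoveGeometry r)

/-! ### Simple transitivity on alcoves -/

/-- The walls of the fundamental alcove. -/
abbrev Wall : Type := {h : G.Hyp // G.asep G.fundamental (G.refl h • G.fundamental) = {h}}

/-- The reflection in a wall of the fundamental alcove. -/
noncomputable def simpleRefl (i : G.Wall) : G.W := G.refl i.1

theorem simpleRefl_mul_self (i : G.Wall) : G.simpleRefl i * G.simpleRefl i = 1 :=
  G.refl_mul_self i.1

theorem asep_smul_simpleRefl (w : G.W) (i : G.Wall) :
    G.asep (w • G.fundamental) ((w * G.simpleRefl i) • G.fundamental) = {G.act w i.1} := by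
  have h : G.asep G.fundamental (G.simpleRefl i • G.fundamental) = {i.1} := i.2
  rw [mul_smul, ← act_image_asep, h, Set.image_singleton]

/-- The wall of the fundamental alcove carried by `w` to a wall of `w • a₀`. -/
theorem exists_wall {w : G.W} {b : G.Alcove} {h : G.Hyp} (hh : G.asep (w • G.fundamental) b = {h}) :
    ∃ i : G.Wall, h = G.act w i.1 ∧ b = (w * G.simpleRefl i) • G.fundamental := by
  have h1 : G.asep G.fundamental (w⁻¹ • b) = {G.act w⁻¹ h} := by
    have := G.act_image_asep w⁻¹ (w • G.fundamental) b
    rw [hh, Set.image_singleton, inv_smul_smul] at this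
    exact this.symm
  have h2 := G.refl_smul_of_asep h1
  refine ⟨⟨G.act w⁻¹ h, by rw [h2, h1]⟩, (G.act_act_inv w h).symm, ?_⟩
  rw [mul_smul, simpleRefl, h2, smul_inv_smul]

theorem exists_toward_fundamental {w : G.W} (hw : w • G.fundamental ≠ G.fundamental) :
    ∃ i : G.Wall, G.act w i.1 ∈ G.asep G.fundamental (w • G.fundamental) ∧
      G.nsep G.fundamental ((w * G.simpleRefl i) • G.fundamental) + 1 =
        G.nsep G.fundamental (w • G.fundamental) := by
  obtain ⟨b, h, h1, h2⟩ := G.exists_adj_toward hw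
  obtain ⟨i, rfl, rfl⟩ := G.exists_wall h1
  refine ⟨i, by rwa [asep_comm], ?_⟩
  rw [G.nsep_comm _ (_ • _), G.nsep_comm _ (w • _)]
  exact G.nsep_of_adj_mem h1 h2

theorem exists_mem_closure_smul (b : G.Alcove) :
    ∃ w ∈ Subgroup.closure (Set.range G.simpleRefl), w • G.fundamental = b := by
  induction h : G.nsep G.fundamental b generalizing b with
  | zero => exact ⟨1, one_mem _, by rw [one_smul, G.nsep_eq_zero.1 h]⟩
  | succ m ih =>
    have hb : b ≠ G.fundamental := fun h0 => by
      rw [G.nsep_eq_zero.2 h0.symm] at h; simp at h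
    obtain ⟨b', k, h1, h2⟩ := G.exists_adj_toward hb
    have h3 := G.nsep_of_adj_mem h1 h2
    rw [G.nsep_comm b', G.nsep_comm b] at h3
    obtain ⟨w, hw, rfl⟩ := ih b' (by omega)
    rw [asep_comm] at h1
    obtain ⟨i, _, hb⟩ := G.exists_wall h1
    exact ⟨_, mul_mem hw (Subgroup.subset_closure ⟨i, rfl⟩), hb.symm⟩

theorem exists_smul_fundamental (b : G.Alcove) : ∃ w : G.W, w • G.fundamental = b := by
  obtain ⟨w, _, h⟩ := G.exists_mem_closure_smul b
  exact ⟨w, h⟩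

/-- A gallery from `b` back to the fundamental alcove crosses `h`. At the crossing `h` is a wall of
an alcove `w • a₀`, with `w` a product of simple reflections. Consequently every reflection is
conjugate to a simple one inside the subgroup these generate. -/
theorem exists_act_wall (h : G.Hyp) (b : G.Alcove) (hb : h ∈ G.asep G.fundamental b) :
    ∃ w ∈ Subgroup.closure (Set.range G.simpleRefl), ∃ i : G.Wall, h = G.act w i.1 := by
  induction hm : G.nsep G.fundamental b generalizing b with
  | zero =>
    rw [G.nsep_eq_zero.1 hm, asep_self] at hb
    exact absurd hb (Set.notMem_empty _)
  | succ m ih =>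
    have hne : b ≠ G.fundamental := fun h0 => by
      rw [G.nsep_eq_zero.2 h0.symm] at hm; simp at hm
    obtain ⟨w, hw, rfl⟩ := G.exists_mem_closure_smul b
    obtain ⟨b', k, h1, h2⟩ := G.exists_adj_toward hne
    obtain ⟨i, hk, hb'⟩ := G.exists_wall h1
    by_cases hkh : h = k
    · exact ⟨w, hw, i, hkh.trans hk⟩
    · refine ih b' ?_ ?_
      · rw [asep_comm, G.asep_of_adj_mem h1 h2]
        exact ⟨by rwa [asep_comm], hkh⟩
      · have h3 := G.nsep_of_adj_mem h1 h2
        rw [G.nsep_comm b', G.nsep_comm (w • _)] at h3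
        omega

theorem closure_simpleRefl : Subgroup.closure (Set.range G.simpleRefl) = ⊤ := by
  have h1 : ∀ h : G.Hyp, G.refl h ∈ Subgroup.closure (Set.range G.simpleRefl) := by
    intro h
    obtain ⟨w, hw, i, rfl⟩ := G.exists_act_wall h _ (G.refl_separates h G.fundamental)
    rw [refl_act]
    exact mul_mem (mul_mem hw (Subgroup.subset_closure ⟨i, rfl⟩)) (inv_mem hw)
  rw [eq_top_iff]
  have h2 : Subgroup.closure ((Subtype.val : G.W → _) ⁻¹' (G.reflect '' G.hyperplanes)) = ⊤ :=
    Subgroup.closure_closure_coe_preimage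
  rw [← h2, Subgroup.closure_le]
  rintro w ⟨h, hh, hw⟩
  have : w = G.refl ⟨h, hh⟩ := Subtype.ext hw.symm
  rw [this]
  exact h1 _

/-- The element of `W^e` given by a word in the simple reflections. -/
noncomputable def wordProd (l : List G.Wall) : G.W := (l.map G.simpleRefl).prod

theorem exists_wordProd (w : G.W) : ∃ l, G.wordProd l = w := by
  have hw : w ∈ Subgroup.closure (Set.range G.simpleRefl) := by
    rw [closure_simpleRefl]; trivial
  induction hw using Subgroup.closure_induction'' with
  | one => exact ⟨[], rfl⟩
  | mem x hx =>
    obtain ⟨i, rfl⟩ := hx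
    exact ⟨[i], by simp [wordProd]⟩
  | inv_mem x hx =>
    obtain ⟨i, rfl⟩ := hx
    exact ⟨[i], by simp [wordProd, simpleRefl, refl_inv]⟩
  | mul x y _ _ hx hy =>
    obtain ⟨l, rfl⟩ := hx
    obtain ⟨m, rfl⟩ := hy
    exact ⟨l ++ m, by simp [wordProd]⟩

/-- A gallery which leaves the far side of `h` crosses `h`. -/
theorem exists_crossing (h : G.Hyp) (l : List G.Wall) (u : G.W)
    (h1 : h ∈ G.asep G.fundamental (u • G.fundamental))
    (h2 : h ∉ G.asep G.fundamental ((u * G.wordProd l) • G.fundamental)) :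
    ∃ l₁ j l₂, l = l₁ ++ j :: l₂ ∧ G.act (u * G.wordProd l₁) j.1 = h := by
  induction l generalizing u with
  | nil => simp [wordProd] at h2; exact absurd h1 h2
  | cons j l ih =>
    by_cases h3 : h ∈ G.asep G.fundamental ((u * G.simpleRefl j) • G.fundamental)
    · obtain ⟨l₁, k, l₂, h4, h5⟩ := ih (u * G.simpleRefl j) h3
        (by simpa [wordProd, mul_assoc] using h2)
      refine ⟨j :: l₁, k, l₂, by simp [h4], ?_⟩
      rw [← h5]; simp [wordProd, mul_assoc]
    · refine ⟨[], j, l, rfl, ?_⟩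
      have h4 := G.mem_asep_trans G.fundamental (u • G.fundamental)
        ((u * G.simpleRefl j) • G.fundamental) h
      rw [asep_smul_simpleRefl] at h4
      simp only [h1, h3, true_iff, false_iff, not_not, Set.mem_singleton_iff] at h4
      simp [wordProd, ← h4]

/-- Deletion argument: a closed gallery that first crosses the wall `i` must cross the same
hyperplane again, say with the letter `j`. Removing both letters leaves the product unchanged and
shortens the word. -/
theorem wordProd_eq_one (l : List G.Wall) (hl : G.wordProd l • G.fundamental = G.fundamental) :
    G.wordProd l = 1 := by
  induction hm : l.length using Nat.strong_induction_on generalizing l with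
  | _ m ih =>
    cases l with
    | nil => rfl
    | cons i l =>
      have hi : G.wordProd (i :: l) = G.simpleRefl i * G.wordProd l := by simp [wordProd]
      rw [hi] at hl ⊢
      have h1 : i.1 ∈ G.asep G.fundamental (G.simpleRefl i • G.fundamental) :=
        G.refl_separates _ _
      obtain ⟨l₁, j, l₂, rfl, h2⟩ := G.exists_crossing i.1 l (G.simpleRefl i) h1
        (by rw [hl, asep_self]; exact Set.notMem_empty _)
      have h3 := congrArg G.refl h2
      rw [refl_act] at h3
      have h4 : G.simpleRefl i * G.wordProd l₁ * G.simpleRefl j = G.wordProd l₁ := by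
        have : G.simpleRefl i * (G.simpleRefl i * G.wordProd l₁) =
            G.simpleRefl i * G.wordProd l₁ * G.simpleRefl j :=
          (mul_inv_eq_iff_eq_mul.1 h3).symm
        rw [← this, ← mul_assoc, simpleRefl_mul_self, one_mul]
      have h5 : G.simpleRefl i * G.wordProd (l₁ ++ j :: l₂) = G.wordProd (l₁ ++ l₂) := by
        have : G.wordProd (l₁ ++ j :: l₂) = G.wordProd l₁ * (G.simpleRefl j * G.wordProd l₂) := by
          simp [wordProd]
        rw [this, ← mul_assoc, ← mul_assoc, h4]
        simp [wordProd]
      rw [h5] at hl ⊢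
      exact ih _ (by rw [← hm]; simp) _ hl rfl

theorem eq_one_of_smul_fundamental {w : G.W} (h : w • G.fundamental = G.fundamental) : w = 1 := by
  obtain ⟨l, rfl⟩ := G.exists_wordProd w
  exact G.wordProd_eq_one l h

theorem smul_left_injective (a : G.Alcove) : Function.Injective fun w : G.W => w • a := by
  intro v w h
  obtain ⟨u, rfl⟩ := G.exists_smul_fundamental a
  have h1 : (u⁻¹ * w⁻¹ * v * u) • G.fundamental = G.fundamental := by
    have h' : v • u • G.fundamental = w • u • G.fundamental := h
    simp only [mul_smul]
    rw [h', inv_smul_smul, inv_smul_smul]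
  have h2 := G.eq_one_of_smul_fundamental h1
  have h3 : w⁻¹ * v = 1 := by
    have : u * (u⁻¹ * w⁻¹ * v * u) * u⁻¹ = u * 1 * u⁻¹ := by rw [h2]
    simpa [mul_assoc] using this
  exact (inv_mul_eq_one.1 h3).symm

theorem exists_smul_eq (a b : G.Alcove) : ∃ w : G.W, w • a = b := by
  obtain ⟨u, rfl⟩ := G.exists_smul_fundamental a
  obtain ⟨v, rfl⟩ := G.exists_smul_fundamental b
  exact ⟨v * u⁻¹, by rw [mul_smul, inv_smul_smul]⟩

/-- `W^e` acts simply transitively on the alcoves. -/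
noncomputable def alcoveEquiv : G.W ≃ G.Alcove :=
  Equiv.ofBijective (fun w => w • G.fundamental)
    ⟨G.smul_left_injective G.fundamental, G.exists_smul_fundamental⟩

theorem alcoveEquiv_apply (w : G.W) : G.alcoveEquiv w = w • G.fundamental := rfl

/-! ### Crossing walls -/

/-- The group element chosen in `cross` is forced, because the action on alcoves is simply
transitive. -/
theorem cross_smul (a a' : G.Alcove) (w : G.W) : G.cross a a' (w • a) = w • a' := by
  have h : ∃ b' : G.Alcove, ∃ v ∈ G.W, v '' a.1 = (w • a).1 ∧ v '' a'.1 = b'.1 :=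
    ⟨w • a', w.1, w.2, rfl, rfl⟩
  rw [cross, dif_pos h]
  obtain ⟨v, hv, h1, h2⟩ := h.choose_spec
  have h3 : (⟨v, hv⟩ : G.W) = w := G.smul_left_injective a (Subtype.ext h1)
  exact (Subtype.ext h2.symm : _ = (⟨v, hv⟩ : G.W) • a').trans (congrArg (· • a') h3)

/-- `W^e` acts on alcoves from the left; crossing walls of a given type is right multiplication by a
simple reflection. -/
theorem cross_eq_simple {a a' : G.Alcove} (h : G.adjacency.Adj a a') :
    ∃ i : G.Wall, ∀ w : G.W,
      G.cross a a' (w • G.fundamental) = (w * G.simpleRefl i) • G.fundamental := by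
  obtain ⟨u, rfl⟩ := G.exists_smul_fundamental a
  obtain ⟨k, hk⟩ := (G.adj_iff _ _).1 h
  obtain ⟨i, _, rfl⟩ := G.exists_wall hk
  refine ⟨i, fun w => ?_⟩
  have : w • G.fundamental = (w * u⁻¹) • u • G.fundamental := by rw [mul_smul, inv_smul_smul]
  rw [this, cross_smul, ← mul_smul]
  congr 1
  group

theorem cross_left (a a' : G.Alcove) : G.cross a a' a = a' := by
  have := G.cross_smul a a' 1
  rwa [one_smul, one_smul] at this

theorem cross_involutive {a a' : G.Alcove} (h : G.adjacency.Adj a a') :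
    Function.Involutive (G.cross a a') := by
  intro b
  obtain ⟨i, hi⟩ := G.cross_eq_simple h
  obtain ⟨w, rfl⟩ := G.exists_smul_fundamental b
  rw [hi, hi, mul_assoc, simpleRefl_mul_self, mul_one]

theorem asep_cross {a a' : G.Alcove} {h : G.Hyp} (hh : G.asep a a' = {h}) (w : G.W) :
    G.asep (w • a) (G.cross a a' (w • a)) = {G.act w h} := by
  rw [cross_smul, ← act_image_asep, hh, Set.image_singleton]

theorem len_adj {a b : G.Alcove} (h : G.adjacency.Adj a b) :
    G.len b = G.len a + 1 ∨ G.len a = G.len b + 1 := by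
  obtain ⟨k, hk⟩ := (G.adj_iff _ _).1 h
  by_cases h2 : k ∈ G.asep G.fundamental a
  · exact Or.inr (G.len_of_asep_mem hk h2).symm
  · exact Or.inl (G.len_of_asep_notMem hk h2)

end AlcoveGeometry

/-! ### The bar involution of the regular Hecke module -/

/-- The properties of the length function `ℓ` of a group `W` generated by involutions `s i` which
make the Hecke algebra well behaved. -/
structure IsHeckeLength {W I : Type*} [Group W] (s : I → W) (ℓ : W → ℕ) : Prop where
  mul_self : ∀ i, s i * s i = 1
  inv : ∀ w, ℓ w⁻¹ = ℓ w
  step : ∀ w i, ℓ (w * s i) = ℓ w + 1 ∨ ℓ w = ℓ (w * s i) + 1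
  descent : ∀ w, w ≠ 1 → ∃ i, ℓ (w * s i) < ℓ w
  exchange : ∀ i j w, ℓ (s j * w) = ℓ (w * s i) → ℓ (s j * w * s i) = ℓ w → s j * w = w * s i

namespace IsHeckeLength

open LaurentPolynomial

variable {W I : Type*} [Group W] {s : I → W} {ℓ : W → ℕ}

/-- The scalar by which `C_i` acts on the diagonal: `t` at an ascent and `t⁻¹` at a descent. -/
noncomputable def scalar (ℓ : W → ℕ) (w v : W) : ℤ[T;T⁻¹] := if ℓ w < ℓ v then T 1 else T (-1)

/-- Right multiplication by the Kazhdan-Lusztig generator `C_i`. -/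
noncomputable def rightC (s : I → W) (ℓ : W → ℕ) (i : I) : Module.End ℤ[T;T⁻¹] (W →₀ ℤ[T;T⁻¹]) :=
  Finsupp.linearCombination ℤ[T;T⁻¹] fun w =>
    Finsupp.single (w * s i) 1 + scalar ℓ w (w * s i) • Finsupp.single w 1

/-- Left multiplication by the Kazhdan-Lusztig generator `C_j`. -/
noncomputable def leftC (s : I → W) (ℓ : W → ℕ) (j : I) : Module.End ℤ[T;T⁻¹] (W →₀ ℤ[T;T⁻¹]) :=
  Finsupp.linearCombination ℤ[T;T⁻¹] fun w =>
    Finsupp.single (s j * w) 1 + scalar ℓ w (s j * w) • Finsupp.single w 1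

theorem rightC_single (i : I) (w : W) : rightC s ℓ i (Finsupp.single w 1) =
    Finsupp.single (w * s i) 1 + scalar ℓ w (w * s i) • Finsupp.single w 1 := by
  simp [rightC]

theorem leftC_single (j : I) (w : W) : leftC s ℓ j (Finsupp.single w 1) =
    Finsupp.single (s j * w) 1 + scalar ℓ w (s j * w) • Finsupp.single w 1 := by
  simp [leftC]

theorem end_ext {W : Type*} {X Y : Module.End ℤ[T;T⁻¹] (W →₀ ℤ[T;T⁻¹])}
    (h : ∀ w, X (Finsupp.single w 1) = Y (Finsupp.single w 1)) : X = Y :=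
  Finsupp.lhom_ext' fun w => LinearMap.ext_ring (h w)

theorem mul_mul_self (hs : IsHeckeLength s ℓ) (w : W) (i : I) : w * s i * s i = w := by
  rw [mul_assoc, hs.mul_self, mul_one]

theorem self_mul_mul (hs : IsHeckeLength s ℓ) (w : W) (j : I) : s j * (s j * w) = w := by
  rw [← mul_assoc, hs.mul_self, one_mul]

theorem inv_gen (hs : IsHeckeLength s ℓ) (i : I) : (s i)⁻¹ = s i := inv_eq_of_mul_eq_one_left (hs.mul_self i)

theorem step_left (hs : IsHeckeLength s ℓ) (w : W) (j : I) : ℓ (s j * w) = ℓ w + 1 ∨ ℓ w = ℓ (s j * w) + 1 := by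
  have := hs.step w⁻¹ j
  rw [hs.inv, ← hs.inv (w⁻¹ * s j), mul_inv_rev, inv_inv, hs.inv_gen] at this
  exact this

theorem descent_left (hs : IsHeckeLength s ℓ) (w : W) (hw : w ≠ 1) : ∃ j, ℓ (s j * w) < ℓ w := by
  obtain ⟨j, hj⟩ := hs.descent w⁻¹ (by simpa using hw)
  rw [hs.inv, ← hs.inv (w⁻¹ * s j), mul_inv_rev, inv_inv, hs.inv_gen] at hj
  exact ⟨j, hj⟩

/-- Both compositions involve the same four elements `w`, `s j * w`, `w * s i`, `s j * w * s i`. The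
length change under `s i` is the same before and after applying `s j`, and conversely, except in the
configuration covered by `exchange`. There `s j * w = w * s i`, and both operators act on the same
pair of elements. -/
theorem leftC_comm_rightC (hs : IsHeckeLength s ℓ) (i j : I) : leftC s ℓ j * rightC s ℓ i = rightC s ℓ i * leftC s ℓ j := by
  refine end_ext fun w => ?_
  have h1 := hs.step w i
  have h2 := hs.step_left w j
  have h3 := hs.step (s j * w) i
  have h4 := hs.step_left (w * s i) j
  rw [← mul_assoc] at h4
  simp only [Module.End.mul_apply, rightC_single, leftC_single, map_add, map_smul, mul_assoc]
  by_cases he : s j * w = w * s i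
  · have h5 : s j * (w * s i) = w := by rw [← mul_assoc, he, hs.mul_mul_self]
    simp only [he, h5]
  · have h6 : ¬ (ℓ (s j * w) = ℓ (w * s i) ∧ ℓ (s j * w * s i) = ℓ w) :=
      fun h => he (hs.exchange i j w h.1 h.2)
    have e1 : scalar ℓ (s j * w) (s j * (w * s i)) = scalar ℓ w (w * s i) := by
      rw [← mul_assoc, scalar, scalar]
      refine if_congr ?_ rfl rfl
      omega
    have e2 : scalar ℓ (w * s i) (s j * (w * s i)) = scalar ℓ w (s j * w) := by
      rw [← mul_assoc, scalar, scalar]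
      refine if_congr ?_ rfl rfl
      omega
    rw [e1, e2]
    simp only [smul_add, smul_smul, mul_comm (scalar ℓ w (w * s i))]
    abel

theorem rightC_apply (hs : IsHeckeLength s ℓ) (i : I) (f : W →₀ ℤ[T;T⁻¹]) (w : W) : rightC s ℓ i f w =
    f (w * s i) + (if ℓ (w * s i) < ℓ w then T (-1) else T 1) * f w := by
  classical
  induction f using Finsupp.induction_linear with
  | zero => simp
  | add f g hf hg => simp only [map_add, Finsupp.add_apply, hf, hg]; ring
  | single v a =>
    have h0 : (Finsupp.single v a : W →₀ ℤ[T;T⁻¹]) = a • Finsupp.single v 1 := by simp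
    rw [h0, map_smul, rightC_single]
    simp only [Finsupp.smul_apply, Finsupp.add_apply, Finsupp.single_apply, smul_eq_mul]
    have h1 : v * s i = w ↔ v = w * s i := by
      constructor <;> rintro rfl <;> rw [hs.mul_mul_self]
    by_cases hvw : v = w
    · subst hvw
      have h2 := hs.step v i
      have h3 : ¬ v * s i = v := fun h => by rw [h] at h2; omega
      have h4 : ¬ v = v * s i := fun h => h3 h.symm
      simp only [h3, h4, if_false, if_true, scalar]
      by_cases h5 : ℓ v < ℓ (v * s i)
      · rw [if_pos h5, if_neg (by omega)]; ring
      · rw [if_neg h5, if_pos (by omega)]; ring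
    · simp only [h1, hvw, if_false]
      split_ifs <;> ring

/-- The diagonal scalars at `w` and `w * s i` are `t` and `t⁻¹` in some order, and their product is
`1`. -/
theorem rightC_mul_self (hs : IsHeckeLength s ℓ) (i : I) :
    rightC s ℓ i * rightC s ℓ i = ((T 1 + T (-1) : ℤ[T;T⁻¹])) • rightC s ℓ i := by
  refine LinearMap.ext fun f => Finsupp.ext fun w => ?_
  have h1 := hs.step w i
  have hT : (T 1 * T (-1) : ℤ[T;T⁻¹]) = 1 := by rw [← T_add]; simp
  rw [Module.End.mul_apply, LinearMap.smul_apply, Finsupp.smul_apply]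
  simp only [hs.rightC_apply, hs.mul_mul_self, smul_eq_mul]
  by_cases h2 : ℓ (w * s i) < ℓ w
  · rw [if_pos h2, if_neg (by omega)]
    linear_combination (-f w) * hT
  · rw [if_neg h2, if_pos (by omega)]
    linear_combination (-f w) * hT

/-- Right multiplication by the standard generator `H_i`. -/
noncomputable def rightH (hs : IsHeckeLength s ℓ) (i : I) : (Module.End ℤ[T;T⁻¹] (W →₀ ℤ[T;T⁻¹]))ˣ where
  val := rightC s ℓ i - (T 1 : ℤ[T;T⁻¹]) • 1
  inv := rightC s ℓ i - (T (-1) : ℤ[T;T⁻¹]) • 1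
  -- The quadratic relation gives `(C_i - t)(C_i - t⁻¹) = C_i² - (t + t⁻¹) C_i + 1 = 1`.
  val_inv := by
    have hT : (T (-1) * T 1 : ℤ[T;T⁻¹]) = 1 := by rw [← T_add]; simp
    refine LinearMap.ext fun f => ?_
    have h := LinearMap.congr_fun (hs.rightC_mul_self i) f
    simp only [Module.End.mul_apply, LinearMap.smul_apply] at h
    simp only [Module.End.mul_apply, LinearMap.sub_apply, LinearMap.smul_apply,
      Module.End.one_apply, map_sub, map_smul, h, smul_sub, smul_smul, hT, add_smul, one_smul]
    abel
  inv_val := by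
    have hT : (T 1 * T (-1) : ℤ[T;T⁻¹]) = 1 := by rw [← T_add]; simp
    refine LinearMap.ext fun f => ?_
    have h := LinearMap.congr_fun (hs.rightC_mul_self i) f
    simp only [Module.End.mul_apply, LinearMap.smul_apply] at h
    simp only [Module.End.mul_apply, LinearMap.sub_apply, LinearMap.smul_apply,
      Module.End.one_apply, map_sub, map_smul, h, smul_sub, smul_smul, hT, add_smul, one_smul]
    abel

theorem rightH_val (hs : IsHeckeLength s ℓ) (i : I) : (hs.rightH i).1 = rightC s ℓ i - (T 1 : ℤ[T;T⁻¹]) • 1 := rfl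

theorem rightH_inv (hs : IsHeckeLength s ℓ) (i : I) :
    (hs.rightH i)⁻¹.1 = rightC s ℓ i - (T (-1) : ℤ[T;T⁻¹]) • 1 := rfl

theorem rightH_single (hs : IsHeckeLength s ℓ) {i : I} {w : W} (h : ℓ w < ℓ (w * s i)) :
    (hs.rightH i).1 (Finsupp.single w 1) = Finsupp.single (w * s i) 1 := by
  rw [rightH_val, LinearMap.sub_apply, rightC_single, scalar, if_pos h]
  simp

theorem leftC_single_sub {j : I} {w : W} (h : ℓ w < ℓ (s j * w)) :
    leftC s ℓ j (Finsupp.single w 1) - (T 1 : ℤ[T;T⁻¹]) • Finsupp.single w 1 =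
      Finsupp.single (s j * w) 1 := by
  rw [leftC_single, scalar, if_pos h]
  simp

/-- An endomorphism commuting with the left multiplications is determined by its value at `1`. -/
theorem eq_of_comm (hs : IsHeckeLength s ℓ) {X Y : Module.End ℤ[T;T⁻¹] (W →₀ ℤ[T;T⁻¹])}
    (hX : ∀ j, Commute (leftC s ℓ j) X) (hY : ∀ j, Commute (leftC s ℓ j) Y)
    (h : X (Finsupp.single 1 1) = Y (Finsupp.single 1 1)) : X = Y := by
  refine end_ext fun w => ?_
  induction hm : ℓ w using Nat.strong_induction_on generalizing w with
  | _ m ih =>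
    by_cases hw : w = 1
    · rw [hw, h]
    · obtain ⟨j, hj⟩ := hs.descent_left w hw
      have h1 : ℓ (s j * w) < ℓ (s j * (s j * w)) := by rwa [hs.self_mul_mul]
      have h2 := leftC_single_sub h1
      rw [hs.self_mul_mul] at h2
      have h3 := ih _ (hm ▸ hj) (s j * w) rfl
      have hX' := LinearMap.congr_fun (hX j).eq (Finsupp.single (s j * w) 1)
      have hY' := LinearMap.congr_fun (hY j).eq (Finsupp.single (s j * w) 1)
      simp only [Module.End.mul_apply] at hX' hY'
      rw [← h2, map_sub, map_sub, map_smul, map_smul, ← hX', ← hY', h3]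

theorem comm_rightH (hs : IsHeckeLength s ℓ) (i j : I) : Commute (leftC s ℓ j) (hs.rightH i).1 := by
  refine LinearMap.ext fun f => ?_
  have h := LinearMap.congr_fun (hs.leftC_comm_rightC i j) f
  simp only [Module.End.mul_apply] at h
  simp only [rightH_val, Module.End.mul_apply, LinearMap.sub_apply, LinearMap.smul_apply,
    Module.End.one_apply, map_sub, map_smul, h]

/-- The operators `H_i` are composed along a reduced word of `w`. By `eq_of_comm` the result does
not depend on the word, so no braid relations have to be checked. -/
theorem exists_rightMul (hs : IsHeckeLength s ℓ) (w : W) : ∃ X : (Module.End ℤ[T;T⁻¹] (W →₀ ℤ[T;T⁻¹]))ˣ,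
    (∀ j, Commute (leftC s ℓ j) X.1) ∧ X.1 (Finsupp.single 1 1) = Finsupp.single w 1 := by
  induction hm : ℓ w using Nat.strong_induction_on generalizing w with
  | _ m ih =>
    by_cases hw : w = 1
    · exact ⟨1, fun j => Commute.one_right _, by rw [hw]; rfl⟩
    · obtain ⟨i, hi⟩ := hs.descent w hw
      obtain ⟨X, h1, h2⟩ := ih _ (hm ▸ hi) (w * s i) rfl
      refine ⟨hs.rightH i * X, fun j => (hs.comm_rightH i j).mul_right (h1 j), ?_⟩
      rw [Units.val_mul, Module.End.mul_apply, h2, hs.rightH_single, hs.mul_mul_self]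
      rwa [hs.mul_mul_self]

/-- Right multiplication by the standard basis element `H_w`. -/
noncomputable def rightMul (hs : IsHeckeLength s ℓ) (w : W) : (Module.End ℤ[T;T⁻¹] (W →₀ ℤ[T;T⁻¹]))ˣ :=
  (hs.exists_rightMul w).choose

theorem rightMul_comm (hs : IsHeckeLength s ℓ) (w : W) (j : I) : Commute (leftC s ℓ j) (hs.rightMul w).1 :=
  (hs.exists_rightMul w).choose_spec.1 j

theorem rightMul_one (hs : IsHeckeLength s ℓ) (w : W) : (hs.rightMul w).1 (Finsupp.single 1 1) = Finsupp.single w 1 :=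
  (hs.exists_rightMul w).choose_spec.2

theorem length_one (hs : IsHeckeLength s ℓ) : ∀ i, ℓ 1 < ℓ (s i) := by
  -- a descent of `1` and the left descents of `s i` would both contradict the step property
  intro i
  have h1 := hs.step 1 i
  rw [one_mul] at h1
  rcases h1 with h1 | h1
  · omega
  · exfalso
    have key : ∀ m, ∀ w, ℓ w = m → ℓ 1 ≤ m := by
      intro m
      induction m using Nat.strong_induction_on with
      | _ m ih =>
        intro w hw
        by_cases hw1 : w = 1
        · rw [← hw, hw1]
        · obtain ⟨k, hk⟩ := hs.descent w hw1
          exact (ih _ (hw ▸ hk) _ rfl).trans (hw ▸ hk).le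
    have := key _ (s i) rfl
    omega

/-- Both sides commute with left multiplication, so it suffices to compare them at `1`. The factors
appear in the opposite order because right multiplications compose contravariantly. -/
theorem rightMul_mul_left (hs : IsHeckeLength s ℓ) {j : I} {w : W} (h : ℓ w < ℓ (s j * w)) :
    hs.rightMul (s j * w) = hs.rightMul w * hs.rightH j := by
  refine Units.ext (hs.eq_of_comm (hs.rightMul_comm _)
    (fun k => (hs.rightMul_comm w k).mul_right (hs.comm_rightH j k)) ?_)
  have h1 : (hs.rightH j).1 (Finsupp.single 1 1) =
      leftC s ℓ j (Finsupp.single 1 1) - (T 1 : ℤ[T;T⁻¹]) • Finsupp.single 1 1 := by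
    have h2 : ℓ 1 < ℓ (1 * s j) := by rw [one_mul]; exact hs.length_one j
    have h3 : ℓ 1 < ℓ (s j * 1) := by rw [mul_one]; exact hs.length_one j
    rw [hs.rightH_single h2, leftC_single_sub h3, one_mul, mul_one]
  have h4 := LinearMap.congr_fun (hs.rightMul_comm w j).eq (Finsupp.single 1 1)
  simp only [Module.End.mul_apply] at h4
  rw [rightMul_one, Units.val_mul, Module.End.mul_apply, h1, map_sub, map_smul, ← h4,
    rightMul_one, leftC_single_sub h]

/-- The image of the standard basis element `H_w` under the bar involution. -/
noncomputable def barBasis (hs : IsHeckeLength s ℓ) (w : W) : W →₀ ℤ[T;T⁻¹] :=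
  -- The bar involution sends `H_w` to the inverse of `H_{w⁻¹}`.
  (hs.rightMul w⁻¹)⁻¹.1 (Finsupp.single 1 1)

theorem barBasis_one (hs : IsHeckeLength s ℓ) : hs.barBasis 1 = Finsupp.single 1 1 := by
  have h : hs.rightMul 1 = 1 := by
    refine Units.ext (hs.eq_of_comm (hs.rightMul_comm _) (fun k => Commute.one_right _) ?_)
    rw [rightMul_one]; rfl
  rw [barBasis, inv_one, h, inv_one]; rfl

/-- The inverse of `H_i` is `C_i - t⁻¹`, and passing to `w⁻¹` turns the right ascent of `w` into a
left ascent, so `rightMul_mul_left` applies. -/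
theorem barBasis_mul (hs : IsHeckeLength s ℓ) {i : I} {w : W} (h : ℓ w < ℓ (w * s i)) :
    hs.barBasis (w * s i) =
      rightC s ℓ i (hs.barBasis w) - (T (-1) : ℤ[T;T⁻¹]) • hs.barBasis w := by
  have h1 : ℓ w⁻¹ < ℓ (s i * w⁻¹) := by
    rw [hs.inv, ← hs.inv (s i * w⁻¹), mul_inv_rev, inv_inv, hs.inv_gen]; exact h
  rw [barBasis, mul_inv_rev, hs.inv_gen, hs.rightMul_mul_left h1, mul_inv_rev, Units.val_mul,
    Module.End.mul_apply, ← barBasis, rightH_inv]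
  simp

/-- Induction along a descent `i` of `w`: `C_i` carries the leading term at `w * s i` to `w`, and
every other contribution stays at smaller length. -/
theorem barBasis_triangular (hs : IsHeckeLength s ℓ) (w : W) : hs.barBasis w w = 1 ∧
    ∀ v, v ≠ w → ℓ w ≤ ℓ v → hs.barBasis w v = 0 := by
  induction hm : ℓ w using Nat.strong_induction_on generalizing w with
  | _ m ih =>
    subst hm
    by_cases hw : w = 1
    · subst hw
      rw [barBasis_one]
      exact ⟨by simp, fun v hv _ => Finsupp.single_eq_of_ne hv⟩
    · obtain ⟨i, hi⟩ := hs.descent w hw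
      obtain ⟨h1, h2⟩ := ih _ hi (w * s i) rfl
      have h3 : ℓ (w * s i) < ℓ (w * s i * s i) := by rwa [hs.mul_mul_self]
      have h4 := hs.barBasis_mul h3
      rw [hs.mul_mul_self] at h4
      have h5 : w ≠ w * s i := fun h => by rw [← h] at hi; omega
      have hst := hs.step w i
      refine ⟨?_, fun v hv hl => ?_⟩
      · rw [h4, Finsupp.sub_apply, Finsupp.smul_apply, hs.rightC_apply, h1, h2 w h5 (by omega)]
        simp
      · have h6 : v ≠ w * s i := fun h => by rw [← h] at hi; omega
        have h7 : v * s i ≠ w * s i := fun h => hv (mul_right_cancel h)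
        have h8 := hs.step v i
        rw [h4, Finsupp.sub_apply, Finsupp.smul_apply, hs.rightC_apply, h2 v h6 (by omega),
          h2 _ h7 (by omega)]
        simp

/-- The bar involution on the regular module of the Hecke algebra. -/
noncomputable def bar (hs : IsHeckeLength s ℓ) : (W →₀ ℤ[T;T⁻¹]) →+ (W →₀ ℤ[T;T⁻¹]) :=
  Finsupp.liftAddHom fun w =>
    (((LinearMap.id : ℤ[T;T⁻¹] →ₗ[ℤ[T;T⁻¹]] ℤ[T;T⁻¹]).smulRight (hs.barBasis w)).toAddMonoidHom).comp
      (invert : ℤ[T;T⁻¹] ≃ₐ[ℤ] ℤ[T;T⁻¹]).toAddEquiv.toAddMonoidHom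

theorem bar_single (hs : IsHeckeLength s ℓ) (w : W) (a : ℤ[T;T⁻¹]) :
    hs.bar (Finsupp.single w a) = invert a • hs.barBasis w := by
  simp [bar]

theorem bar_smul (hs : IsHeckeLength s ℓ) (a : ℤ[T;T⁻¹]) (f : W →₀ ℤ[T;T⁻¹]) : hs.bar (a • f) = invert a • hs.bar f := by
  induction f using Finsupp.induction_linear with
  | zero => simp
  | add f g hf hg => rw [smul_add, map_add, hf, hg, map_add, smul_add]
  | single w b => rw [Finsupp.smul_single, bar_single, bar_single, smul_eq_mul, map_mul, mul_smul]

/-- `C_i` is bar invariant. At an ascent this is `barBasis_mul`; a descent is reduced to an ascent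
by the quadratic relation. -/
theorem bar_rightC (hs : IsHeckeLength s ℓ) (i : I) (f : W →₀ ℤ[T;T⁻¹]) :
    hs.bar (rightC s ℓ i f) = rightC s ℓ i (hs.bar f) := by
  have hT : (T 1 * T (-1) : ℤ[T;T⁻¹]) = 1 := by rw [← T_add]; simp
  induction f using Finsupp.induction_linear with
  | zero => simp
  | add f g hf hg => simp only [map_add, hf, hg]
  | single w b =>
    have h0 : (Finsupp.single w b : W →₀ ℤ[T;T⁻¹]) = b • Finsupp.single w 1 := by simp
    rw [h0, map_smul, bar_smul, bar_smul, map_smul]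
    congr 1
    rw [rightC_single, map_add, bar_smul, bar_single, bar_single, map_one, one_smul, one_smul]
    rcases hs.step w i with h | h
    · rw [hs.barBasis_mul (by omega), scalar, if_pos (by omega), invert_T]
      simp
    · have h1 : ℓ (w * s i) < ℓ (w * s i * s i) := by rw [hs.mul_mul_self]; omega
      have h2 := hs.barBasis_mul h1
      rw [hs.mul_mul_self] at h2
      have h3 := LinearMap.congr_fun (hs.rightC_mul_self i) (hs.barBasis (w * s i))
      rw [Module.End.mul_apply, LinearMap.smul_apply] at h3
      rw [h2, map_sub, map_smul, h3, scalar, if_neg (by omega), invert_T, neg_neg, smul_sub,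
        smul_smul, hT, add_smul, one_smul]
      abel

/-- By triangularity only the term of `w` itself contributes at a position of maximal length. The
uniqueness of Kazhdan-Lusztig elements depends on this. -/
theorem bar_apply_of_top (hs : IsHeckeLength s ℓ) (f : W →₀ ℤ[T;T⁻¹]) (w : W) (h : ∀ v, f v ≠ 0 → ℓ v ≤ ℓ w) :
    hs.bar f w = invert (f w) := by
  have h1 : hs.bar f = f.sum fun v a => invert a • hs.barBasis v := by
    rw [bar, Finsupp.liftAddHom_apply]; rfl
  rw [h1, Finsupp.sum_apply, Finsupp.sum, Finset.sum_eq_single w]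
  · rw [Finsupp.smul_apply, (hs.barBasis_triangular w).1]; simp
  · intro v hv hvw
    rw [Finsupp.smul_apply, (hs.barBasis_triangular v).2 w hvw.symm
      (h v (Finsupp.mem_support_iff.1 hv)), smul_zero]
  · intro hw
    simp [Finsupp.notMem_support_iff.1 hw]

end IsHeckeLength

/-! ### Soergel's algorithm as the construction of the Kazhdan-Lusztig basis. -/

namespace AlcoveGeometry

open LaurentPolynomial

variable {r : ℕ} (G : AlcoveGeometry r)

/-! ### Kazhdan-Lusztig theory on alcoves -/

theorem nsep_smul (w : G.W) (a b : G.Alcove) : G.nsep (w • a) (w • b) = G.nsep a b := by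
  rw [nsep, ← act_image_asep, Set.ncard_image_of_injective _ (G.act_injective w), nsep]

/-- The distance of `s_j b` from the fundamental alcove is that of `b` from `s_j a₀`, and this
alcove differs from `a₀` only across the wall `j`. -/
theorem len_simpleRefl_smul_lt (j : G.Wall) (b : G.Alcove) :
    (j.1 ∈ G.asep G.fundamental b → G.len (G.simpleRefl j • b) + 1 = G.len b) ∧
    (j.1 ∉ G.asep G.fundamental b → G.len (G.simpleRefl j • b) = G.len b + 1) := by
  have h1 : G.len (G.simpleRefl j • b) = G.nsep (G.simpleRefl j • G.fundamental) b := by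
    rw [len_eq, ← G.nsep_smul (G.simpleRefl j), ← mul_smul, simpleRefl_mul_self, one_smul]
  rw [h1, len_eq]
  have h2 : G.asep G.fundamental (G.simpleRefl j • G.fundamental) = {j.1} := j.2
  exact ⟨fun h => G.nsep_of_adj_mem h2 h, fun h => G.nsep_of_adj_notMem h2 h⟩

theorem isHeckeLength : IsHeckeLength G.simpleRefl fun w => G.len (w • G.fundamental) where
  mul_self := G.simpleRefl_mul_self
  inv w := by
    simp only [len_eq]
    rw [← G.nsep_smul w, smul_inv_smul, nsep_comm]
  step w i := G.len_adj ((G.adj_iff _ _).2 ⟨_, G.asep_smul_simpleRefl w i⟩)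
  descent w hw := by
    obtain ⟨i, _, hi⟩ :=
      G.exists_toward_fundamental fun h => hw (G.eq_one_of_smul_fundamental h)
    refine ⟨i, ?_⟩
    simp only [len_eq]
    omega
  exchange i j w h1 h2 := by
    simp only [mul_smul (G.simpleRefl j), mul_assoc] at h1 h2
    have h3 := G.asep_smul_simpleRefl w i
    have hb := G.len_simpleRefl_smul_lt j (w • G.fundamental)
    have hb' := G.len_simpleRefl_smul_lt j ((w * G.simpleRefl i) • G.fundamental)
    have h4 := G.mem_asep_trans G.fundamental (w • G.fundamental)
      ((w * G.simpleRefl i) • G.fundamental) j.1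
    rw [h3, Set.mem_singleton_iff] at h4
    -- The length hypotheses say that the wall `j` separates exactly one of `w a₀` and `w s_i a₀`
    -- from `a₀`. Hence it is the wall between these two alcoves.
    have h5 : j.1 = G.act w i.1 := by
      by_cases hm : j.1 ∈ G.asep G.fundamental (w • G.fundamental) <;>
      by_cases hm' : j.1 ∈ G.asep G.fundamental ((w * G.simpleRefl i) • G.fundamental)
      · have := hb.1 hm
        have := hb'.1 hm'
        omega
      · simp only [hm, hm', true_iff, false_iff, not_not] at h4
        exact h4
      · simp only [hm, hm', true_iff, false_iff, not_not] at h4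
        exact h4
      · have := hb.2 hm
        have := hb'.2 hm'
        omega
    have h6 := G.refl_act w i.1
    rw [← h5] at h6
    change G.refl j.1 * w = w * G.refl i.1
    rw [h6]; group

/-- The alcove across the wall of type `i`. -/
noncomputable def wallCross (i : G.Wall) (b : G.Alcove) : G.Alcove :=
  G.alcoveEquiv (G.alcoveEquiv.symm b * G.simpleRefl i)

theorem cross_eq_wallCross {a a' : G.Alcove} (h : G.adjacency.Adj a a') :
    ∃ i, G.cross a a' = G.wallCross i := by
  obtain ⟨i, hi⟩ := G.cross_eq_simple h
  refine ⟨i, funext fun b => ?_⟩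
  rw [wallCross, alcoveEquiv_apply, ← hi, ← alcoveEquiv_apply, Equiv.apply_symm_apply]

theorem wallCross_wallCross (i : G.Wall) (b : G.Alcove) :
    G.wallCross i (G.wallCross i b) = b := by
  simp [wallCross, mul_assoc, simpleRefl_mul_self]

theorem len_wallCross (i : G.Wall) (b : G.Alcove) :
    G.len (G.wallCross i b) = G.len b + 1 ∨ G.len b = G.len (G.wallCross i b) + 1 := by
  have := G.isHeckeLength.step (G.alcoveEquiv.symm b) i
  simp only [← alcoveEquiv_apply, Equiv.apply_symm_apply] at this
  exact this

/-- Finitely supported patterns on the alcoves. -/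
abbrev Pattern : Type := G.Alcove →₀ ℤ[T;T⁻¹]

/-- The transport of the regular Hecke module to the alcoves. -/
noncomputable def transport : (G.W →₀ ℤ[T;T⁻¹]) ≃ₗ[ℤ[T;T⁻¹]] G.Pattern :=
  Finsupp.domLCongr G.alcoveEquiv

theorem transport_apply (f : G.W →₀ ℤ[T;T⁻¹]) (b : G.Alcove) :
    G.transport f b = f (G.alcoveEquiv.symm b) := rfl

theorem transport_symm_apply (f : G.Pattern) (w : G.W) :
    G.transport.symm f w = f (G.alcoveEquiv w) := rfl

/-- The operator `C_i` on patterns. -/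
noncomputable def wallOp (i : G.Wall) : G.Pattern →ₗ[ℤ[T;T⁻¹]] G.Pattern :=
  G.transport.toLinearMap ∘ₗ
    (IsHeckeLength.rightC G.simpleRefl (fun w => G.len (w • G.fundamental)) i) ∘ₗ
      G.transport.symm.toLinearMap

theorem wallOp_apply (i : G.Wall) (f : G.Pattern) (b : G.Alcove) :
    G.wallOp i f b = f (G.wallCross i b) +
      (if G.len (G.wallCross i b) < G.len b then T (-1) else T 1) * f b := by
  change G.transport (IsHeckeLength.rightC _ _ i (G.transport.symm f)) b = _
  rw [transport_apply, G.isHeckeLength.rightC_apply, transport_symm_apply, transport_symm_apply,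
    Equiv.apply_symm_apply]
  simp only [← alcoveEquiv_apply, Equiv.apply_symm_apply]
  rfl

/-- This identifies a step of the algorithm with a Hecke operator, and gives access to the bar
involution. -/
theorem soergelStep_eq {a a' : G.Alcove} {i : G.Wall} (h : G.cross a a' = G.wallCross i)
    (f : G.Pattern) (b : G.Alcove) : G.soergelStep a a' f b = G.wallOp i f b := by
  rw [soergelStep, wallOp_apply, h]

/-- The bar involution on patterns. -/
noncomputable def barA : G.Pattern →+ G.Pattern :=
  G.transport.toLinearMap.toAddMonoidHom.comp
    (G.isHeckeLength.bar.comp G.transport.symm.toLinearMap.toAddMonoidHom)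

theorem barA_eq (f : G.Pattern) : G.barA f = G.transport (G.isHeckeLength.bar (G.transport.symm f)) :=
  rfl

theorem barA_wallOp (i : G.Wall) (f : G.Pattern) :
    G.barA (G.wallOp i f) = G.wallOp i (G.barA f) := by
  rw [barA_eq, barA_eq, wallOp]
  simp [G.isHeckeLength.bar_rightC]

theorem barA_apply_of_top (f : G.Pattern) (b : G.Alcove) (h : ∀ d, f d ≠ 0 → G.len d ≤ G.len b) :
    G.barA f b = invert (f b) := by
  rw [barA_eq, transport_apply, G.isHeckeLength.bar_apply_of_top, transport_symm_apply,
    Equiv.apply_symm_apply]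
  intro w hw
  simp only [← alcoveEquiv_apply, Equiv.apply_symm_apply]
  exact h _ hw

theorem barA_single_fundamental :
    G.barA (Finsupp.single G.fundamental 1) = Finsupp.single G.fundamental 1 := by
  have h : (Finsupp.single G.fundamental 1 : G.Pattern) = G.transport (Finsupp.single 1 1) := by
    rw [transport, Finsupp.domLCongr_single, alcoveEquiv_apply, one_smul]
  rw [h, barA_eq, LinearEquiv.symm_apply_apply, G.isHeckeLength.bar_single, map_one, one_smul,
    G.isHeckeLength.barBasis_one]

/-- Laurent polynomials in `t ℤ[t]`. -/
def IsPos (q : ℤ[T;T⁻¹]) : Prop := ∀ k ≤ 0, q.coeff k = 0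

theorem eq_zero_of_isPos_of_invert {q : ℤ[T;T⁻¹]} (h : IsPos q) (h' : invert q = q) : q = 0 := by
  refine LaurentPolynomial.ext fun k => ?_
  rcases le_total k 0 with hk | hk
  · rw [h k hk]; rfl
  · rw [← h', invert_apply, h (-k) (by omega)]; rfl

theorem IsPos.sub {p q : ℤ[T;T⁻¹]} (hp : IsPos p) (hq : IsPos q) : IsPos (p - q) := fun k hk => by
  rw [AddMonoidAlgebra.coeff_sub, Finsupp.sub_apply, hp k hk, hq k hk, sub_zero]

theorem isPos_zero : IsPos 0 := fun _ _ => rfl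

theorem coeff_T_mul (q : ℤ[T;T⁻¹]) (m k : ℤ) : (T m * q).coeff k = q.coeff (k - m) := by
  rw [T, AddMonoidAlgebra.coeff_single_mul_eq_mul_coeff (k - m) (fun _ _ => by omega), one_mul]

theorem coeff_add (p q : ℤ[T;T⁻¹]) (k : ℤ) : (p + q).coeff k = p.coeff k + q.coeff k := by
  simp

theorem exists_max_len {f : G.Pattern} (hf : f ≠ 0) :
    ∃ b, f b ≠ 0 ∧ ∀ d, f d ≠ 0 → G.len d ≤ G.len b := by
  obtain ⟨b, hb, h⟩ := f.support.exists_max_image G.len (Finsupp.support_nonempty_iff.2 hf)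
  exact ⟨b, Finsupp.mem_support_iff.1 hb, fun d hd => h d (Finsupp.mem_support_iff.2 hd)⟩

/-- At a support alcove of maximal length the bar involution acts by `t ↦ t⁻¹`, and a self-dual
element of `t ℤ[t]` is zero. -/
theorem eq_zero_of_bar_of_isPos {f : G.Pattern} (h1 : G.barA f = f) (h2 : ∀ b, IsPos (f b)) :
    f = 0 := by
  by_contra hf
  obtain ⟨b, hb, hmax⟩ := G.exists_max_len hf
  have := G.barA_apply_of_top f b hmax
  rw [h1] at this
  exact hb (eq_zero_of_isPos_of_invert (h2 b) this.symm)

/-- `F` is the Kazhdan-Lusztig basis element labelled by the alcove `a`. -/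
structure IsKL (a : G.Alcove) (F : G.Pattern) : Prop where
  bar : G.barA F = F
  self : F a = 1
  pos : ∀ b, b ≠ a → IsPos (F b)
  lower : ∀ b, b ≠ a → G.len a ≤ G.len b → F b = 0

variable {G}

theorem IsKL.unique {a : G.Alcove} {F F' : G.Pattern} (h : G.IsKL a F) (h' : G.IsKL a F') :
    F = F' := by
  rw [← sub_eq_zero]
  refine G.eq_zero_of_bar_of_isPos (by rw [map_sub, h.bar, h'.bar]) fun b => ?_
  rw [Finsupp.sub_apply]
  by_cases hb : b = a
  · rw [hb, h.self, h'.self, sub_self]; exact isPos_zero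
  · exact (h.pos b hb).sub (h'.pos b hb)

theorem IsKL.coeff_neg {a : G.Alcove} {F : G.Pattern} (h : G.IsKL a F) (b : G.Alcove) {k : ℤ}
    (hk : k < 0) : (F b).coeff k = 0 := by
  by_cases hb : b = a
  · rw [hb, h.self, ← T_zero, T_apply, if_neg (by omega)]
  · exact h.pos b hb k hk.le

/-- The factor `t⁻¹` occurs only at alcoves where the crossing is a descent. The alcove `a` is not
one of them, so the factor meets only entries in `t ℤ[t]`. -/
theorem IsKL.wallOp_coeff_neg {a : G.Alcove} {F : G.Pattern} (h : G.IsKL a F) {i : G.Wall}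
    (hi : G.len a < G.len (G.wallCross i a)) (b : G.Alcove) {k : ℤ} (hk : k < 0) :
    (G.wallOp i F b).coeff k = 0 := by
  rw [wallOp_apply, coeff_add, h.coeff_neg _ hk, zero_add]
  split_ifs with hb
  · rw [coeff_T_mul]
    refine h.pos b ?_ _ (by omega)
    rintro rfl
    omega
  · rw [coeff_T_mul]
    exact h.coeff_neg _ (by omega)

theorem IsKL.wallOp_self {a : G.Alcove} {F : G.Pattern} (h : G.IsKL a F) {i : G.Wall}
    (hi : G.len a < G.len (G.wallCross i a)) : G.wallOp i F (G.wallCross i a) = 1 := by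
  rw [wallOp_apply, wallCross_wallCross, h.self,
    h.lower (G.wallCross i a) (fun h0 => by rw [h0] at hi; omega) hi.le]
  simp

theorem IsKL.wallOp_lower {a : G.Alcove} {F : G.Pattern} (h : G.IsKL a F) {i : G.Wall}
    (hi : G.len a < G.len (G.wallCross i a)) {b : G.Alcove} (hb : b ≠ G.wallCross i a)
    (hl : G.len (G.wallCross i a) ≤ G.len b) : G.wallOp i F b = 0 := by
  have h1 := G.len_wallCross i a
  have h2 := G.len_wallCross i b
  rw [wallOp_apply, h.lower b (fun h0 => by rw [h0] at hl; omega) (by omega),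
    h.lower (G.wallCross i b) (fun h0 => hb (by rw [← h0, wallCross_wallCross])) (by omega)]
  simp

/-- The constant terms of `F C_i` live at the alcoves for which crossing `i` is a descent. -/
theorem IsKL.wallOp_coeff_zero {a : G.Alcove} {F : G.Pattern} (h : G.IsKL a F) {i : G.Wall}
    (hi : G.len a < G.len (G.wallCross i a)) {b : G.Alcove}
    (hb : G.len b < G.len (G.wallCross i b)) : (G.wallOp i F b).coeff 0 = 0 := by
  have hT : (T 1 * T (-1) : ℤ[T;T⁻¹]) = 1 := by rw [← T_add]; simp
  -- The values of `F C_i` on the two sides of a wall of type `i` differ by the factor `t`. A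
  -- constant term on the shorter side would thus be a coefficient of `t⁻¹` on the longer side.
  have h1 : G.wallOp i F b = T 1 * G.wallOp i F (G.wallCross i b) := by
    rw [wallOp_apply, wallOp_apply, wallCross_wallCross, if_neg (by omega), if_pos hb]
    linear_combination (-F (G.wallCross i b)) * hT
  rw [h1, coeff_T_mul]
  exact h.wallOp_coeff_neg hi _ (by norm_num)

open Classical in
/-- One step of Soergel's algorithm produces the next Kazhdan-Lusztig basis element. -/
theorem IsKL.step {a : G.Alcove} {F : G.Pattern} (h : G.IsKL a F) {i : G.Wall}
    (hi : G.len a < G.len (G.wallCross i a)) {Fd : G.Alcove → G.Pattern}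
    (hd : ∀ d, G.len d < G.len (G.wallCross i a) → G.IsKL d (Fd d)) :
    G.IsKL (G.wallCross i a) (G.wallOp i F -
      ∑ d ∈ (G.wallOp i F).support with G.len d < G.len (G.wallCross i a),
        (G.wallOp i F d).coeff 0 • Fd d) := by
  set a' := G.wallCross i a
  set S := (G.wallOp i F).support.filter fun d => G.len d < G.len a' with hS
  have hSd : ∀ d ∈ S, G.IsKL d (Fd d) := fun d h => hd d (Finset.mem_filter.1 h).2
  have hval : ∀ b, (G.wallOp i F - ∑ d ∈ S, (G.wallOp i F d).coeff 0 • Fd d) b =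
      G.wallOp i F b - ∑ d ∈ S, (G.wallOp i F d).coeff 0 • Fd d b := by
    intro b
    rw [Finsupp.sub_apply, Finsupp.finsetSum_apply]
    rfl
  have hzero : ∀ b, G.len a' ≤ G.len b → ∑ d ∈ S, (G.wallOp i F d).coeff 0 • Fd d b = 0 := by
    intro b hb
    refine Finset.sum_eq_zero fun d hdS => ?_
    have hlt := (Finset.mem_filter.1 hdS).2
    rw [(hSd d hdS).lower b (fun h0 => by rw [h0] at hb; omega) (by omega), smul_zero]
  refine ⟨?_, ?_, fun b hb k hk => ?_, fun b hb hl => ?_⟩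
  · rw [map_sub, barA_wallOp, h.bar, map_sum]
    congr 1
    refine Finset.sum_congr rfl fun d hdS => ?_
    rw [map_zsmul, (hSd d hdS).bar]
  · rw [hval, h.wallOp_self hi, hzero _ le_rfl, sub_zero]
  · rw [hval, AddMonoidAlgebra.coeff_sub, Finsupp.sub_apply]
    rcases hk.lt_or_eq with hk' | rfl
    · rw [h.wallOp_coeff_neg hi b hk', AddMonoidAlgebra.coeff_sum, Finsupp.finsetSum_apply,
        Finset.sum_eq_zero, sub_zero]
      intro d hdS
      rw [AddMonoidAlgebra.coeff_smul, Finsupp.smul_apply, (hSd d hdS).coeff_neg b hk', smul_zero]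
    -- Each subtracted element has constant term `1` at its own alcove and `0` at every other, so
    -- one simultaneous subtraction removes all the constant terms.
    · by_cases hbl : G.len b < G.len a'
      · rw [AddMonoidAlgebra.coeff_sum, Finsupp.finsetSum_apply, Finset.sum_eq_single b]
        · rw [AddMonoidAlgebra.coeff_smul, Finsupp.smul_apply, (hd b hbl).self, ← T_zero, T_apply]
          simp
        · intro d hdS hdb
          rw [AddMonoidAlgebra.coeff_smul, Finsupp.smul_apply,
            (hSd d hdS).pos b hdb.symm 0 le_rfl, smul_zero]
        · intro hbS
          have : G.wallOp i F b = 0 := by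
            by_contra h0
            exact hbS (Finset.mem_filter.2 ⟨Finsupp.mem_support_iff.2 h0, hbl⟩)
          simp [this]
      · rw [hzero b (not_lt.1 hbl), h.wallOp_lower hi hb (not_lt.1 hbl), sub_self]
  · rw [hval, hzero b hl, h.wallOp_lower hi hb hl, sub_zero]

theorem isKL_single : G.IsKL G.fundamental (Finsupp.single G.fundamental 1) where
  bar := G.barA_single_fundamental
  self := by simp
  pos b hb := by rw [Finsupp.single_eq_of_ne hb]; exact isPos_zero
  lower b hb _ := Finsupp.single_eq_of_ne hb

/-- The values of Soergel's algorithm are the Kazhdan-Lusztig basis elements. -/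
theorem exists_isKL {p : G.Alcove → G.Alcove} (hp : G.IsDescent p) (a : G.Alcove) :
    ∃ F : G.Pattern, (∀ b, F b = G.soergelN p a b) ∧ G.IsKL a F := by
  classical
  induction hm : G.len a using Nat.strong_induction_on generalizing a with
  | _ m ih =>
    subst hm
    by_cases ha : a = G.fundamental
    · subst ha
      refine ⟨_, fun b => ?_, isKL_single⟩
      have h0 : G.len G.fundamental = 0 := G.len_eq_zero.2 rfl
      rw [soergelN, dif_neg (by omega), delta, Finsupp.single_apply]
      simp only [eq_comm]
    · obtain ⟨hadj, hlt⟩ := hp a ha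
      obtain ⟨i, hi⟩ := G.cross_eq_wallCross hadj
      have hia : G.wallCross i (p a) = a := by rw [← hi, cross_left]
      obtain ⟨F, hF, hKL⟩ := ih _ hlt (p a) rfl
      have hex : ∀ d, ∃ Fd : G.Pattern, G.len d < G.len a →
          (∀ b, Fd b = G.soergelN p d b) ∧ G.IsKL d Fd := by
        intro d
        by_cases hd : G.len d < G.len a
        · obtain ⟨Fd, h⟩ := ih _ hd d rfl
          exact ⟨Fd, fun _ => h⟩
        · exact ⟨0, fun h => absurd h hd⟩
      choose Fd hFd using hex
      have hKL' := hKL.step (i := i) (by rwa [hia]) (Fd := Fd) (by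
        rw [hia]; exact fun d hd => (hFd d hd).2)
      rw [hia] at hKL'
      refine ⟨_, fun b => ?_, hKL'⟩
      have hFeq : G.soergelN p (p a) = F := funext fun b => (hF b).symm
      rw [soergelN, dif_pos hlt]
      simp only [hFeq, G.soergelStep_eq hi]
      rw [Finsupp.sub_apply, Finsupp.finsetSum_apply]
      congr 1
      -- The sum over all shorter alcoves reduces to a finite one, as the coefficients vanish off
      -- the support of `F C_i`.
      rw [finsum_subtype_eq_finsum_cond (f := fun d => (G.wallOp i F d).coeff 0 • G.soergelN p d b)
        (p := fun d => G.len d < G.len a), finsum_cond_eq_sum_of_cond_iff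
        (f := fun d => (G.wallOp i F d).coeff 0 • G.soergelN p d b)
        (p := fun d => G.len d < G.len a)
        (t := (G.wallOp i F).support.filter fun d => G.len d < G.len a)]
      · refine Finset.sum_congr rfl fun d hd => ?_
        rw [← (hFd d (Finset.mem_filter.1 hd).2).1 b]
        rfl
      · intro d hd
        rw [Finset.mem_filter, Finsupp.mem_support_iff]
        refine ⟨fun h => ⟨fun h0 => hd ?_, h⟩, fun h => h.2⟩
        simp [h0]

/-- Soergel's pattern `n_a` as a finitely supported pattern. -/
noncomputable def klPattern {p : G.Alcove → G.Alcove} (hp : G.IsDescent p) (a : G.Alcove) :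
    G.Pattern := (exists_isKL hp a).choose

theorem klPattern_apply {p : G.Alcove → G.Alcove} (hp : G.IsDescent p) (a b : G.Alcove) :
    klPattern hp a b = G.soergelN p a b := (exists_isKL hp a).choose_spec.1 b

theorem klPattern_isKL {p : G.Alcove → G.Alcove} (hp : G.IsDescent p) (a : G.Alcove) :
    G.IsKL a (klPattern hp a) := (exists_isKL hp a).choose_spec.2

-- `IsKL.step` constructs an element with the defining properties, and uniqueness identifies it with
-- the given one.
open Classical in
theorem wallOp_klPattern_of_lt {p : G.Alcove → G.Alcove} (hp : G.IsDescent p) {a : G.Alcove}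
    {i : G.Wall} (hi : G.len a < G.len (G.wallCross i a)) :
    G.wallOp i (klPattern hp a) = klPattern hp (G.wallCross i a) +
      ∑ d ∈ (G.wallOp i (klPattern hp a)).support with G.len d < G.len (G.wallCross i a),
        (G.wallOp i (klPattern hp a) d).coeff 0 • klPattern hp d := by
  have h := (klPattern_isKL hp a).step hi (Fd := klPattern hp) fun d _ => klPattern_isKL hp d
  rw [(klPattern_isKL hp (G.wallCross i a)).unique h]
  abel

theorem wallOp_wallOp (i : G.Wall) (f : G.Pattern) :
    G.wallOp i (G.wallOp i f) = (T 1 + T (-1) : ℤ[T;T⁻¹]) • G.wallOp i f := by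
  have h := LinearMap.congr_fun (G.isHeckeLength.rightC_mul_self i) (G.transport.symm f)
  rw [Module.End.mul_apply, LinearMap.smul_apply] at h
  simp only [wallOp, LinearMap.comp_apply, LinearEquiv.coe_coe, LinearEquiv.symm_apply_apply]
  rw [h, map_smul]

/-- With `b` across the wall from `a`, `n_a` occurs once in `n_b C_i`. The other `n_d` that occur
also have a descent at `i`, so they are eigenvectors by induction. Applying `C_i` once more and
using the quadratic relation leaves the eigenvector equation for `n_a`. -/
theorem wallOp_klPattern_of_gt {p : G.Alcove → G.Alcove} (hp : G.IsDescent p) {a : G.Alcove}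
    {i : G.Wall} (hi : G.len (G.wallCross i a) < G.len a) :
    G.wallOp i (klPattern hp a) = (T 1 + T (-1) : ℤ[T;T⁻¹]) • klPattern hp a := by
  classical
  induction hm : G.len a using Nat.strong_induction_on generalizing a with
  | _ m ih =>
    subst hm
    set b := G.wallCross i a with hb
    have hba : G.wallCross i b = a := G.wallCross_wallCross i a
    have hup : G.len b < G.len (G.wallCross i b) := by rwa [hba]
    obtain ⟨S, m, hM, hS⟩ : ∃ (S : Finset G.Alcove) (m : G.Alcove → ℤ),
        G.wallOp i (klPattern hp b) = klPattern hp a + ∑ d ∈ S, m d • klPattern hp d ∧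
        ∀ d ∈ S, G.len d < G.len a ∧ (G.len d < G.len (G.wallCross i d) → m d = 0) := by
      have h1 := wallOp_klPattern_of_lt hp hup
      rw [hba] at h1
      exact ⟨_, _, h1, fun d hd => ⟨(Finset.mem_filter.1 hd).2,
        fun hd' => (klPattern_isKL hp b).wallOp_coeff_zero hup hd'⟩⟩
    have h2 := wallOp_wallOp i (klPattern hp b)
    rw [hM, map_add, map_sum, smul_add, Finset.smul_sum] at h2
    have h3 : ∀ d ∈ S, G.wallOp i (m d • klPattern hp d) =
        (T 1 + T (-1) : ℤ[T;T⁻¹]) • (m d • klPattern hp d) := by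
      intro d hd
      rw [map_zsmul]
      by_cases hd' : G.len d < G.len (G.wallCross i d)
      · rw [(hS d hd).2 hd']
        simp
      · have hl := G.len_wallCross i d
        rw [ih _ (hS d hd).1 (a := d) (by omega) rfl, smul_comm]
    rw [Finset.sum_congr rfl h3] at h2
    exact add_right_cancel h2

end AlcoveGeometry

namespace AlcoveGeometry

open LaurentPolynomial

variable {r : ℕ} {G : AlcoveGeometry r}

/-! ### The character algorithm -/

/-- The pattern `δ C_{s_1} ⋯ C_{s_i}` along a chain of alcoves, without cancellation. -/
noncomputable def chainPattern (G : AlcoveGeometry r) (g : ℕ → G.Alcove) :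
    ℕ → G.Alcove → ℤ[T;T⁻¹]
  | 0 => G.delta (g 0)
  | i + 1 => G.soergelStep (g i) (g (i + 1)) (chainPattern G g i)

open Classical in
/-- The coefficients of `n_d C_i` in the Kazhdan-Lusztig basis. -/
noncomputable def wallCoeff {p : G.Alcove → G.Alcove} (hp : G.IsDescent p) (i : G.Wall)
    (d : G.Alcove) : G.Pattern :=
  if G.len (G.wallCross i d) < G.len d then Finsupp.single d (T 1 + T (-1))
  else Finsupp.single (G.wallCross i d) 1 +
    ∑ z ∈ (G.wallOp i (klPattern hp d)).support with G.len z < G.len (G.wallCross i d),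
      Finsupp.single z (C ((G.wallOp i (klPattern hp d) z).coeff 0))

theorem wallOp_klPattern {p : G.Alcove → G.Alcove} (hp : G.IsDescent p) (i : G.Wall)
    (d : G.Alcove) : G.wallOp i (klPattern hp d) =
      Finsupp.linearCombination ℤ[T;T⁻¹] (klPattern hp) (wallCoeff hp i d) := by
  classical
  rw [wallCoeff]
  split_ifs with h
  · rw [Finsupp.linearCombination_single, wallOp_klPattern_of_gt hp h]
  · have hl := G.len_wallCross i d
    rw [map_add, map_sum, Finsupp.linearCombination_single, one_smul]
    conv_lhs => rw [wallOp_klPattern_of_lt hp (show G.len d < _ by omega)]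
    congr 1
    refine Finset.sum_congr rfl fun z _ => ?_
    rw [Finsupp.linearCombination_single]
    ext b : 1
    rw [Finsupp.smul_apply, Finsupp.smul_apply, smul_eq_C_mul, smul_eq_mul]

open Classical in
theorem wallCoeff_apply_of_gt {p : G.Alcove → G.Alcove} (hp : G.IsDescent p) {i : G.Wall}
    {d : G.Alcove} (h : G.len (G.wallCross i d) < G.len d) (z : G.Alcove) :
    wallCoeff hp i d z = if d = z then T 1 + T (-1) else 0 := by
  rw [wallCoeff, if_pos h, Finsupp.single_apply]

-- The length restriction in `wallCoeff` can be dropped: `n_d C_i` vanishes at every other alcove at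
-- least as long as the one across the wall from `d`.
open Classical in
theorem wallCoeff_apply_of_lt {p : G.Alcove → G.Alcove} (hp : G.IsDescent p) {i : G.Wall}
    {d : G.Alcove} (h : G.len d < G.len (G.wallCross i d)) (z : G.Alcove) :
    wallCoeff hp i d z = if z = G.wallCross i d then 1 else
      C ((G.wallOp i (klPattern hp d) z).coeff 0) := by
  rw [wallCoeff, if_neg (by omega), Finsupp.add_apply, Finsupp.finsetSum_apply]
  by_cases hz : z = G.wallCross i d
  · subst hz
    rw [if_pos rfl, Finsupp.single_eq_same, Finset.sum_eq_zero, add_zero]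
    intro y hy
    refine Finsupp.single_eq_of_ne fun h0 => ?_
    have := (Finset.mem_filter.1 hy).2
    rw [← h0] at this
    omega
  · rw [if_neg hz, Finsupp.single_eq_of_ne hz, zero_add]
    by_cases hzS : z ∈ (G.wallOp i (klPattern hp d)).support.filter
        (fun z => G.len z < G.len (G.wallCross i d))
    · rw [Finset.sum_eq_single_of_mem z hzS, Finsupp.single_eq_same]
      intro y _ hy
      exact Finsupp.single_eq_of_ne hy.symm
    · rw [Finset.sum_eq_zero]
      · by_cases hl : G.len z < G.len (G.wallCross i d)
        · have : G.wallOp i (klPattern hp d) z = 0 := by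
            by_contra h0
            exact hzS (Finset.mem_filter.2 ⟨Finsupp.mem_support_iff.2 h0, hl⟩)
          simp [this]
        · rw [(klPattern_isKL hp d).wallOp_lower h hz (by omega)]
          simp
      · intro y hy
        exact Finsupp.single_eq_of_ne fun h0 => hzS (h0 ▸ hy)

/-- The coefficients are integers or `t + t⁻¹`. Their self-duality makes the outcome of the
character algorithm self-dual. -/
theorem invert_wallCoeff {p : G.Alcove → G.Alcove} (hp : G.IsDescent p) (i : G.Wall)
    (d z : G.Alcove) : invert (wallCoeff hp i d z) = wallCoeff hp i d z := by
  rcases G.len_wallCross i d with h | h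
  · rw [wallCoeff_apply_of_lt hp (by omega)]
    split_ifs <;> simp
  · rw [wallCoeff_apply_of_gt hp (by omega)]
    split_ifs
    · simp [add_comm]
    · simp

/-- The character algorithm computes the expansion of `δ C_{s_1} ⋯ C_{s_N}` in terms of the
patterns of Soergel's algorithm. -/
theorem exists_charE {p : G.Alcove → G.Alcove} (hp : G.IsDescent p) {g : ℕ → G.Alcove}
    (h0 : g 0 = G.fundamental) (N : ℕ) (hadj : ∀ i < N, G.adjacency.Adj (g i) (g (i + 1))) :
    ∃ E M : G.Pattern, (∀ b, E b = G.charE p g N b) ∧ (∀ b, invert (E b) = E b) ∧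
      (∀ b, M b = chainPattern G g N b) ∧
      M = Finsupp.linearCombination ℤ[T;T⁻¹] (klPattern hp) E := by
  classical
  induction N with
  | zero =>
    have hs : klPattern hp G.fundamental = Finsupp.single G.fundamental 1 :=
      (klPattern_isKL hp _).unique isKL_single
    have hd : ∀ b, (Finsupp.single G.fundamental 1 : G.Pattern) b = G.delta (g 0) b := by
      intro b
      rw [h0, delta, Finsupp.single_apply]
      simp only [eq_comm]
    refine ⟨Finsupp.single G.fundamental 1, Finsupp.single G.fundamental 1, hd, fun b => ?_, hd, ?_⟩
    · rw [Finsupp.single_apply]; split_ifs <;> simp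
    · rw [Finsupp.linearCombination_single, one_smul, hs]
  | succ N ih =>
    obtain ⟨E, M, hE, hinv, hM, hME⟩ := ih fun i hi => hadj i (by omega)
    obtain ⟨i, hi⟩ := G.cross_eq_wallCross (hadj N (by omega))
    have hEf : G.charE p g N = E := funext fun b => (hE b).symm
    have hMf : chainPattern G g N = M := funext fun b => (hM b).symm
    have hval : ∀ z, Finsupp.linearCombination ℤ[T;T⁻¹] (wallCoeff hp i) E z =
        ∑ d ∈ E.support, E d * wallCoeff hp i d z := by
      intro z
      rw [Finsupp.linearCombination_apply, Finsupp.sum, Finsupp.finsetSum_apply]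
      rfl
    refine ⟨Finsupp.linearCombination ℤ[T;T⁻¹] (wallCoeff hp i) E, G.wallOp i M, fun z => ?_,
      fun z => ?_, fun z => ?_, ?_⟩
    · rw [hval, charE, hi, hEf]
      have hlz := G.len_wallCross i z
      beta_reduce
      split_ifs with hz
      · rw [finsum_subtype_eq_finsum_cond
          (f := fun d => (G.soergelStep (g N) (g (N + 1)) (G.soergelN p d) z).coeff 0 • E d)
          (p := fun d => d ≠ G.wallCross i z ∧ G.len d < G.len (G.wallCross i d)),
          finsum_cond_eq_sum_of_cond_iff
          (f := fun d => (G.soergelStep (g N) (g (N + 1)) (G.soergelN p d) z).coeff 0 • E d)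
          (p := fun d => d ≠ G.wallCross i z ∧ G.len d < G.len (G.wallCross i d))
          (t := E.support.filter fun d => d ≠ G.wallCross i z ∧
            G.len d < G.len (G.wallCross i d))]
        -- The recursion reads the matrix of `C_i` in the basis `n_d` by its target `z`. There are
        -- three sources: the eigenvalue when `d = z`, the leading term when `d` is across the wall
        -- from `z`, and the constant terms split off from the remaining ascents.
        · have hterm : ∀ d ∈ E.support, E d * wallCoeff hp i d z =
              (if d = z then (T 1 + T (-1)) * E z else 0) +
              (if d = G.wallCross i z then E (G.wallCross i z) else 0) +
              (if d ≠ G.wallCross i z ∧ G.len d < G.len (G.wallCross i d) then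
                (G.soergelStep (g N) (g (N + 1)) (G.soergelN p d) z).coeff 0 • E d else 0) := by
            intro d _
            have hnf : G.soergelN p d = klPattern hp d :=
              funext fun b => (klPattern_apply hp d b).symm
            rcases G.len_wallCross i d with hd | hd
            · rw [wallCoeff_apply_of_lt hp (by omega), hnf, G.soergelStep_eq hi]
              have h1 : d ≠ z := by rintro rfl; omega
              have h2 : z = G.wallCross i d ↔ d = G.wallCross i z := by
                constructor <;> rintro rfl <;> rw [wallCross_wallCross]
              rw [if_neg h1, h2]
              by_cases h3 : d = G.wallCross i z
              · simp [h3]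
              · rw [if_neg h3, if_neg h3, if_pos ⟨h3, by omega⟩, smul_eq_C_mul]
                ring
            · rw [wallCoeff_apply_of_gt hp (by omega)]
              have h2 : d ≠ G.wallCross i z := by
                rintro rfl
                rw [wallCross_wallCross] at hd
                omega
              rw [if_neg h2, if_neg (show ¬ (d ≠ G.wallCross i z ∧ _) from fun h => by omega)]
              by_cases h1 : d = z
              · subst h1; rw [if_pos rfl, if_pos rfl]; ring
              · rw [if_neg h1, if_neg h1]; ring
          rw [Finset.sum_congr rfl hterm, Finset.sum_add_distrib, Finset.sum_add_distrib,
            Finset.sum_ite_eq', Finset.sum_ite_eq', Finset.sum_filter]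
          congr 2
          · split_ifs with h
            · rfl
            · rw [Finsupp.notMem_support_iff.1 h]; ring
          · split_ifs with h
            · rfl
            · rw [Finsupp.notMem_support_iff.1 h]
        · intro d hd
          rw [Finset.mem_filter, Finsupp.mem_support_iff]
          exact ⟨fun h => ⟨fun h0 => hd (by simp [h0]), h⟩, fun h => h.2⟩
      -- Everything that occurs in some `n_d C_i` has a descent at `i`, so nothing reaches a `z`
      -- with an ascent.
      · refine Finset.sum_eq_zero fun d _ => ?_
        rcases G.len_wallCross i d with hd | hd
        · have h1 : z ≠ G.wallCross i d := by
            rintro rfl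
            rw [wallCross_wallCross] at hlz hz
            omega
          rw [wallCoeff_apply_of_lt hp (by omega), if_neg h1,
            (klPattern_isKL hp d).wallOp_coeff_zero (by omega) (by omega)]
          simp
        · have h1 : d ≠ z := by rintro rfl; omega
          rw [wallCoeff_apply_of_gt hp (by omega), if_neg h1, mul_zero]
    · rw [hval, map_sum]
      refine Finset.sum_congr rfl fun d _ => ?_
      rw [map_mul, hinv, invert_wallCoeff]
    · rw [chainPattern, hMf, G.soergelStep_eq hi]
    · rw [hME, Finsupp.linearCombination_apply _ E, Finsupp.linearCombination_apply _ E,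
        Finsupp.sum, Finsupp.sum, map_sum, map_sum]
      refine Finset.sum_congr rfl fun d _ => ?_
      rw [map_smul, map_smul, wallOp_klPattern]

end AlcoveGeometry

/-! ### Transversality of admissible paths, and their alcove series. -/

namespace AlcoveGeometry

variable {r : ℕ} (G : AlcoveGeometry r)

/-! ### The shape of admissible paths -/

theorem zero_mem_fundamental : (0 : ESpace r) ∈ G.fundamental.1 := G.mem_alcoveOf G.regular_zero

theorem exists_fin_leave {n : ℕ} {Q : Fin (n + 1) → Prop} {a : Fin (n + 1)} (ha : Q a)
    (hl : ¬ Q (Fin.last n)) : ∃ i : Fin n, Q i.castSucc ∧ ¬ Q i.succ := by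
  by_contra! h
  have : ∀ k, a ≤ k → Q k := by
    intro k
    induction k using Fin.induction with
    | zero => intro h0; rwa [← Fin.le_zero_iff.1 h0]
    | succ i ih =>
      intro h0
      rcases h0.lt_or_eq with h1 | h1
      · exact h i (ih (Fin.le_castSucc_iff.2 h1))
      · rwa [← h1]
  exact hl (this _ (Fin.le_last a))

theorem exists_fin_enter {n : ℕ} {Q : Fin (n + 1) → Prop} {a : Fin (n + 1)} (ha : Q a)
    (h0 : ¬ Q 0) : ∃ i : Fin n, i.succ ≤ a ∧ ¬ Q i.castSucc ∧ Q i.succ := by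
  by_contra! h
  have : ∀ k, k ≤ a → ¬ Q k := by
    intro k
    induction k using Fin.induction with
    | zero => exact fun _ => h0
    | succ i ih => exact fun hi => h i hi (ih (i.castSucc_lt_succ.le.trans hi))
  exact this a le_rfl ha

/-- A path which meets each hyperplane during one interval of time, changing sides, and whose
hyperplanes through a common point are orthogonal. -/
structure IsTransversal {n : ℕ} (ω : Fin (n + 1) → ESpace r) : Prop where
  zero : ω 0 = 0
  regular : G.Regular (ω (Fin.last n))
  interval : ∀ (h : G.Hyp) (i k j : Fin (n + 1)), i ≤ k → k ≤ j → G.On h.1 (ω i) →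
    G.On h.1 (ω j) → G.On h.1 (ω k)
  orthogonal : ∀ k, ∀ h h' : G.Hyp, h ≠ h' → G.On h.1 (ω k) → G.On h'.1 (ω k) →
    ⟪h.1.1, coroot h'.1.1⟫_ℝ = 0
  met_iff : ∀ (h : G.Hyp) (k : Fin (n + 1)),
    (∃ i ≤ k, G.On h.1 (ω i)) ↔ G.side h.1 (ω k) * G.side h.1 0 ≤ 0

theorem degUpTo_last {n : ℕ} (ω : Fin (n + 1) → ESpace r) : G.degUpTo ω (Fin.last n) =
    ∑ i : Fin n, ∑ α ∈ G.pos, G.stepDegree α (ω i.castSucc) (ω i.succ) := by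
  rw [degUpTo]
  congr 1
  ext i
  simp [Fin.castSucc_lt_last]

-- Suppose the path meets `h` at two times. Reflecting at both restores the end point, so by `huniq`
-- the path is unchanged and lies on `h` in between. Without jumps it enters `h` first from the side
-- of the origin, and it cannot enter again from the other side. Hence no step has negative degree,
-- and total degree zero excludes a return to the side of the origin.
variable {G} in
theorem isTransversal_of_admissible {n : ℕ} {ω : Fin (n + 1) → ESpace r} (h0 : ω 0 = 0)
    (hadm : G.IsAdmissible ω) (hreg : G.Regular (ω (Fin.last n)))
    (huniq : ∀ ω', G.PathEquiv ω ω' → ω' (Fin.last n) = ω (Fin.last n) → ω' = ω) :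
    G.IsTransversal ω := by
  have hinterval : ∀ (h : G.Hyp) (i k j : Fin (n + 1)), i ≤ k → k ≤ j → G.On h.1 (ω i) →
      G.On h.1 (ω j) → G.On h.1 (ω k) := by
    intro h i k j hik hkj hi hj
    rcases hik.eq_or_lt with rfl | hik
    · exact hi
    have hjl : j < Fin.last n := lt_of_le_of_ne (Fin.le_last j) fun he => by
      rw [he] at hj; exact hreg h.1 h.2 hj
    -- The two reflections together change only the points after time `i` and up to time `j`.
    set ω₁ := G.reflectAt h.1 i ω with hω₁
    have h1 : G.ReflectionStep ω ω₁ := ⟨h.1, h.2, i, hi, rfl⟩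
    have hj1 : ω₁ j = ω j := by
      rw [hω₁, reflectAt, if_neg (not_le.2 (hik.trans_le hkj))]
      exact (G.On_iff_reflect h.2 _).1 hj
    set ω₂ := G.reflectAt h.1 j ω₁ with hω₂
    have h2 : G.ReflectionStep ω₁ ω₂ := ⟨h.1, h.2, j, by rwa [hj1], rfl⟩
    have h3 : ω₂ (Fin.last n) = ω (Fin.last n) := by
      rw [hω₂, reflectAt, if_neg (not_le.2 hjl), hω₁, reflectAt,
        if_neg (not_le.2 ((hik.trans_le hkj).trans hjl)), reflect_reflect]
    have h4 := huniq ω₂ ((Relation.ReflTransGen.single h1).tail h2) h3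
    have h5 := congrFun h4 k
    rw [hω₂, reflectAt, if_pos hkj, hω₁, reflectAt, if_neg (not_le.2 hik)] at h5
    exact (G.On_iff_reflect h.2 _).2 h5
  have hpos0 : ∀ h : G.Hyp, 0 < G.side h.1 (ω 0) * G.side h.1 0 := by
    intro h
    rw [h0]
    exact mul_self_pos.2 (G.regular_side G.regular_zero h)
  -- a hyperplane not yet met has the path on the side of the origin
  have hminus : ∀ (h : G.Hyp) (k : Fin (n + 1)), (¬ ∃ i ≤ k, G.On h.1 (ω i)) →
      0 < G.side h.1 (ω k) * G.side h.1 0 := by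
    intro h k
    induction k using Fin.induction with
    | zero => exact fun _ => hpos0 h
    | succ i ih =>
      intro hn
      have h1 := ih fun ⟨m, hm, hm'⟩ => hn ⟨m, hm.trans i.castSucc_lt_succ.le, hm'⟩
      have h2 := hadm.no_jump i h.1 h.2
      have h3 : G.side h.1 (ω i.succ) ≠ 0 := fun he => hn ⟨i.succ, le_rfl, he⟩
      have h4 := mul_self_pos.2 (G.regular_side G.regular_zero h)
      have h5 : G.side h.1 (ω i.castSucc) ≠ 0 := fun he => by simp [he] at h1
      have h6 : 0 < G.side h.1 (ω i.castSucc) * G.side h.1 (ω i.succ) :=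
        lt_of_le_of_ne h2 (mul_ne_zero h5 h3).symm
      have h7 := mul_pos h1 h6
      have h8 := mul_self_pos.2 h5
      have h9 : 0 < (G.side h.1 (ω i.succ) * G.side h.1 0) *
          (G.side h.1 (ω i.castSucc) * G.side h.1 (ω i.castSucc)) := by
        calc 0 < _ := h7
          _ = _ := by ring
      exact pos_of_mul_pos_left h9 h8.le
  -- If `h` was met before, the interval property keeps the path on `h`; if not, the path is still
  -- on the side of the origin.
  have hnoenter : ∀ (h : G.Hyp) (i : Fin n), G.On h.1 (ω i.succ) →
      ¬ G.InPlus h.1 (ω i.castSucc) := by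
    intro h i hon hplus
    by_cases hm : ∃ m ≤ i.castSucc, G.On h.1 (ω m)
    · obtain ⟨m, hm, hm'⟩ := hm
      have := hinterval h m i.castSucc i.succ hm i.castSucc_lt_succ.le hm' hon
      rw [InPlus, this] at hplus
      simp at hplus
    · have := hminus h _ hm
      rw [InPlus] at hplus
      linarith
  have hstep : ∀ (i : Fin n), ∀ α ∈ G.pos,
      0 ≤ G.stepDegree α (ω i.castSucc) (ω i.succ) ∧
      ((∃ c ∈ G.levels, G.On (α, c) (ω i.castSucc) ∧ G.InMinus (α, c) (ω i.succ)) →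
        0 < G.stepDegree α (ω i.castSucc) (ω i.succ)) := by
    intro i α hα
    have h2 : ¬ ∃ c ∈ G.levels, G.On (α, c) (ω i.succ) ∧ G.InPlus (α, c) (ω i.castSucc) := by
      rintro ⟨c, hc, h3, h4⟩
      exact hnoenter ⟨(α, c), hα, hc⟩ i h3 h4
    rw [stepDegree, if_neg h2, sub_zero]
    split_ifs with h1
    · simp
    · simp [h1]
  -- A sum of nonnegative step degrees equal to zero has only zero terms.
  have hnoleave : ∀ (h : G.Hyp) (i : Fin n), G.On h.1 (ω i.castSucc) →
      ¬ G.InMinus h.1 (ω i.succ) := by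
    intro h i hon hmin
    have hdeg := hadm.deg_eq_zero (Fin.last n)
    rw [degUpTo_last] at hdeg
    have h1 := (Finset.sum_eq_zero_iff_of_nonneg fun i _ =>
      Finset.sum_nonneg fun α hα => (hstep i α hα).1).1 hdeg i (Finset.mem_univ i)
    have h2 := (Finset.sum_eq_zero_iff_of_nonneg fun α hα => (hstep i α hα).1).1 h1 h.1.1 h.2.1
    have h3 := (hstep i h.1.1 h.2.1).2 ⟨h.1.2, h.2.2, hon, hmin⟩
    omega
  refine ⟨h0, hreg, hinterval, fun k h h' hne h1 h2 => hadm.orthogonal k h.1 h.2 h'.1 h'.2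
    (fun he => hne (Subtype.ext he)) h1 h2, fun h k => ⟨?_, fun hle => ?_⟩⟩
  · rintro ⟨i, hik, hi⟩
    induction k using Fin.induction with
    | zero =>
      rw [Fin.le_zero_iff.1 hik] at hi
      rw [hi, zero_mul]
    | succ k ih =>
      rcases hik.lt_or_eq with h1 | h1
      · have h2 := ih (Fin.le_castSucc_iff.2 h1)
        rcases h2.lt_or_eq with h3 | h3
        · by_contra h4
          rw [not_le] at h4
          have h5 := hadm.no_jump k h.1 h.2
          have h6 := mul_neg_of_neg_of_pos h3 h4
          have h7 := mul_self_nonneg (G.side h.1 0)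
          have h8 := mul_nonneg h5 h7
          nlinarith
        · have h4 : G.On h.1 (ω k.castSucc) :=
            (mul_eq_zero.1 h3).resolve_right (G.regular_side G.regular_zero h)
          exact not_lt.1 (hnoleave h k h4)
      · rw [h1] at hi
        rw [hi, zero_mul]
  · by_contra hn
    have := hminus h k hn
    linarith

variable {G}

namespace IsTransversal

variable {n : ℕ} {ω : Fin (n + 1) → ESpace r}

/-- The alcove just beyond all the hyperplanes met by the path up to a given time. -/
theorem exists_alcove (hω : G.IsTransversal ω) (k : Fin (n + 1)) : ∃ a : G.Alcove,
    G.asep G.fundamental a = {h | ∃ i ≤ k, G.On h.1 (ω i)} := by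
  obtain ⟨ε, hε, hstep⟩ := G.exists_small_step (ω k) (ω k)
  -- The point is pushed radially away from the origin. On a hyperplane through `ω k` the side value
  -- becomes `-ε` times that of the origin, so `x` lies just beyond all of them.
  set x := ω k + ε • ω k with hx
  have hon : ∀ h : G.Hyp, G.On h.1 (ω k) → G.side h.1 x = -ε * G.side h.1 0 := by
    intro h hh
    have h1 : x = 0 + (1 + ε) • (ω k - 0) := by rw [hx]; module
    rw [On] at hh
    rw [h1, side_lineMap, hh]
    ring
  have hxr : G.Regular x := by
    intro h hh h0
    by_cases h1 : G.On h (ω k)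
    · have h2 := hon ⟨h, hh⟩ h1
      rw [On] at h0
      rw [h0] at h2
      have := G.regular_side G.regular_zero ⟨h, hh⟩
      have h3 : ε * G.side h 0 = 0 := by linarith
      rcases mul_eq_zero.1 h3 with h4 | h4
      · exact hε.ne' h4
      · exact this h4
    · have := (hstep ⟨h, hh⟩ h1).1
      rw [On] at h0
      simp only [h0, mul_zero, lt_irrefl] at this
  refine ⟨G.alcoveOf x hxr, ?_⟩
  rw [G.asep_eq G.zero_mem_fundamental (G.mem_alcoveOf hxr)]
  ext h
  rw [Set.mem_ofPred_eq, hω.met_iff, mem_sep, mul_comm]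
  have h0 := mul_self_pos.2 (G.regular_side G.regular_zero h)
  by_cases h1 : G.On h.1 (ω k)
  · rw [hon h h1]
    rw [On] at h1
    rw [h1]
    constructor
    · intro; simp
    · intro; nlinarith
  · have h2 := (hstep h h1).1
    have h3 := mul_self_pos.2 h1
    constructor
    · intro h4
      by_contra h5
      rw [not_le] at h5
      have := mul_pos h2 h5
      nlinarith [mul_neg_of_neg_of_pos h4 h3]
    · intro h4
      have h5 : G.side h.1 (ω k) * G.side h.1 0 < 0 := lt_of_le_of_ne h4
        (mul_ne_zero h1 (G.regular_side G.regular_zero h))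
      by_contra h6
      rw [not_lt] at h6
      have := mul_neg_of_pos_of_neg h2 h5
      nlinarith [mul_nonneg h6 h3.le]

theorem inPlus_iff_mem_asep (h : G.Hyp) (a : G.Alcove) :
    (∀ x ∈ a.1, G.InPlus h.1 x) ↔ h ∈ G.asep G.fundamental a := by
  constructor
  · intro hx
    rw [G.asep_eq G.zero_mem_fundamental (G.pt_mem a), mem_sep, mul_comm]
    exact hx _ (G.pt_mem a)
  · intro hh x hx
    rw [G.asep_eq G.zero_mem_fundamental hx, mem_sep, mul_comm] at hh
    exact hh

/-- An alcove is a candidate when its hyperplanes separating it from `a₀` include all those met so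
far. By `exists_alcove` some alcove has exactly these, so minimal length means equality. -/
theorem isAlcoveAt_iff (hω : G.IsTransversal ω) (k : Fin (n + 1)) (a : G.Alcove) :
    G.IsAlcoveAt ω k a ↔ G.asep G.fundamental a = {h | ∃ i ≤ k, G.On h.1 (ω i)} := by
  have hsub : ∀ b : G.Alcove, (∀ h ∈ G.hyperplanes, (∃ i ≤ k, G.On h (ω i)) →
      ∀ x ∈ b.1, G.InPlus h x) ↔ {h : G.Hyp | ∃ i ≤ k, G.On h.1 (ω i)} ⊆ G.asep G.fundamental b := by
    intro b
    constructor
    · exact fun hb h hh => (inPlus_iff_mem_asep h b).1 (hb h.1 h.2 hh)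
    · exact fun hb h hh hm => (inPlus_iff_mem_asep ⟨h, hh⟩ b).2 (hb (a := ⟨h, hh⟩) hm)
  rw [IsAlcoveAt, hsub]
  simp only [hsub]
  constructor
  · rintro ⟨h1, h2⟩
    obtain ⟨b, hb⟩ := hω.exists_alcove k
    have h3 := h2 b hb.ge
    rw [len_eq, len_eq, nsep, nsep, hb] at h3
    exact (Set.eq_of_subset_of_ncard_le h1 h3 (G.asep_finite _ _)).symm
  · intro h1
    refine ⟨h1.ge, fun b hb => ?_⟩
    rw [len_eq, len_eq, nsep, nsep]
    rw [← h1] at hb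
    exact Set.ncard_le_ncard hb (G.asep_finite _ _)

/-- The path ends in the last alcove. -/
theorem eq_alcoveOf_end (hω : G.IsTransversal ω) {a : G.Alcove}
    (ha : G.IsAlcoveAt ω (Fin.last n) a) : a = G.alcoveOf (ω (Fin.last n)) hω.regular := by
  apply G.eq_of_asep_eq_empty
  have h1 := (hω.isAlcoveAt_iff _ a).1 ha
  have h2 : G.asep G.fundamental (G.alcoveOf (ω (Fin.last n)) hω.regular) =
      G.asep G.fundamental a := by
    rw [h1, G.asep_eq G.zero_mem_fundamental (G.mem_alcoveOf hω.regular)]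
    ext h
    rw [Set.mem_ofPred_eq, hω.met_iff, mem_sep, mul_comm]
    exact ⟨le_of_lt, fun h4 => lt_of_le_of_ne h4
      (mul_ne_zero (G.regular_side hω.regular h) (G.regular_side G.regular_zero h))⟩
  ext h
  rw [G.mem_asep_trans a G.fundamental, G.asep_comm a, h2]
  simp

/-- A chain of alcoves of increasing length which passes all the alcoves of the path up to time `k`
and ends in `a`. -/
def Chain (ω : Fin (n + 1) → ESpace r) (k : Fin (n + 1)) (a : G.Alcove) : Prop :=
  ∃ (N : ℕ) (g : ℕ → G.Alcove), g 0 = G.fundamental ∧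
    (∀ i < N, G.adjacency.Adj (g i) (g (i + 1)) ∧ G.len (g i) < G.len (g (i + 1))) ∧
    (∀ k' ≤ k, ∃ i ≤ N, G.IsAlcoveAt ω k' (g i)) ∧ g N = a

/-- A step towards `b` crosses a hyperplane separating `a` from `b`. By the inclusion it separates
`b`, but not yet `a`, from the origin, so the length grows. -/
theorem Chain.extend {k : Fin (n + 1)} {a b : G.Alcove} (h : Chain ω k a)
    (hab : G.asep G.fundamental a ⊆ G.asep G.fundamental b) : Chain ω k b := by
  induction hm : G.nsep a b generalizing a with
  | zero => rwa [← G.nsep_eq_zero.1 hm]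
  | succ m ih =>
    have hne : a ≠ b := fun h0 => by rw [G.nsep_eq_zero.2 h0] at hm; simp at hm
    obtain ⟨a', κ, h1, h2⟩ := G.exists_adj_toward hne
    have h3 : κ ∉ G.asep G.fundamental a ∧ κ ∈ G.asep G.fundamental b := by
      have h4 := G.mem_asep_trans a G.fundamental b κ
      rw [G.asep_comm a G.fundamental] at h4
      have h5 := @hab κ
      tauto
    have h4 : G.asep G.fundamental a' = insert κ (G.asep G.fundamental a) := by
      rw [G.asep_comm _ a', G.asep_comm _ a]
      exact G.asep_of_adj_notMem h1 (by rw [asep_comm]; exact h3.1)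
    refine ih ?_ (by rw [h4]; exact Set.insert_subset h3.2 hab) ?_
    · obtain ⟨N, g, hg0, hg, hgk, rfl⟩ := h
      refine ⟨N + 1, Function.update g (N + 1) a', ?_, fun i hi => ?_, fun k' hk' => ?_, by simp⟩
      · rw [Function.update_of_ne (by omega), hg0]
      · rw [Function.update_of_ne (by omega)]
        rcases Nat.lt_succ_iff_lt_or_eq.1 hi with hi' | rfl
        · rw [Function.update_of_ne (by omega)]
          exact hg i hi'
        · rw [Function.update_self]
          exact ⟨(G.adj_iff _ _).2 ⟨κ, h1⟩, (G.len_lt_iff' h1).2 h3.1⟩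
      · obtain ⟨i, hi, hi'⟩ := hgk k' hk'
        exact ⟨i, by omega, by rwa [Function.update_of_ne (by omega)]⟩
    · have := G.nsep_of_adj_mem h1 h2
      omega

theorem exists_chain (hω : G.IsTransversal ω) (k : Fin (n + 1)) :
    ∃ a, G.IsAlcoveAt ω k a ∧ Chain ω k a := by
  induction k using Fin.induction with
  | zero =>
    have h1 : G.IsAlcoveAt ω 0 G.fundamental := by
      rw [hω.isAlcoveAt_iff, asep_self, eq_comm, Set.eq_empty_iff_forall_notMem]
      rintro h ⟨i, hi, hi'⟩
      rw [Fin.le_zero_iff.1 hi, hω.zero] at hi'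
      exact G.regular_zero h.1 h.2 hi'
    exact ⟨G.fundamental, h1, 0, fun _ => G.fundamental, rfl, fun i hi => absurd hi (by omega),
      fun k' hk' => ⟨0, le_rfl, by rwa [Fin.le_zero_iff.1 hk']⟩, rfl⟩
  | succ i ih =>
    obtain ⟨a, ha, hc⟩ := ih
    obtain ⟨b, hb⟩ := hω.exists_alcove i.succ
    have hb' := (hω.isAlcoveAt_iff _ b).2 hb
    refine ⟨b, hb', ?_⟩
    have hab : G.asep G.fundamental a ⊆ G.asep G.fundamental b := by
      rw [hb, (hω.isAlcoveAt_iff _ a).1 ha]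
      rintro h ⟨m, hm, hm'⟩
      exact ⟨m, hm.trans i.castSucc_lt_succ.le, hm'⟩
    obtain ⟨N, g, hg0, hg, hgk, hgN⟩ := hc.extend hab
    refine ⟨N, g, hg0, hg, fun k' hk' => ?_, hgN⟩
    rcases hk'.lt_or_eq with h1 | rfl
    · exact hgk k' (Fin.le_castSucc_iff.2 h1)
    · exact ⟨N, le_rfl, by rwa [hgN]⟩

theorem exists_alcoveSeries (hω : G.IsTransversal ω) : ∃ N g, G.IsAlcoveSeries ω N g := by
  obtain ⟨a, ha, N, g, hg0, hg, hgk, hgN⟩ := hω.exists_chain (Fin.last n)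
  exact ⟨N, g, hg0, hg, fun k => hgk k (Fin.le_last k), by rwa [hgN]⟩

end IsTransversal

end AlcoveGeometry

/-! ### Paths obtained by reflections correspond to sets of folds. -/

namespace AlcoveGeometry

variable {r : ℕ} {G : AlcoveGeometry r}

/-! ### Orthogonal hyperplanes and the sides of moved hyperplanes -/

theorem inner_coroot_eq_zero_comm {α β : ESpace r} (h : ⟪α, coroot β⟫_ℝ = 0) (hβ : β ≠ 0) :
    ⟪β, coroot α⟫_ℝ = 0 := by
  rw [coroot, inner_smul_right] at h ⊢
  have h1 : ⟪β, β⟫_ℝ ≠ 0 := by simpa using hβ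
  have h2 : ⟪α, β⟫_ℝ = 0 := (mul_eq_zero.1 h).resolve_left (div_ne_zero two_ne_zero h1)
  rw [real_inner_comm α β, h2, mul_zero]

theorem side_refl_of_orthogonal {h k : G.Hyp} (hk : ⟪k.1.1, coroot h.1.1⟫_ℝ = 0) (x : ESpace r) :
    G.side h.1 ((G.refl k).1 x) = G.side h.1 x := by
  change G.side h.1 (x - G.side k.1 x • k.1.1) = _
  rw [sub_eq_add_neg, ← neg_smul, side_add, real_inner_smul_left, hk, mul_zero, add_zero]

theorem refl_commute_of_orthogonal {h k : G.Hyp} (hk : ⟪k.1.1, coroot h.1.1⟫_ℝ = 0) :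
    G.refl h * G.refl k = G.refl k * G.refl h := by
  have hh := inner_coroot_eq_zero_comm hk (G.hyperplane_ne_zero h.2)
  refine Subtype.ext (Equiv.ext fun x => ?_)
  have h1 := side_refl_of_orthogonal hk x
  have h2 := side_refl_of_orthogonal hh x
  change (G.refl k).1 x - G.side h.1 ((G.refl k).1 x) • h.1.1 =
    (G.refl h).1 x - G.side k.1 ((G.refl h).1 x) • k.1.1
  rw [h1, h2]
  change x - _ • k.1.1 - _ = x - _ • h.1.1 - _
  abel

theorem act_refl_of_orthogonal {h k : G.Hyp} (hk : ⟪k.1.1, coroot h.1.1⟫_ℝ = 0) (w : G.W) :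
    G.act (w * G.refl k) h = G.act w h := by
  rw [act_mul]
  congr 1
  apply G.refl_injective
  rw [refl_act, ← refl_commute_of_orthogonal hk, mul_inv_cancel_right]

theorem act_mul_refl_self (h : G.Hyp) (w : G.W) : G.act (w * G.refl h) h = G.act w h := by
  rw [act_mul, act_refl_self]

/-- The element `w` moves the side of `h` containing the origin to the side of `w h` away from the
origin. -/
def Flips (w : G.W) (h : G.Hyp) : Prop := G.side (G.act w h).1 (w.1 0) * G.side (G.act w h).1 0 < 0

/-- The image under `w` of a point `x` lies on the same side of `w h` as the image of the origin
exactly when `x` lies on the side of the origin of `h`. The square factor takes the place of a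
division. -/
theorem side_act_mul (w : G.W) (h : G.Hyp) (x : ESpace r) :
    G.side (G.act w h).1 (w.1 x) * G.side (G.act w h).1 0 * (G.side h.1 0 * G.side h.1 0) =
      G.side h.1 x * G.side h.1 0 *
        (G.side (G.act w h).1 (w.1 0) * G.side (G.act w h).1 0) := by
  obtain ⟨ε, hε, h1⟩ := G.act_side w h
  rw [h1, h1]
  ring

theorem flips_ne_zero (w : G.W) (h : G.Hyp) :
    G.side (G.act w h).1 (w.1 0) * G.side (G.act w h).1 0 ≠ 0 :=
  mul_ne_zero (G.regular_side (G.regular_smul w G.regular_zero) _)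
    (G.regular_side G.regular_zero _)

theorem inMinus_act_of_inPlus {w : G.W} {h : G.Hyp} {x : ESpace r} (hx : G.InPlus h.1 x) :
    G.InMinus (G.act w h).1 (w.1 x) ↔ Flips w h := by
  have h1 := side_act_mul w h x
  have h2 := mul_self_pos.2 (G.regular_side G.regular_zero h)
  rw [InPlus] at hx
  rw [InMinus, Flips, ← mul_pos_iff_of_pos_right h2, h1, mul_pos_iff]
  constructor
  · rintro (⟨h3, -⟩ | ⟨-, h3⟩)
    · linarith
    · exact h3
  · exact fun h3 => Or.inr ⟨hx, h3⟩

theorem inPlus_act_of_inMinus {w : G.W} {h : G.Hyp} {x : ESpace r} (hx : G.InMinus h.1 x) :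
    G.InPlus (G.act w h).1 (w.1 x) ↔ Flips w h := by
  have h1 := side_act_mul w h x
  have h2 := mul_self_pos.2 (G.regular_side G.regular_zero h)
  rw [InMinus] at hx
  rw [InPlus, Flips]
  constructor
  · intro h3
    by_contra h4
    have h5 := mul_neg_of_neg_of_pos h3 h2
    have h6 := mul_nonneg hx.le (not_lt.1 h4)
    linarith
  · intro h3
    by_contra h4
    have h5 := mul_nonneg (not_lt.1 h4) h2.le
    have h6 := mul_neg_of_pos_of_neg hx h3
    linarith

/-- Reflecting in an orthogonal hyperplane keeps the origin on its side of `h`. -/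
theorem flips_mul_of_orthogonal {h k : G.Hyp} (hk : ⟪k.1.1, coroot h.1.1⟫_ℝ = 0) (w : G.W) :
    Flips (w * G.refl k) h ↔ Flips w h := by
  have h1 : G.InMinus h.1 ((G.refl k).1 0) := by
    rw [InMinus, side_refl_of_orthogonal hk]
    exact mul_self_pos.2 (G.regular_side G.regular_zero h)
  rw [← inPlus_act_of_inMinus (w := w) h1, Flips, act_refl_of_orthogonal hk]
  rfl

/-- The reflection in `h` preserves `h` and carries the origin to its other side. -/
theorem flips_mul_self (w : G.W) (h : G.Hyp) : Flips (w * G.refl h) h ↔ ¬ Flips w h := by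
  have h1 : G.InPlus h.1 ((G.refl h).1 0) := by
    rw [InPlus, side_reflect_self, neg_mul, neg_lt_zero]
    exact mul_self_pos.2 (G.regular_side G.regular_zero h)
  have h2 := flips_ne_zero (w * G.refl h) h
  rw [act_mul_refl_self] at h2
  rw [← inMinus_act_of_inPlus (w := w) h1, Flips, act_mul_refl_self, InMinus, not_lt]
  exact ⟨le_of_lt, fun h3 => lt_of_le_of_ne h3 h2⟩

/-! ### Folding a path along the hyperplanes it meets -/

open Classical in
/-- The product of the reflections in the first `m` hyperplanes selected by `V`. -/
noncomputable def foldW (h : ℕ → G.Hyp) (V : Finset ℕ) : ℕ → G.W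
  | 0 => 1
  | m + 1 => foldW h V m * (if m ∈ V then G.refl (h m) else 1)

theorem foldW_congr {h : ℕ → G.Hyp} {V V' : Finset ℕ} {m : ℕ} (hV : ∀ j < m, j ∈ V ↔ j ∈ V') :
    foldW h V m = foldW h V' m := by
  induction m with
  | zero => rfl
  | succ m ih =>
    simp only [foldW, ih fun j hj => hV j (by omega), hV m (by omega)]

theorem foldW_empty (h : ℕ → G.Hyp) (m : ℕ) : foldW h ∅ m = 1 := by
  induction m with
  | zero => rfl
  | succ m ih => simp [foldW, ih]

/-- The hyperplanes `h 0, …, h (N - 1)` are those met by the transversal path `ω`, ordered in such a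
way that those met up to time `k` are the first `J k`. -/
structure Wiring {n : ℕ} (ω : Fin (n + 1) → ESpace r) (N : ℕ) (h : ℕ → G.Hyp)
    (J : Fin (n + 1) → ℕ) : Prop where
  transversal : G.IsTransversal ω
  le : ∀ k, J k ≤ N
  last : J (Fin.last n) = N
  lt_iff : ∀ j < N, ∀ k, j < J k ↔ ∃ i ≤ k, G.On (h j).1 (ω i)
  surj : ∀ k (h' : G.Hyp), G.On h'.1 (ω k) → ∃ j < J k, h' = h j
  inj : ∀ i < N, ∀ j < N, h i = h j → i = j

/-- The path `ω` folded along the hyperplanes selected by `V`. -/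
noncomputable def foldPath {n : ℕ} (ω : Fin (n + 1) → ESpace r) (h : ℕ → G.Hyp)
    (J : Fin (n + 1) → ℕ) (V : Finset ℕ) (k : Fin (n + 1)) : ESpace r :=
  (foldW h V (J k)).1 (ω k)

namespace Wiring

variable {n : ℕ} {ω : Fin (n + 1) → ESpace r} {N : ℕ} {h : ℕ → G.Hyp} {J : Fin (n + 1) → ℕ}

theorem mono (w : Wiring ω N h J) {k l : Fin (n + 1)} (hkl : k ≤ l) : J k ≤ J l := by
  by_contra hc
  rw [not_le] at hc
  obtain ⟨i, hi, hi'⟩ := (w.lt_iff (J l) (hc.trans_le (w.le k)) k).1 hc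
  exact lt_irrefl _ ((w.lt_iff (J l) (hc.trans_le (w.le k)) l).2 ⟨i, hi.trans hkl, hi'⟩)

theorem lt_of_on (w : Wiring ω N h J) {j : ℕ} (hj : j < N) {k : Fin (n + 1)}
    (hk : G.On (h j).1 (ω k)) : j < J k := (w.lt_iff j hj k).2 ⟨k, le_rfl, hk⟩

theorem on_of_lt (w : Wiring ω N h J) {j : ℕ} {k l : Fin (n + 1)} (hj : j < J k) (hkl : k ≤ l)
    (hl : G.On (h j).1 (ω l)) : G.On (h j).1 (ω k) := by
  obtain ⟨i, hi, hi'⟩ := (w.lt_iff j (hj.trans_le (w.le k)) k).1 hj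
  exact w.transversal.interval _ i k l hi hkl hi' hl

/-- At a time `t ≤ l` when `h j'` is met, the earlier `h j` has been met too. It still contains `ω
l`, hence also `ω t`, so the two hyperplanes share that point. -/
theorem orthogonal (w : Wiring ω N h J) {j j' : ℕ} {l : Fin (n + 1)} (hl : G.On (h j).1 (ω l))
    (hj : j < j') (hj' : j' < J l) : ⟪(h j').1.1, coroot (h j).1.1⟫_ℝ = 0 := by
  have hN := hj'.trans_le (w.le l)
  obtain ⟨t, ht, ht'⟩ := (w.lt_iff j' hN l).1 hj'
  have h1 := w.on_of_lt (hj.trans (w.lt_of_on hN ht')) ht hl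
  exact w.transversal.orthogonal t _ _ (fun he => hj.ne' (w.inj _ hN _ (hj.trans hN) he)) ht' h1

theorem orthogonal' (w : Wiring ω N h J) {j j' : ℕ} {l : Fin (n + 1)} (hl : G.On (h j).1 (ω l))
    (hj : j < j') (hj' : j' < J l) : ⟪(h j).1.1, coroot (h j').1.1⟫_ℝ = 0 :=
  inner_coroot_eq_zero_comm (w.orthogonal hl hj hj') (G.hyperplane_ne_zero (h j).2)

/-- Folds made after `j`, as long as the path is still on `h j`, are in orthogonal hyperplanes and
do not affect it. Only the fold at `j` itself changes the orientation. -/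
theorem act_foldW (w : Wiring ω N h J) (V : Finset ℕ) {j m : ℕ} {l : Fin (n + 1)}
    (hl : G.On (h j).1 (ω l)) (hj : j < m) (hm : m ≤ J l) :
    G.act (foldW h V m) (h j) = G.act (foldW h V j) (h j) ∧
      (Flips (foldW h V m) (h j) ↔ ¬ (Flips (foldW h V j) (h j) ↔ j ∈ V)) := by
  induction m, hj using Nat.le_induction with
  | base =>
    by_cases hV : j ∈ V
    · simp [foldW, hV, act_mul_refl_self, flips_mul_self]
    · simp [foldW, hV]
  | succ m hj ih =>
    obtain ⟨h1, h2⟩ := ih (by omega)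
    by_cases hV : m ∈ V
    · have h3 := w.orthogonal hl (show j < m by omega) (by omega)
      simp only [foldW, hV, if_true]
      rw [act_refl_of_orthogonal h3, flips_mul_of_orthogonal h3]
      exact ⟨h1, h2⟩
    · simp only [foldW, hV, if_false, mul_one]
      exact ⟨h1, h2⟩

/-- The counterpart for folds with smaller index through the same point: they too are orthogonal to
`h j`. -/
theorem flips_foldW_of_le (w : Wiring ω N h J) (V : Finset ℕ) {j m : ℕ} {l : Fin (n + 1)}
    (hm : m ≤ j) (hj : j < J l) (hon : ∀ i, m ≤ i → i < j → G.On (h i).1 (ω l)) :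
    Flips (foldW h V j) (h j) ↔ Flips (foldW h V m) (h j) := by
  have key : ∀ i, m ≤ i → i ≤ j → (Flips (foldW h V i) (h j) ↔ Flips (foldW h V m) (h j)) := by
    intro i hi
    induction i, hi using Nat.le_induction with
    | base => exact fun _ => Iff.rfl
    | succ i hi ih =>
      intro hij
      rw [← ih (by omega)]
      by_cases hV : i ∈ V
      · simp only [foldW, hV, if_true]
        exact flips_mul_of_orthogonal (w.orthogonal' (hon i hi hij) hij hj) _
      · simp only [foldW, hV, if_false, mul_one]
  exact key j hm le_rfl

/-- The step from time `i` to `i + 1` is moved by the element folding time `i`. -/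
theorem foldPath_succ (w : Wiring ω N h J) (V : Finset ℕ) (i : Fin n) :
    foldPath ω h J V i.succ = (foldW h V (J i.castSucc)).1 (ω i.succ) := by
  have key : ∀ m, J i.castSucc ≤ m → m ≤ J i.succ →
      (foldW h V m).1 (ω i.succ) = (foldW h V (J i.castSucc)).1 (ω i.succ) := by
    intro m hm
    induction m, hm using Nat.le_induction with
    | base => exact fun _ => rfl
    | succ m hm ih =>
      intro hm'
      rw [← ih (by omega)]
      have hN : m < N := lt_of_lt_of_le hm' (w.le _)
      -- An index between the two values of `J` belongs to a hyperplane first met at `i.succ`, whose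
      -- reflection fixes that point.
      have hon : G.On (h m).1 (ω i.succ) := by
        obtain ⟨t, ht, ht'⟩ := (w.lt_iff m hN i.succ).1 hm'
        rcases ht.lt_or_eq with h1 | rfl
        · exact absurd ((w.lt_iff m hN i.castSucc).2 ⟨t, Fin.le_castSucc_iff.2 h1, ht'⟩) (by omega)
        · exact ht'
      by_cases hV : m ∈ V
      · simp only [foldW, hV, if_true]
        change (foldW h V m).1 (G.reflect (h m).1 (ω i.succ)) = _
        rw [(G.On_iff_reflect (h m).2 _).1 hon]
      · simp only [foldW, hV, if_false, mul_one]
  exact key _ (w.mono i.castSucc_lt_succ.le) le_rfl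

/-- The reflections selected after `j` commute with that in `h j`, so the toggled factor can be
moved to the right end. -/
theorem foldW_toggle (w : Wiring ω N h J) {V V' : Finset ℕ} {j : ℕ}
    (hV : ∀ i, i ≠ j → (i ∈ V' ↔ i ∈ V)) (hj : j ∈ V' ↔ j ∉ V) {l : Fin (n + 1)}
    (hl : G.On (h j).1 (ω l)) {m : ℕ} (hjm : j < m) (hm : m ≤ J l) :
    foldW h V' m = foldW h V m * G.refl (h j) := by
  induction m, hjm using Nat.le_induction with
  | base =>
    have h1 : foldW h V' j = foldW h V j := foldW_congr fun i hi => hV i (by omega)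
    by_cases hjV : j ∈ V
    · simp [foldW, h1, hj, hjV, mul_assoc, refl_mul_self]
    · simp [foldW, h1, hj, hjV]
  | succ m hjm ih =>
    have h1 := ih (by omega)
    have h2 := hV m (by omega)
    by_cases hmV : m ∈ V
    · simp only [foldW, h1, h2, hmV, if_true]
      rw [mul_assoc, mul_assoc, refl_commute_of_orthogonal
        (w.orthogonal hl (show j < m by omega) (by omega))]
    · simp only [foldW, h1, h2, hmV, if_false, mul_one]

/-- Reflecting a folded path in the image of a hyperplane through `ω k` toggles this hyperplane. -/
theorem reflectAt_foldPath (w : Wiring ω N h J) {V V' : Finset ℕ} {j : ℕ}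
    (hV : ∀ i, i ≠ j → (i ∈ V' ↔ i ∈ V)) (hj : j ∈ V' ↔ j ∉ V) {k : Fin (n + 1)}
    (hjk : j < J k) (hk : G.On (h j).1 (ω k)) :
    G.reflectAt (G.act (foldW h V (J k)) (h j)).1 k (foldPath ω h J V) = foldPath ω h J V' := by
  funext l
  by_cases hlk : l ≤ k
  · rw [reflectAt, if_pos hlk, foldPath, foldPath]
    -- If `h j` has already been met at time `l`, it contains `ω l` and its reflection has no effect
    -- there; if not, the fold has not yet taken place.
    by_cases hl : j < J l
    · have hon := w.on_of_lt hl hlk hk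
      rw [w.foldW_toggle hV hj hon hl le_rfl]
      change _ = (foldW h V (J l)).1 (G.reflect (h j).1 (ω l))
      rw [(G.On_iff_reflect (h j).2 _).1 hon]
    · rw [foldW_congr fun i hi => (hV i (by omega)).symm]
  -- From time `k` on, the factor at the right end becomes a conjugate reflection on the left, which
  -- is the reflection in the moved hyperplane.
  · have key : ∀ m, J k ≤ m →
        foldW h V' m = G.refl (G.act (foldW h V (J k)) (h j)) * foldW h V m := by
      intro m hm
      induction m, hm using Nat.le_induction with
      | base => rw [refl_act, w.foldW_toggle hV hj hk hjk le_rfl]; group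
      | succ m hm ih =>
        have h2 := hV m (by omega)
        simp only [foldW, ih, h2, mul_assoc]
    rw [reflectAt, if_neg hlk, foldPath, foldPath, key _ (w.mono (le_of_not_ge hlk))]
    rfl

theorem foldPath_empty : foldPath ω h J ∅ = ω := by
  funext k
  rw [foldPath, foldW_empty]
  rfl

/-- A hyperplane through a point of a folded path is the image of some `h j` through the original
point. Reflecting in it therefore toggles `j`, and every set of folds is reached by inserting its
elements one at a time. -/
theorem pathEquiv_iff (w : Wiring ω N h J) (ω' : Fin (n + 1) → ESpace r) :
    G.PathEquiv ω ω' ↔ ∃ V ⊆ Finset.range N, ω' = foldPath ω h J V := by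
  constructor
  · intro he
    induction he with
    | refl => exact ⟨∅, by simp, foldPath_empty.symm⟩
    | tail _ hstep ih =>
      obtain ⟨V, hV, rfl⟩ := ih
      obtain ⟨κ, hκ, k, hon, rfl⟩ := hstep
      have h1 : G.On (G.act (foldW h V (J k))⁻¹ ⟨κ, hκ⟩).1 (ω k) := by
        rw [← G.act_On (foldW h V (J k)), act_act_inv]
        exact hon
      obtain ⟨j, hj, hj'⟩ := w.surj k _ h1
      have h2 : (⟨κ, hκ⟩ : G.Hyp) = G.act (foldW h V (J k)) (h j) := by
        rw [← hj', act_act_inv]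
      have h3 : κ = (G.act (foldW h V (J k)) (h j)).1 := congrArg Subtype.val h2
      rw [hj'] at h1
      rw [h3]
      have hjN : j < N := hj.trans_le (w.le k)
      by_cases hjV : j ∈ V
      · exact ⟨V.erase j, (Finset.erase_subset _ _).trans hV, w.reflectAt_foldPath
          (fun i hi => by simp [hi]) (by simp [hjV]) hj h1⟩
      · exact ⟨insert j V, Finset.insert_subset (by simpa using hjN) hV, w.reflectAt_foldPath
          (fun i hi => by simp [hi]) (by simp [hjV]) hj h1⟩
  · rintro ⟨V, hV, rfl⟩
    induction V using Finset.induction_on with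
    | empty => rw [foldPath_empty]; exact Relation.ReflTransGen.refl
    | insert j V hjV ih =>
      refine (ih ((Finset.subset_insert _ _).trans hV)).tail ?_
      have hjN : j < N := by simpa using hV (Finset.mem_insert_self j V)
      have hlt : j < J (Fin.last n) := by rwa [w.last]
      obtain ⟨k, -, hk⟩ := (w.lt_iff j hjN _).1 hlt
      refine ⟨_, (G.act (foldW h V (J k)) (h j)).2, k, (G.act_On _ _ _).2 hk,
        (w.reflectAt_foldPath (fun i hi => by simp [hi]) (by simp [hjV]) (w.lt_of_on hjN hk)
          hk).symm⟩

/-- Each hyperplane is left exactly once, to the side away from the origin. -/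
theorem exists_leave (w : Wiring ω N h J) {j : ℕ} (hj : j < N) : ∃ i : Fin n,
    G.On (h j).1 (ω i.castSucc) ∧ G.InPlus (h j).1 (ω i.succ) ∧
      ∀ i' : Fin n, G.On (h j).1 (ω i'.castSucc) → ¬ G.On (h j).1 (ω i'.succ) → i' = i := by
  have hlt : j < J (Fin.last n) := by rwa [w.last]
  obtain ⟨k, -, hk⟩ := (w.lt_iff j hj _).1 hlt
  obtain ⟨i, h1, h2⟩ := exists_fin_leave (Q := fun k => G.On (h j).1 (ω k)) hk
    (w.transversal.regular _ (h j).2)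
  refine ⟨i, h1, ?_, fun i' h3 h4 => ?_⟩
  · have h3 := (w.transversal.met_iff (h j) i.succ).1 ⟨_, i.castSucc_lt_succ.le, h1⟩
    exact lt_of_le_of_ne h3 (mul_ne_zero h2 (G.regular_side G.regular_zero _))
  · rcases lt_trichotomy i' i with h5 | h5 | h5
    · exact absurd (w.transversal.interval _ _ _ _ i'.castSucc_lt_succ.le
        (Fin.le_castSucc_iff.2 (Fin.succ_lt_succ_iff.2 h5)) h3 h1) h4
    · exact h5
    · exact absurd (w.transversal.interval _ _ _ _ i.castSucc_lt_succ.le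
        (Fin.le_castSucc_iff.2 (Fin.succ_lt_succ_iff.2 h5)) h1 h3) h2

/-- Each hyperplane is entered exactly once, from the side of the origin. -/
theorem exists_enter (w : Wiring ω N h J) {j : ℕ} (hj : j < N) : ∃ i : Fin n,
    G.On (h j).1 (ω i.succ) ∧ G.InMinus (h j).1 (ω i.castSucc) ∧ J i.castSucc ≤ j ∧
      ∀ i' : Fin n, G.On (h j).1 (ω i'.succ) → ¬ G.On (h j).1 (ω i'.castSucc) → i' = i := by
  have hlt : j < J (Fin.last n) := by rwa [w.last]
  obtain ⟨k, -, hk⟩ := (w.lt_iff j hj _).1 hlt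
  obtain ⟨i, -, h2, h1⟩ := exists_fin_enter (Q := fun k => G.On (h j).1 (ω k)) hk
    (by rw [w.transversal.zero]; exact G.regular_zero _ (h j).2)
  have h0 : J i.castSucc ≤ j := by
    by_contra hc
    rw [not_le] at hc
    exact h2 (w.on_of_lt hc i.castSucc_lt_succ.le h1)
  refine ⟨i, h1, ?_, h0, fun i' h3 h4 => ?_⟩
  · rw [InMinus, ← not_le, ← w.transversal.met_iff, ← w.lt_iff j hj]
    omega
  · rcases lt_trichotomy i' i with h5 | h5 | h5
    · exact absurd (w.transversal.interval _ _ _ _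
        (Fin.le_castSucc_iff.2 (Fin.succ_lt_succ_iff.2 h5)) i.castSucc_lt_succ.le h3 h1) h2
    · exact h5
    · exact absurd (w.transversal.interval _ _ _ _
        (Fin.le_castSucc_iff.2 (Fin.succ_lt_succ_iff.2 h5)) i'.castSucc_lt_succ.le h1 h3) h4

/-- The side on which the folded path leaves `h j` shows the parity of the earlier orientation and
the fold at `j`. This serves both the degree formula and the recovery of `V`. -/
theorem inMinus_foldPath_leave (w : Wiring ω N h J) (V : Finset ℕ) {j : ℕ} (hj : j < N) {i : Fin n}
    (h1 : G.On (h j).1 (ω i.castSucc)) (h2 : G.InPlus (h j).1 (ω i.succ)) :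
    G.InMinus (G.act (foldW h V (J i.castSucc)) (h j)).1 (foldPath ω h J V i.succ) ↔
      ¬ (Flips (foldW h V j) (h j) ↔ j ∈ V) := by
  rw [w.foldPath_succ, inMinus_act_of_inPlus h2]
  exact (w.act_foldW V h1 (w.lt_of_on hj h1) le_rfl).2

/-- `V` is recovered index by index: once its smaller elements are known, the side on which the path
leaves `h j` decides whether `j ∈ V`. -/
theorem foldPath_injOn (w : Wiring ω N h J) :
    Set.InjOn (foldPath ω h J) {V | V ⊆ Finset.range N} := by
  intro V hV V' hV' he
  have key : ∀ m, ∀ j < m, j < N → (j ∈ V ↔ j ∈ V') := by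
    intro m
    induction m with
    | zero => intro j hj; omega
    | succ m ih =>
      intro j hj hjN
      have hfold : foldW h V j = foldW h V' j := foldW_congr fun i hi => ih i (by omega) (by omega)
      obtain ⟨i, h1, h2, -⟩ := w.exists_leave hjN
      have h3 := w.inMinus_foldPath_leave V hjN h1 h2
      have h4 := w.inMinus_foldPath_leave V' hjN h1 h2
      rw [(w.act_foldW V h1 (w.lt_of_on hjN h1) le_rfl).1, hfold, he] at h3
      rw [(w.act_foldW V' h1 (w.lt_of_on hjN h1) le_rfl).1, h3] at h4
      tauto
  ext j
  by_cases hj : j < N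
  · exact key (j + 1) j (by omega) hj
  · exact ⟨fun h => absurd (Finset.mem_range.1 (hV h)) hj,
      fun h => absurd (Finset.mem_range.1 (hV' h)) hj⟩

end Wiring

end AlcoveGeometry

open LaurentPolynomial (T)

namespace AlcoveGeometry

variable {r : ℕ} {G : AlcoveGeometry r}

/-! ### Degrees of folded paths -/

theorem indicator_congr {a b : Prop} {_ : Decidable a} {_ : Decidable b} (h : a ↔ b) :
    (if a then (1 : ℤ) else 0) = if b then 1 else 0 := if_congr h rfl rfl

open Classical in
/-- At most one hyperplane of each direction passes through a point, so that directions can be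
counted by hyperplanes. -/
theorem sum_pos_indicator (Q : ESpace r × ℝ → Prop) (u : ESpace r) (hQ : ∀ h, Q h → G.On h u)
    (F : ℕ → G.Hyp) (N : ℕ) (hinj : ∀ i < N, ∀ j < N, F i = F j → i = j)
    (hsurj : ∀ h : G.Hyp, Q h.1 → ∃ j < N, h = F j) :
    ∑ α ∈ G.pos, (if ∃ c ∈ G.levels, Q (α, c) then (1 : ℤ) else 0) =
      ∑ j ∈ Finset.range N, if Q (F j).1 then 1 else 0 := by
  rw [Finset.sum_boole, Finset.sum_boole]
  congr 1
  symm
  refine Finset.card_bij (fun j _ => (F j).1.1) ?_ ?_ ?_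
  · intro j hj
    rw [Finset.mem_filter] at hj ⊢
    exact ⟨(F j).2.1, (F j).1.2, (F j).2.2, hj.2⟩
  · intro i hi j hj he
    simp only [Finset.mem_filter, Finset.mem_range] at hi hj
    refine hinj i hi.1 j hj.1 (Subtype.ext (Prod.ext he ?_))
    have h1 := hQ _ hi.2
    have h2 := hQ _ hj.2
    rw [On, side, sub_eq_zero] at h1 h2
    rw [← h1, ← h2, he]
  · intro α hα
    rw [Finset.mem_filter] at hα
    obtain ⟨hα, c, hc, hq⟩ := hα
    obtain ⟨j, hj, he⟩ := hsurj ⟨(α, c), hα, hc⟩ hq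
    refine ⟨j, ?_, by rw [← he]⟩
    rw [Finset.mem_filter, Finset.mem_range, ← he]
    exact ⟨hj, hq⟩

open Classical in
/-- The sum of the signs of the folds up to `m`: a fold counts `-1` if it is towards the side away
from the origin, and `1` otherwise. -/
noncomputable def foldDeg (h : ℕ → G.Hyp) (V : Finset ℕ) (m : ℕ) : ℤ :=
  ∑ j ∈ Finset.range m, if j ∈ V then (if Flips (foldW h V j) (h j) then -1 else 1) else 0

theorem foldDeg_congr {h : ℕ → G.Hyp} {V V' : Finset ℕ} {m : ℕ} (hV : ∀ j < m, j ∈ V ↔ j ∈ V') :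
    foldDeg h V m = foldDeg h V' m := by
  refine Finset.sum_congr rfl fun j hj => ?_
  rw [Finset.mem_range] at hj
  rw [foldW_congr fun i hi => hV i (hi.trans hj)]
  simp only [hV j hj]

namespace Wiring

variable {n : ℕ} {ω : Fin (n + 1) → ESpace r} {N : ℕ} {h : ℕ → G.Hyp} {J : Fin (n + 1) → ℕ}

-- Each `h j` contributes at one entry and at one exit. The entry counts `-1` if `h j` is flipped.
-- The exit counts `+1` if exactly one of flip and fold takes place. Without a fold the two cancel;
-- a fold leaves `-1` or `+1` according to the flip.
open Classical in
theorem deg_foldPath (w : Wiring ω N h J) (V : Finset ℕ) :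
    G.deg (foldPath ω h J V) = foldDeg h V N := by
  rw [deg, degUpTo_last]
  have hstep : ∀ i : Fin n, ∑ α ∈ G.pos, G.stepDegree α (foldPath ω h J V i.castSucc)
      (foldPath ω h J V i.succ) = ∑ j ∈ Finset.range N,
        ((if G.On (h j).1 (ω i.castSucc) ∧ G.InMinus (G.act (foldW h V (J i.castSucc)) (h j)).1
            (foldPath ω h J V i.succ) then (1 : ℤ) else 0) -
          (if G.On (h j).1 (ω i.succ) ∧ G.InPlus (G.act (foldW h V (J i.castSucc)) (h j)).1
            (foldPath ω h J V i.castSucc) then 1 else 0)) := by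
    intro i
    simp only [stepDegree]
    rw [Finset.sum_sub_distrib, Finset.sum_sub_distrib]
    have hinj : ∀ i' < N, ∀ j < N, G.act (foldW h V (J i.castSucc)) (h i') =
        G.act (foldW h V (J i.castSucc)) (h j) → i' = j :=
      fun i' hi' j hj he => w.inj i' hi' j hj (G.act_injective _ he)
    have hsurj : ∀ (k : Fin (n + 1)) (κ : G.Hyp),
        G.On κ.1 ((foldW h V (J i.castSucc)).1 (ω k)) →
        ∃ j < N, κ = G.act (foldW h V (J i.castSucc)) (h j) := by
      intro k κ hκ
      rw [← G.act_act_inv (foldW h V (J i.castSucc)) κ, act_On] at hκ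
      obtain ⟨j, hj, hj'⟩ := w.surj k _ hκ
      exact ⟨j, hj.trans_le (w.le k), by rw [← hj', act_act_inv]⟩
    congr 1
    · rw [sum_pos_indicator (fun κ => G.On κ (foldPath ω h J V i.castSucc) ∧
        G.InMinus κ (foldPath ω h J V i.succ)) _ (fun κ hκ => hκ.1)
        (fun j => G.act (foldW h V (J i.castSucc)) (h j)) N hinj fun κ hκ => hsurj _ κ hκ.1]
      refine Finset.sum_congr rfl fun j _ => ?_
      exact indicator_congr (and_congr_left fun _ => G.act_On _ _ _)
    · rw [sum_pos_indicator (fun κ => G.On κ (foldPath ω h J V i.succ) ∧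
        G.InPlus κ (foldPath ω h J V i.castSucc)) _ (fun κ hκ => hκ.1)
        (fun j => G.act (foldW h V (J i.castSucc)) (h j)) N hinj fun κ hκ =>
          hsurj i.succ κ (by rw [← w.foldPath_succ]; exact hκ.1)]
      refine Finset.sum_congr rfl fun j _ => ?_
      refine indicator_congr (and_congr_left fun _ => ?_)
      rw [w.foldPath_succ, act_On]
  rw [Finset.sum_congr rfl fun i _ => hstep i, Finset.sum_comm, foldDeg]
  refine Finset.sum_congr rfl fun j hj => ?_
  rw [Finset.mem_range] at hj
  rw [Finset.sum_sub_distrib]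
  have hleave : ∑ i : Fin n, (if G.On (h j).1 (ω i.castSucc) ∧
      G.InMinus (G.act (foldW h V (J i.castSucc)) (h j)).1 (foldPath ω h J V i.succ)
      then (1 : ℤ) else 0) = if ¬ (Flips (foldW h V j) (h j) ↔ j ∈ V) then 1 else 0 := by
    obtain ⟨i, h1, h2, h3⟩ := w.exists_leave hj
    rw [Finset.sum_eq_single i]
    · have := w.inMinus_foldPath_leave V hj h1 h2
      simp only [h1, true_and, this]
    · intro i' _ hne
      rw [if_neg]
      rintro ⟨h4, h5⟩
      refine hne (h3 i' h4 fun h6 => ?_)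
      rw [w.foldPath_succ, InMinus, (G.act_On _ _ _).2 h6, zero_mul] at h5
      exact lt_irrefl _ h5
    · simp
  have henter : ∑ i : Fin n, (if G.On (h j).1 (ω i.succ) ∧
      G.InPlus (G.act (foldW h V (J i.castSucc)) (h j)).1 (foldPath ω h J V i.castSucc)
      then (1 : ℤ) else 0) = if Flips (foldW h V j) (h j) then 1 else 0 := by
    obtain ⟨i, h1, h2, h0, h3⟩ := w.exists_enter hj
    rw [Finset.sum_eq_single i]
    · have h4 := inPlus_act_of_inMinus (w := foldW h V (J i.castSucc)) h2
      rw [← w.flips_foldW_of_le V h0 (w.lt_of_on hj h1)] at h4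
      · rw [foldPath, h4]
        simp only [h1, true_and]
      -- These hyperplanes are first met at the same step as `h j`, so they pass through the same
      -- point.
      · intro m hm hmj
        obtain ⟨t, ht, ht'⟩ := (w.lt_iff m (hmj.trans hj) i.succ).1 (hmj.trans (w.lt_of_on hj h1))
        rcases ht.lt_or_eq with h5 | rfl
        · exact absurd ((w.lt_iff m (hmj.trans hj) i.castSucc).2
            ⟨t, Fin.le_castSucc_iff.2 h5, ht'⟩) (by omega)
        · exact ht'
    · intro i' _ hne
      rw [if_neg]
      rintro ⟨h4, h5⟩
      refine hne (h3 i' h4 fun h6 => ?_)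
      rw [foldPath, InPlus, (G.act_On _ _ _).2 h6, zero_mul] at h5
      exact lt_irrefl _ h5
    · simp
  rw [hleave, henter]
  by_cases hV : j ∈ V <;> by_cases hF : Flips (foldW h V j) (h j) <;> simp [hV, hF]

end Wiring

/-! ### Alcove series and folded paths -/

open Classical in
/-- The pattern of a chain of alcoves of increasing length enumerates the folded chains. -/
theorem chainPattern_eq_sum {g : ℕ → G.Alcove} {h : ℕ → G.Hyp} {N : ℕ}
    (hg : ∀ j < N, G.asep (g j) (g (j + 1)) = {h j})
    (hh : ∀ j < N, h j ∉ G.asep G.fundamental (g j)) (m : ℕ) (hm : m ≤ N) (b : G.Alcove) :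
    chainPattern G g m b = ∑ V ∈ (Finset.range m).powerset,
      if foldW h V m • g m = b then T (foldDeg h V m) else 0 := by
  induction m generalizing b with
  | zero =>
    simp [chainPattern, delta, foldW, foldDeg, eq_comm]
  | succ m ih =>
    have hmN : m < N := hm
    have hadj : G.adjacency.Adj (g m) (g (m + 1)) := (G.adj_iff _ _).2 ⟨_, hg m hmN⟩
    rw [Finset.range_add_one, Finset.sum_powerset_insert (by simp), chainPattern, soergelStep,
      ih hmN.le, ih hmN.le]
    congr 1
    -- Sets without `m` let the gallery cross the wall and give the term `f (s · b)` of the step.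
    · refine Finset.sum_congr rfl fun V hV => ?_
      have hmV : m ∉ V := fun hc => by simpa using Finset.mem_powerset.1 hV hc
      have h1 : foldDeg h V (m + 1) = foldDeg h V m := by
        rw [foldDeg, Finset.sum_range_succ, if_neg hmV, add_zero, foldDeg]
      have h2 : foldW h V (m + 1) = foldW h V m := by simp [foldW, hmV]
      rw [h1, h2, ← G.cross_smul (g m) (g (m + 1))]
      refine if_congr ⟨fun h3 => ?_, fun h3 => ?_⟩ rfl rfl
      · rw [h3, G.cross_involutive hadj]
      · rw [← h3, G.cross_involutive hadj]
    -- Sets containing `m` fold the gallery back into the same alcove and give the diagonal term of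
    -- the step.
    · rw [Finset.mul_sum]
      refine Finset.sum_congr rfl fun V hV => ?_
      have hmV : m ∉ V := fun hc => by simpa using Finset.mem_powerset.1 hV hc
      have hag : ∀ j < m, j ∈ insert m V ↔ j ∈ V := fun j hj => by
        rw [Finset.mem_insert]
        exact ⟨fun hc => hc.resolve_left (by omega), Or.inr⟩
      have h1 : foldDeg h (insert m V) (m + 1) =
          foldDeg h V m + if Flips (foldW h V m) (h m) then -1 else 1 := by
        rw [← foldDeg_congr hag, ← foldW_congr hag]
        simp [foldDeg, Finset.sum_range_succ]
      have h2 : foldW h (insert m V) (m + 1) • g (m + 1) = foldW h V m • g m := by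
        rw [foldW, foldW_congr hag, if_pos (Finset.mem_insert_self _ _), mul_smul,
          G.refl_smul_of_asep (a := g (m + 1)) (b := g m) (by rw [asep_comm, hg m hmN])]
      rw [h1, h2, mul_ite, mul_zero]
      refine if_ctx_congr Iff.rfl (fun hb => ?_) fun _ => rfl
      -- Crossing is a descent when the moved wall separates `b` from the origin. As `h m` does not
      -- separate `g m` from the origin, this is decided by where the fold moves the origin.
      have h3 : G.len (G.cross (g m) (g (m + 1)) b) < G.len b ↔ Flips (foldW h V m) (h m) := by
        have h4 := G.asep_cross (hg m hmN) (foldW h V m)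
        rw [← hb, G.len_lt_iff h4, G.asep_eq G.zero_mem_fundamental (G.smul_mem (G.pt_mem _)),
          G.mem_sep_trans G.regular_zero (G.regular_smul (foldW h V m) G.regular_zero)
            (G.regular_smul _ (G.pt_regular _)), act_mem_sep,
          ← G.asep_eq G.zero_mem_fundamental (G.pt_mem (g m)), Flips, mem_sep, mul_comm]
        have := hh m hmN
        tauto
      simp only [h3]
      split_ifs with h4
      · rw [← LaurentPolynomial.T_add, add_comm]
      · rw [← LaurentPolynomial.T_add, add_comm]

/-- `h j` is the wall crossed at step `j`, and `J k` is the position of the alcove `A_k`. Lengths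
increase, so the hyperplanes separating `g m` from the origin are exactly the first `m` walls, all
distinct. -/
theorem IsAlcoveSeries.exists_wiring [Nonempty G.Hyp] {n : ℕ} {ω : Fin (n + 1) → ESpace r} {N : ℕ}
    {g : ℕ → G.Alcove} (hs : G.IsAlcoveSeries ω N g) (hω : G.IsTransversal ω) :
    ∃ (h : ℕ → G.Hyp) (J : Fin (n + 1) → ℕ), Wiring ω N h J ∧
      (∀ j < N, G.asep (g j) (g (j + 1)) = {h j}) ∧
      ∀ j < N, h j ∉ G.asep G.fundamental (g j) := by
  have hex : ∀ j, ∃ κ : G.Hyp, j < N → G.asep (g j) (g (j + 1)) = {κ} := by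
    intro j
    by_cases hj : j < N
    · obtain ⟨κ, hκ⟩ := (G.adj_iff _ _).1 (hs.adj j hj).1
      exact ⟨κ, fun _ => hκ⟩
    -- Values of `h` from `N` on are arbitrary; `Nonempty G.Hyp` serves only to supply them.
    · exact ⟨Classical.arbitrary _, fun h => absurd h hj⟩
  choose h hh using hex
  have hn : ∀ j < N, h j ∉ G.asep G.fundamental (g j) := fun j hj =>
    (G.len_lt_iff' (hh j hj)).1 (hs.adj j hj).2
  have hsep : ∀ m ≤ N, ∀ κ, κ ∈ G.asep G.fundamental (g m) ↔ ∃ j < m, κ = h j := by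
    intro m
    induction m with
    | zero =>
      have h0 : g 0 = G.fundamental := by cases hs; assumption
      intro _ κ
      simp [h0, asep_self]
    | succ m ih =>
      intro hm κ
      have h1 : G.asep G.fundamental (g (m + 1)) = insert (h m) (G.asep G.fundamental (g m)) := by
        rw [G.asep_comm _ (g (m + 1)), G.asep_comm _ (g m)]
        exact G.asep_of_adj_notMem (hh m hm) (by rw [asep_comm]; exact hn m hm)
      rw [h1, Set.mem_insert_iff, ih (by omega)]
      constructor
      · rintro (rfl | ⟨j, hj, rfl⟩)
        · exact ⟨m, by omega, rfl⟩
        · exact ⟨j, by omega, rfl⟩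
      · rintro ⟨j, hj, rfl⟩
        rcases Nat.lt_succ_iff_lt_or_eq.1 hj with h2 | rfl
        · exact Or.inr ⟨j, h2, rfl⟩
        · exact Or.inl rfl
  have hinj' : ∀ i j, i < j → j < N → h i ≠ h j := fun i j hij hj he =>
    hn j hj ((hsep j hj.le _).2 ⟨i, hij, he.symm⟩)
  have hinj : ∀ i < N, ∀ j < N, h i = h j → i = j := by
    intro i hi j hj he
    rcases lt_trichotomy i j with h1 | h1 | h1
    · exact absurd he (hinj' i j h1 hj)
    · exact h1
    · exact absurd he.symm (hinj' j i h1 hi)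
  choose J hJ hJ' using hs.mem
  have hmet : ∀ k κ, (∃ i ≤ k, G.On κ.1 (ω i)) ↔ ∃ j < J k, κ = h j := by
    intro k κ
    rw [← hsep (J k) (hJ k), (hω.isAlcoveAt_iff k _).1 (hJ' k)]
    rfl
  have hlt : ∀ j < N, ∀ k, j < J k ↔ ∃ i ≤ k, G.On (h j).1 (ω i) := by
    intro j hj k
    rw [hmet]
    constructor
    · exact fun h1 => ⟨j, h1, rfl⟩
    · rintro ⟨j', h1, h2⟩
      rwa [hinj j hj j' (h1.trans_le (hJ k)) h2]
  refine ⟨h, J, ⟨hω, hJ, ?_, hlt, fun k κ hκ => (hmet k κ).1 ⟨k, le_rfl, hκ⟩, hinj⟩, hh, hn⟩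
  by_contra hne
  have h1 : J (Fin.last n) < N := lt_of_le_of_ne (hJ _) hne
  have h2 := (hω.isAlcoveAt_iff _ _).1 hs.finish
  rw [← (hω.isAlcoveAt_iff _ _).1 (hJ' (Fin.last n))] at h2
  have h3 := (hsep N le_rfl (h (J (Fin.last n)))).2 ⟨_, h1, rfl⟩
  rw [h2, hsep _ h1.le] at h3
  obtain ⟨j, hj, he⟩ := h3
  exact hinj' j _ hj h1 he.symm

theorem smul_eq_smul_iff {a : G.Alcove} {x : ESpace r} (hx : x ∈ a.1) (v w : G.W) :
    v • a = w • a ↔ v.1 x = w.1 x := by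
  constructor
  · intro h
    rw [G.smul_left_injective a h]
  · intro h
    rw [G.eq_alcoveOf (G.smul_mem (w := v) hx), G.eq_alcoveOf (G.smul_mem (w := w) hx)]
    simp only [h]

/-- The degrees of the paths obtained from `ω` by reflections are given by the pattern of an alcove
series. -/
theorem IsAlcoveSeries.sum_paths {n : ℕ} {ω : Fin (n + 1) → ESpace r} {N : ℕ}
    {g : ℕ → G.Alcove} (hs : G.IsAlcoveSeries ω N g) (hω : G.IsTransversal ω) {ι : Type*}
    [Fintype ι] (v : G.W) {y : ESpace r} (hy : v.1 (ω (Fin.last n)) = y)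
    (e : ι ≃ {ω' : Fin (n + 1) → ESpace r // G.PathEquiv ω ω' ∧ ω' (Fin.last n) = y}) :
    ∑ i, (T (G.deg (e i).1) : ℤ[T;T⁻¹]) = chainPattern G g N (v • g N) := by
  classical
  have hend : ω (Fin.last n) ∈ (g N).1 := by
    rw [hω.eq_alcoveOf_end hs.finish]
    exact G.mem_alcoveOf _
  -- Without hyperplanes there is one alcove and `ω` is the only path. This case is separate because
  -- a wiring needs a total sequence of hyperplanes.
  rcases isEmpty_or_nonempty G.Hyp with hE | hE
  · have hN : N = 0 := by
      by_contra hN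
      obtain ⟨κ, -⟩ := (G.adj_iff _ _).1 (hs.adj 0 (by omega)).1
      exact hE.false κ
    have hpos : G.pos = ∅ := Finset.eq_empty_of_forall_notMem fun α hα =>
      hE.false ⟨(α, 0), hα, 0, fun _ => rfl, by simp⟩
    have hdeg : ∀ ω' : Fin (n + 1) → ESpace r, G.deg ω' = 0 := by
      intro ω'
      simp [deg, degUpTo, hpos]
    have heq : ∀ ω', G.PathEquiv ω ω' ↔ ω' = ω := by
      intro ω'
      refine ⟨fun h => ?_, fun h => h ▸ Relation.ReflTransGen.refl⟩
      induction h with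
      | refl => rfl
      | tail _ hstep ih =>
        obtain ⟨κ, hκ, -⟩ := hstep
        exact (hE.false ⟨κ, hκ⟩).elim
    have halc : v • g N = g N := by
      refine G.eq_of_asep_eq_empty (Set.eq_empty_of_forall_notMem fun κ => (hE.false κ).elim)
    have hv : v.1 (ω (Fin.last n)) = ω (Fin.last n) := by
      have := (smul_eq_smul_iff hend v 1).1 (by rw [halc, one_smul])
      exact this
    have hu : Unique ι := by
      refine ⟨⟨e.symm ⟨ω, (heq ω).2 rfl, by rw [← hy, hv]⟩⟩, fun i => ?_⟩
      apply e.injective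
      refine Eq.trans ?_ (e.apply_symm_apply _).symm
      exact Subtype.ext ((heq _).1 (e i).2.1)
    rw [Fintype.sum_unique, hdeg, halc, hN]
    simp [chainPattern, delta]
  · obtain ⟨h, J, w, hg, hh⟩ := hs.exists_wiring hω
    rw [chainPattern_eq_sum hg hh N le_rfl, ← Finset.sum_filter]
    symm
    have hlast : ∀ V, foldPath ω h J V (Fin.last n) = (foldW h V N).1 (ω (Fin.last n)) := by
      intro V
      rw [foldPath, w.last]
    -- Sets of folds that move the last alcove to `v • g N` correspond to paths ending in `y`, since
    -- a point of an alcove has trivial stabiliser.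
    refine Finset.sum_bij' (fun V hV => e.symm ⟨foldPath ω h J V, ?_, ?_⟩)
      (fun i _ => ((w.pathEquiv_iff _).1 (e i).2.1).choose) ?_ ?_ ?_ ?_ ?_
    · rw [Finset.mem_filter, Finset.mem_powerset] at hV
      exact (w.pathEquiv_iff _).2 ⟨V, hV.1, rfl⟩
    · rw [Finset.mem_filter, smul_eq_smul_iff hend] at hV
      rw [hlast, hV.2, hy]
    · simp
    · intro i _
      have h1 := ((w.pathEquiv_iff _).1 (e i).2.1).choose_spec
      rw [Finset.mem_filter, Finset.mem_powerset, smul_eq_smul_iff hend]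
      refine ⟨h1.1, ?_⟩
      rw [← hlast, ← h1.2, hy]
      exact (e i).2.2
    · intro V hV
      rw [Finset.mem_filter, Finset.mem_powerset] at hV
      have h1 := ((w.pathEquiv_iff (foldPath ω h J V)).1
        ((w.pathEquiv_iff _).2 ⟨V, hV.1, rfl⟩)).choose_spec
      simp only [Equiv.apply_symm_apply]
      exact (w.foldPath_injOn hV.1 h1.1 h1.2).symm
    · intro i _
      have h1 := ((w.pathEquiv_iff _).1 (e i).2.1).choose_spec
      rw [Equiv.symm_apply_eq]
      exact Subtype.ext h1.2.symm
    · intro V hV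
      simp only [Equiv.apply_symm_apply]
      rw [w.deg_foldPath]

end AlcoveGeometry

/-! ### Graded representation theory of the cellular algebra. -/

namespace GradedCellularHW

variable {A : Type*} [Ring A] [Algebra ℂ A] {𝒜 : ℤ → Submodule ℂ A} [GradedAlgebra 𝒜]
variable {P : Type*} [Fintype P] [PartialOrder P] (D : GradedCellularHW 𝒜 P)

/-! ### Weights and degrees of the cellular basis -/

open Classical in
theorem idem_mul_idem (μ ν : P) : D.idem μ * D.idem ν = if ν = μ then D.idem ν else 0 := by
  split_ifs with h
  · rw [h, idem_mul_self]
  · exact D.idem_mul_of_ne μ ν fun h' => h h'.symm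

open Classical in
theorem idem_mul_c (μ lam : P) (S U : D.Tabs lam) :
    D.idem μ * D.c ⟨lam, S, U⟩ = if S.1 = μ then D.c ⟨lam, S, U⟩ else 0 := by
  rw [← D.idem_c_idem lam S U, ← mul_assoc, ← mul_assoc, idem_mul_idem]
  split_ifs <;> simp

open Classical in
theorem c_mul_idem (μ lam : P) (S U : D.Tabs lam) :
    D.c ⟨lam, S, U⟩ * D.idem μ = if U.1 = μ then D.c ⟨lam, S, U⟩ else 0 := by
  rw [← D.idem_c_idem lam S U, mul_assoc, idem_mul_idem]
  by_cases h : U.1 = μ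
  · rw [if_pos h.symm, if_pos h, h]
  · rw [if_neg fun h' => h h'.symm, if_neg h, mul_zero]

theorem idem_ne_zero (μ : P) : D.idem μ ≠ 0 := by
  rw [← D.c_top]
  exact D.c.ne_zero _

/-- `1_μ` is a nonzero homogeneous idempotent, so its degree equals twice itself and is zero. -/
theorem deg_top (μ : P) : D.deg (D.top μ) = 0 := by
  have h1 := D.c_mem μ ⟨μ, D.top μ⟩ ⟨μ, D.top μ⟩
  rw [D.c_top] at h1
  have h2 := SetLike.mul_mem_graded h1 h1
  rw [idem_mul_self] at h2
  have := DirectSum.degree_eq_of_mem_mem 𝒜 h1 h2 (D.idem_ne_zero μ)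
  simp only at this
  omega

theorem idem_mem (μ : P) : D.idem μ ∈ 𝒜 0 := by
  have h1 := D.c_mem μ ⟨μ, D.top μ⟩ ⟨μ, D.top μ⟩
  rw [D.c_top] at h1
  simpa [deg_top] using h1

/-- The cellular basis is homogeneous, so the projection to degree `k` fixes or kills each basis
element. -/
theorem repr_eq_zero_of_degree_ne {x : A} {k : ℤ} (hx : x ∈ 𝒜 k) (lam : P) (U V : D.Tabs lam)
    (hk : D.deg U.2 + D.deg V.2 ≠ k) : D.c.repr x ⟨lam, U, V⟩ = 0 := by
  classical
  have h1 : GradedAlgebra.proj 𝒜 k x = x := by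
    rw [GradedAlgebra.proj_apply]
    exact DirectSum.decompose_of_mem_same 𝒜 hx
  have h2 : x = ∑ i, D.c.repr x i • GradedAlgebra.proj 𝒜 k (D.c i) := by
    conv_lhs => rw [← h1, ← D.c.sum_repr x, map_sum]
    simp only [map_smul]
  have h3 : ∀ i, GradedAlgebra.proj 𝒜 k (D.c i) =
      (if D.deg i.2.1.2 + D.deg i.2.2.2 = k then (1 : ℂ) else 0) • D.c i := by
    rintro ⟨ν, S, W⟩
    have h4 := D.c_mem ν S W
    rw [GradedAlgebra.proj_apply]
    split_ifs with h5
    · rw [one_smul]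
      simp only at h5
      rw [← h5]
      exact DirectSum.decompose_of_mem_same 𝒜 h4
    · rw [zero_smul]
      exact DirectSum.decompose_of_mem_ne 𝒜 h4 h5
  simp only [h3, smul_smul] at h2
  rw [h2, D.c.repr_sum_self]
  simp [hk]

theorem r_eq_zero_of_degree_ne {a : A} {z : ℤ} (ha : a ∈ 𝒜 z) (lam : P) (S U : D.Tabs lam)
    (h : D.deg U.2 ≠ z + D.deg S.2) : D.r lam S U a = 0 := by
  refine D.repr_eq_zero_of_degree_ne (SetLike.mul_mem_graded ha (D.c_mem lam S (D.topTab lam)))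
    lam U (D.topTab lam) ?_
  simp only [topTab, deg_top]
  omega

open Classical in
theorem r_idem (lam μ : P) (S U : D.Tabs lam) :
    D.r lam S U (D.idem μ) = if S = U ∧ U.1 = μ then 1 else 0 := by
  rw [r, idem_mul_c]
  by_cases h : S.1 = μ
  · rw [if_pos h, Module.Basis.repr_self]
    by_cases h' : S = U
    · subst h'
      simp [h]
    · rw [if_neg fun hc => h' hc.1, Finsupp.single_eq_of_ne]
      intro h''
      apply h'
      simpa using h''.symm
  · rw [if_neg h, if_neg]
    · simp
    · rintro ⟨rfl, h'⟩
      exact h h'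

open Classical in
theorem idem_smul_apply (lam μ : P) (x : D.Std lam) (U : D.Tabs lam) :
    (D.idem μ • x) U = if U.1 = μ then x U else 0 := by
  rw [smul_apply]
  simp only [r_idem, mul_ite, mul_one, mul_zero]
  by_cases h : U.1 = μ
  · rw [if_pos h, Finset.sum_eq_single U]
    · rw [if_pos ⟨rfl, h⟩]
    · exact fun S _ hS => if_neg fun h' => hS h'.1
    · simp
  · simp [h]

theorem gram_eq_zero_of_degree_ne (lam : P) (S U : D.Tabs lam) (h : D.deg S.2 + D.deg U.2 ≠ 0) :
    D.gram lam S U = 0 := by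
  refine D.repr_eq_zero_of_degree_ne (SetLike.mul_mem_graded (D.c_mem lam (D.topTab lam) S)
    (D.c_mem lam U (D.topTab lam))) lam _ _ ?_
  simp only [topTab, deg_top]
  omega

theorem repr_star (x : A) (lam : P) (U V : D.Tabs lam) :
    D.c.repr (D.star x) ⟨lam, U, V⟩ = D.c.repr x ⟨lam, V, U⟩ := by
  classical
  have : (D.c.coord ⟨lam, U, V⟩) ∘ₗ D.star = D.c.coord ⟨lam, V, U⟩ := by
    refine D.c.ext fun ⟨ν, S, W⟩ => ?_
    simp only [LinearMap.comp_apply, star_c, Module.Basis.coord_apply, Module.Basis.repr_self,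
      Finsupp.single_apply]
    refine if_congr ?_ rfl rfl
    constructor <;> intro h <;> cases h <;> rfl
  exact LinearMap.congr_fun this x

theorem gram_comm (lam : P) (S U : D.Tabs lam) : D.gram lam S U = D.gram lam U S := by
  rw [gram, ← repr_star, star_mul, star_c, star_c, gram]

theorem form_comm (lam : P) (x y : D.Std lam) : D.form lam x y = D.form lam y x := by
  rw [form, Finset.sum_comm, form]
  refine Finset.sum_congr rfl fun S _ => Finset.sum_congr rfl fun U _ => ?_
  rw [D.gram_comm lam S U]
  ring

theorem c_topTab (lam : P) : D.c ⟨lam, D.topTab lam, D.topTab lam⟩ = D.idem lam := D.c_top lam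

theorem gram_top (lam : P) : D.gram lam (D.topTab lam) (D.topTab lam) = 1 := by
  rw [gram, c_topTab, idem_mul_self, ← c_topTab, Module.Basis.repr_self]
  simp

theorem r_topTab (lam : P) (Q V : D.Tabs lam) :
    D.r lam (D.topTab lam) V (D.c ⟨lam, Q, D.topTab lam⟩) = if Q = V then 1 else 0 := by
  rw [r, c_topTab, c_mul_idem, if_pos (by rfl), Module.Basis.repr_self]
  by_cases h : Q = V
  · simp [h]
  · rw [if_neg h]
    refine Finsupp.single_eq_of_ne fun h' => h ?_
    simpa using h'.symm

/-- `c_{Q R} ≡ c_{Q T} c_{T R}` modulo `A^{▷ lam}` for `T = T^lam`. -/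
theorem c_mul_c_sub (lam : P) (Q R : D.Tabs lam) :
    D.c ⟨lam, Q, D.topTab lam⟩ * D.c ⟨lam, D.topTab lam, R⟩ - D.c ⟨lam, Q, R⟩ ∈ D.above lam := by
  have h := D.action lam (D.topTab lam) (D.c ⟨lam, Q, D.topTab lam⟩) R
  simpa [D.r_topTab lam Q] using h

theorem eq_topTab {lam : P} {U : D.Tabs lam} (h : U.1 = lam) : U = D.topTab lam := by
  obtain ⟨μ, U⟩ := U
  obtain rfl : μ = lam := h
  rw [D.eq_top μ U, topTab]

/-- `c_{T V} = 1_λ c_{T V}` maps into the weight space of weight `λ`, which is spanned by `c_T`, `T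
= T^λ`. -/
theorem r_c_top (lam : P) (S U V : D.Tabs lam) :
    D.r lam S U (D.c ⟨lam, D.topTab lam, V⟩) = if U = D.topTab lam then D.gram lam V S else 0 := by
  split_ifs with h
  · rw [r, h, gram]
  · have h1 : D.c ⟨lam, D.topTab lam, V⟩ = D.idem lam * D.c ⟨lam, D.topTab lam, V⟩ := by
      rw [idem_mul_c, if_pos (by rfl)]
    rw [h1, r_mul]
    refine Finset.sum_eq_zero fun W _ => ?_
    rw [r_idem, if_neg, mul_zero]
    rintro ⟨-, h2⟩
    exact h (D.eq_topTab h2)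

/-- The basis vector `c_S` of the standard module. -/
noncomputable def vec (lam : P) (S : D.Tabs lam) : D.Std lam := fun U => if U = S then 1 else 0

theorem vec_apply (lam : P) (S U : D.Tabs lam) : D.vec lam S U = if U = S then 1 else 0 := rfl

theorem form_vec_left (lam : P) (S : D.Tabs lam) (x : D.Std lam) :
    D.form lam (D.vec lam S) x = ∑ U, x U * D.gram lam S U := by
  rw [form, Finset.sum_eq_single S]
  · simp [vec_apply]
  · intro V _ hV
    simp [vec_apply, hV]
  · simp

theorem form_eq_sum (lam : P) (x y : D.Std lam) :
    D.form lam x y = ∑ S, x S * D.form lam (D.vec lam S) y := by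
  simp only [form_vec_left]
  simp only [form, Finset.mul_sum, mul_assoc]

/-- The form is realised by operators of the algebra: a vector outside the radical is carried by one
of them to a nonzero multiple of the generator. -/
theorem c_top_smul (lam : P) (V : D.Tabs lam) (x : D.Std lam) :
    D.c ⟨lam, D.topTab lam, V⟩ • x = D.form lam (D.vec lam V) x • D.vec lam (D.topTab lam) := by
  funext U
  rw [smul_apply, csmul_apply, vec_apply, form_vec_left]
  simp only [r_c_top]
  by_cases h : U = D.topTab lam <;> simp [h]

theorem mem_rad {lam : P} {x : D.Std lam} : x ∈ D.rad lam ↔ ∀ y, D.form lam x y = 0 := Iff.rfl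

theorem mem_rad_iff {lam : P} {x : D.Std lam} :
    x ∈ D.rad lam ↔ ∀ S, D.form lam (D.vec lam S) x = 0 := by
  rw [mem_rad]
  constructor
  · intro h S
    rw [form_comm, h]
  · intro h y
    rw [form_comm, form_eq_sum]
    simp [h]

theorem idem_smul_eq_vec (lam : P) (x : D.Std lam) :
    D.idem lam • x = x (D.topTab lam) • D.vec lam (D.topTab lam) := by
  funext U
  rw [idem_smul_apply, csmul_apply, vec_apply]
  by_cases h : U.1 = lam
  · rw [if_pos h, D.eq_topTab h]
    simp
  · rw [if_neg h, if_neg, mul_zero]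
    rintro rfl
    exact h rfl

/-- The weight space of weight `lam` meets the radical trivially. -/
theorem idem_smul_eq_zero_of_mem_rad {lam : P} {x : D.Std lam} (hx : x ∈ D.rad lam) :
    D.idem lam • x = 0 := by
  have h1 : D.idem lam • x ∈ D.rad lam := (D.rad lam).smul_mem _ hx
  rw [idem_smul_eq_vec] at h1 ⊢
  have h2 := D.mem_rad_iff.1 h1 (D.topTab lam)
  rw [form_vec_left, Finset.sum_eq_single (D.topTab lam)] at h2
  · simp only [csmul_apply, vec_apply, gram_top, if_true, mul_one] at h2
    rw [h2, zero_smul]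
  · intro U _ hU
    simp [csmul_apply, vec_apply, hU]
  · simp

/-! ### Homogeneous components of standard modules -/

/-- The projection of `Δ(lam)` on its component of degree `z`. -/
noncomputable def proj (lam : P) (z : ℤ) : D.Std lam →ₗ[ℂ] D.Std lam where
  toFun x U := if D.deg U.2 = z then x U else 0
  map_add' x y := by
    funext U
    change (if _ then x U + y U else 0) = (if _ then x U else 0) + (if _ then y U else 0)
    split_ifs
    · rfl
    · exact (add_zero 0).symm
  map_smul' w x := by
    funext U
    change (if _ then w * x U else 0) = w * (if _ then x U else 0)
    split_ifs
    · rfl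
    · exact (mul_zero w).symm

theorem proj_apply (lam : P) (z : ℤ) (x : D.Std lam) (U : D.Tabs lam) :
    D.proj lam z x U = if D.deg U.2 = z then x U else 0 := rfl

theorem proj_mem (lam : P) (z : ℤ) (x : D.Std lam) : D.proj lam z x ∈ D.stdGrading lam z := by
  intro S hS
  rw [proj_apply, if_neg hS]

theorem mem_stdGrading_iff {lam : P} {z : ℤ} {x : D.Std lam} :
    x ∈ D.stdGrading lam z ↔ D.proj lam z x = x := by
  constructor
  · intro h
    funext U
    rw [proj_apply]
    split_ifs with h1
    · rfl
    · exact (h U h1).symm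
  · intro h
    rw [← h]
    exact D.proj_mem lam z x

theorem proj_proj (lam : P) (z z' : ℤ) (x : D.Std lam) :
    D.proj lam z (D.proj lam z' x) = if z' = z then D.proj lam z x else 0 := by
  funext U
  split_ifs with h
  · simp only [proj_apply, h]
    split_ifs <;> rfl
  · simp only [proj_apply, zero_apply]
    split_ifs with h1 h2
    · exact absurd (h2.symm.trans h1) h
    · rfl
    · rfl

/-- The degrees occurring in `Δ(lam)`. -/
noncomputable def degrees (lam : P) : Finset ℤ := Finset.univ.image fun S : D.Tabs lam => D.deg S.2

theorem sum_proj (lam : P) (x : D.Std lam) : ∑ z ∈ D.degrees lam, D.proj lam z x = x := by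
  funext U
  have h : ∀ (s : Finset ℤ) (f : ℤ → D.Std lam), (∑ z ∈ s, f z) U = ∑ z ∈ s, f z U := by
    intro s f
    exact Finset.sum_apply U s f
  rw [h, Finset.sum_eq_single (D.deg U.2)]
  · rw [proj_apply, if_pos rfl]
  · intro z _ hz
    rw [proj_apply, if_neg hz.symm]
  · intro h1
    exact absurd (Finset.mem_image_of_mem _ (Finset.mem_univ U)) h1

theorem smul_proj {a : A} {z : ℤ} (ha : a ∈ 𝒜 z) (lam : P) (k : ℤ) (x : D.Std lam) :
    a • D.proj lam k x = D.proj lam (z + k) (a • x) := by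
  funext U
  rw [smul_apply, proj_apply, smul_apply]
  split_ifs with h
  · refine Finset.sum_congr rfl fun S _ => ?_
    rw [proj_apply]
    split_ifs with h1
    · rfl
    · rw [D.r_eq_zero_of_degree_ne ha lam S U (by omega)]
      simp
  · refine Finset.sum_eq_zero fun S _ => ?_
    rw [proj_apply]
    split_ifs with h1
    · rw [D.r_eq_zero_of_degree_ne ha lam S U (by omega)]
      simp
    · simp

theorem isGradedSubmodule_iff {lam : P} (N : Submodule A (D.Std lam)) :
    IsGradedSubmodule (D.stdGrading lam) N ↔ ∀ x ∈ N, ∀ z, D.proj lam z x ∈ N := by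
  rw [IsGradedSubmodule]
  constructor
  · intro h x hx z
    have hx' : x ∈ ⨆ z, N.restrictScalars ℂ ⊓ D.stdGrading lam z := by
      rw [← h]
      exact hx
    clear hx
    induction hx' using Submodule.iSup_induction' with
    | mem k y hy =>
      have h1 := D.mem_stdGrading_iff.1 hy.2
      rw [← h1, proj_proj]
      split_ifs with h2
      · rw [← h2, h1]
        exact hy.1
      · exact N.zero_mem
    | zero => rw [map_zero]; exact N.zero_mem
    | add x y _ _ hx hy => rw [map_add]; exact N.add_mem hx hy
  · intro h
    apply le_antisymm
    · intro x hx
      rw [← D.sum_proj lam x]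
      exact Submodule.sum_mem _ fun z _ =>
        Submodule.mem_iSup_of_mem z ⟨h x hx z, D.proj_mem lam z x⟩
    · exact iSup_le fun z => inf_le_left

/-- The form has degree zero, so it pairs degree `z` with degree `-z`; this makes the radical
graded. -/
theorem form_proj (lam : P) (z : ℤ) (x y : D.Std lam) :
    D.form lam (D.proj lam z x) y = D.form lam x (D.proj lam (-z) y) := by
  refine Finset.sum_congr rfl fun S _ => Finset.sum_congr rfl fun U _ => ?_
  rw [proj_apply, proj_apply]
  by_cases h : D.deg S.2 + D.deg U.2 = 0
  · by_cases h1 : D.deg S.2 = z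
    · rw [if_pos h1, if_pos (by omega)]
    · rw [if_neg h1, if_neg (by omega)]
      simp
  · rw [D.gram_eq_zero_of_degree_ne lam S U h]
    simp

theorem proj_mem_rad {lam : P} {x : D.Std lam} (hx : x ∈ D.rad lam) (z : ℤ) :
    D.proj lam z x ∈ D.rad lam := by
  intro y
  rw [form_proj]
  exact hx _

end GradedCellularHW

namespace GradedCellularHW

variable {A : Type*} [Ring A] [Algebra ℂ A] {𝒜 : ℤ → Submodule ℂ A} [GradedAlgebra 𝒜]
variable {P : Type*} [Fintype P] [PartialOrder P] {D : GradedCellularHW 𝒜 P}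

/-! ### Graded composition factors of standard modules -/

instance (lam : P) : FiniteDimensional ℂ (D.Std lam) :=
  inferInstanceAs (FiniteDimensional ℂ (D.Tabs lam → ℂ))

/-- A map from a standard module which is linear modulo `N₁`, with kernel the radical, identifies
`N₂ / N₁` with a simple module. -/
theorem isShiftedFactor_of_map {lam ν : P} {k : ℤ} {N₁ N₂ : Submodule A (D.Std lam)}
    (h₁ : IsGradedSubmodule (D.stdGrading lam) N₁)
    (θ : D.Std ν →ₗ[ℂ] D.Std lam) (hmem : ∀ x, θ x ∈ N₂)
    (hsmul : ∀ (a : A) x, θ (a • x) - a • θ x ∈ N₁) (hker : ∀ x, θ x ∈ N₁ ↔ x ∈ D.rad ν)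
    (hsurj : ∀ m ∈ N₂, ∃ x, m - θ x ∈ N₁)
    (hproj : ∀ j x, D.proj lam (j + k) (θ x) = θ (D.proj ν j x)) :
    IsShiftedFactor (D.stdGrading lam) (D.simpleGrading ν) N₁ N₂ k := by
  have hmk : ∀ x y : ↥N₂, (Submodule.Quotient.mk x : ↥N₂ ⧸ N₁.submoduleOf N₂) =
      Submodule.Quotient.mk y ↔ (x : D.Std lam) - y ∈ N₁ := by
    intro x y
    rw [Submodule.Quotient.eq]
    rfl
  let Θ : D.Std ν →ₗ[A] (↥N₂ ⧸ N₁.submoduleOf N₂) :=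
    { toFun := fun x => Submodule.Quotient.mk ⟨θ x, hmem x⟩
      map_add' := fun x y => by
        rw [← Submodule.Quotient.mk_add, hmk]
        change θ (x + y) - (θ x + θ y) ∈ N₁
        rw [map_add, sub_self]
        exact N₁.zero_mem
      map_smul' := fun a x => by
        rw [RingHom.id_apply, ← Submodule.Quotient.mk_smul, hmk]
        exact hsmul a x }
  have hΘ : ∀ x, Θ x = Submodule.Quotient.mk ⟨θ x, hmem x⟩ := fun _ => rfl
  have hkerΘ : LinearMap.ker Θ = D.rad ν := by
    ext x
    rw [LinearMap.mem_ker, hΘ, ← hker, ← Submodule.Quotient.mk_zero, hmk]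
    change θ x - 0 ∈ N₁ ↔ _
    rw [sub_zero]
  have hsurjΘ : Function.Surjective Θ := by
    intro q
    obtain ⟨m, rfl⟩ := Submodule.Quotient.mk_surjective _ q
    obtain ⟨x, hx⟩ := hsurj m.1 m.2
    refine ⟨x, ?_⟩
    rw [hΘ, eq_comm, hmk]
    exact hx
  let e : (D.Std ν ⧸ D.rad ν) ≃ₗ[A] (↥N₂ ⧸ N₁.submoduleOf N₂) :=
    (Submodule.quotEquivOfEq _ _ hkerΘ.symm).trans (Θ.quotKerEquivOfSurjective hsurjΘ)
  have he : ∀ x, e (Submodule.Quotient.mk x) = Θ x := fun x => rfl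
  refine ⟨e.symm, fun z x hx => ?_⟩
  obtain ⟨y, hy⟩ := hsurj x.1 x.2
  have h2 : Submodule.Quotient.mk x = e (Submodule.Quotient.mk (D.proj ν (z - k) y)) := by
    rw [he, hΘ, hmk]
    change (x : D.Std lam) - θ (D.proj ν (z - k) y) ∈ N₁
    rw [← hproj, sub_add_cancel, ← D.mem_stdGrading_iff.1 hx, ← map_sub]
    exact (D.isGradedSubmodule_iff N₁).1 h₁ _ hy z
  rw [h2, LinearEquiv.symm_apply_apply]
  exact ⟨_, D.proj_mem ν (z - k) y, rfl⟩

variable (D) in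
/-- The map `c_S ↦ c_{S T} v`, `T = T^ν`. -/
noncomputable def orbitMap (ν : P) {lam : P} (v : D.Std lam) : D.Std ν →ₗ[ℂ] D.Std lam where
  toFun x := ∑ S, x S • D.c ⟨ν, S, D.topTab ν⟩ • v
  map_add' x y := by
    rw [← Finset.sum_add_distrib]
    exact Finset.sum_congr rfl fun S _ => add_smul _ _ _
  map_smul' w x := by
    rw [Finset.smul_sum]
    exact Finset.sum_congr rfl fun S _ => mul_smul _ _ _

theorem orbitMap_apply (ν : P) {lam : P} (v : D.Std lam) (x : D.Std ν) :
    D.orbitMap ν v x = ∑ S, x S • D.c ⟨ν, S, D.topTab ν⟩ • v := rfl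

theorem orbitMap_top (ν : P) {lam : P} {v : D.Std lam} (hv : D.idem ν • v = v) :
    D.orbitMap ν v (D.vec ν (D.topTab ν)) = v := by
  rw [orbitMap_apply, Finset.sum_eq_single (D.topTab ν)]
  · rw [vec_apply, if_pos rfl, one_smul, c_topTab, hv]
  · intro S _ hS
    rw [vec_apply, if_neg hS, zero_smul]
  · simp

theorem orbitMap_mem {ν lam : P} {v : D.Std lam} {N : Submodule A (D.Std lam)} (hv : v ∈ N)
    (x : D.Std ν) : D.orbitMap ν v x ∈ N :=
  N.sum_mem fun S _ => N.smul_of_tower_mem (x S) (N.smul_mem _ hv)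

theorem proj_orbitMap {ν lam : P} {v : D.Std lam} {k : ℤ} (hv : D.proj lam k v = v) (j : ℤ)
    (x : D.Std ν) : D.proj lam (j + k) (D.orbitMap ν v x) = D.orbitMap ν v (D.proj ν j x) := by
  rw [orbitMap_apply, map_sum, orbitMap_apply]
  refine Finset.sum_congr rfl fun S _ => ?_
  have h1 : D.c ⟨ν, S, D.topTab ν⟩ ∈ 𝒜 (D.deg S.2) := by
    have := D.c_mem ν S (D.topTab ν)
    simpa [topTab, deg_top] using this
  have h2 := D.smul_proj h1 lam k v
  rw [hv] at h2
  rw [map_smul, h2, proj_proj, proj_apply]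
  by_cases h : D.deg S.2 = j
  · rw [if_pos (by omega), if_pos h, h]
  · rw [if_neg (by omega), if_neg h, smul_zero, zero_smul]

/-- The cellular multiplication rule has an error in `A^{▷ ν}`, so linearity fails only by what
`A^{▷ ν}` does to `v`. -/
theorem orbitMap_smul_sub {ν lam : P} {v : D.Std lam} {N : Submodule A (D.Std lam)}
    (hN : ∀ a ∈ D.above ν, a • v ∈ N) (a : A) (x : D.Std ν) :
    D.orbitMap ν v (a • x) - a • D.orbitMap ν v x ∈ N := by
  have h1 : D.orbitMap ν v (a • x) =
      ∑ S, x S • (∑ U, D.r ν S U a • D.c ⟨ν, U, D.topTab ν⟩) • v := by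
    simp only [orbitMap_apply, smul_apply, Finset.sum_smul, Finset.smul_sum]
    rw [Finset.sum_comm]
    refine Finset.sum_congr rfl fun S _ => Finset.sum_congr rfl fun U _ => ?_
    rw [mul_smul, smul_assoc]
  have h2 : a • D.orbitMap ν v x = ∑ S, x S • (a * D.c ⟨ν, S, D.topTab ν⟩) • v := by
    rw [orbitMap_apply, Finset.smul_sum]
    refine Finset.sum_congr rfl fun S _ => ?_
    rw [mul_smul]
    exact smul_algebra_smul_comm (x S) a _
  rw [← N.neg_mem_iff, neg_sub, h1, h2, ← Finset.sum_sub_distrib]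
  refine N.sum_mem fun S _ => ?_
  rw [← smul_sub, ← sub_smul]
  exact N.smul_of_tower_mem _ (hN _ (D.action ν S a (D.topTab ν)))

theorem sum_idem_smul {lam : P} (x : D.Std lam) : ∑ μ, D.idem μ • x = x := by
  rw [← Finset.sum_smul, D.sum_idem, one_smul]

theorem idem_smul_proj (μ lam : P) (z : ℤ) (x : D.Std lam) :
    D.idem μ • D.proj lam z x = D.proj lam z (D.idem μ • x) := by
  rw [D.smul_proj (D.idem_mem μ), zero_add]

/-- The elements of `A^{▷ ν}` annihilate a module without weights above `ν`. -/
theorem above_smul_mem {ν lam : P} {N₁ N₂ : Submodule A (D.Std lam)}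
    (h : ∀ κ, ν < κ → ∀ x ∈ N₂, D.idem κ • x ∈ N₁) {a : A} (ha : a ∈ D.above ν) {y : D.Std lam}
    (hy : y ∈ N₂) : a • y ∈ N₁ := by
  have hspan : ∀ κ, (∀ κ', κ < κ' → ∀ (Q R : D.Tabs κ') (y), y ∈ N₂ → D.c ⟨κ', Q, R⟩ • y ∈ N₁) →
      ∀ a ∈ D.above κ, ∀ y ∈ N₂, a • y ∈ N₁ := by
    intro κ hκ a ha y hy
    induction ha using Submodule.span_induction with
    | mem a h =>
      obtain ⟨κ', h1, Q, R, rfl⟩ := h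
      exact hκ κ' h1 Q R y hy
    | zero => rw [zero_smul]; exact N₁.zero_mem
    | add a b _ _ ha hb => rw [add_smul]; exact N₁.add_mem ha hb
    | smul z a _ ha => rw [smul_assoc]; exact N₁.smul_of_tower_mem z ha
  have key : ∀ κ, ν < κ → ∀ (Q R : D.Tabs κ) (y), y ∈ N₂ → D.c ⟨κ, Q, R⟩ • y ∈ N₁ := by
    intro κ
    induction κ using WellFoundedGT.induction with
    | _ κ ih =>
      intro hκ Q R y hy
      -- `c_{Q R}` is `c_{Q T} c_{T R}` up to terms labelled by larger weights, handled by
      -- induction. The vector `c_{T R} y` has weight `κ`, so it lies in `N₁`.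
      have h1 := hspan κ (fun κ' h1 => ih κ' h1 (hκ.trans h1)) _ (D.c_mul_c_sub κ Q R) y hy
      have h2 : D.c ⟨κ, D.topTab κ, R⟩ • y ∈ N₁ := by
        have h3 : D.c ⟨κ, D.topTab κ, R⟩ = D.idem κ * D.c ⟨κ, D.topTab κ, R⟩ := by
          rw [idem_mul_c, if_pos (by rfl)]
        rw [h3, mul_smul]
        exact h κ hκ _ (N₂.smul_mem _ hy)
      rw [sub_smul, mul_smul] at h1
      have h4 := N₁.sub_mem (N₁.smul_mem (D.c ⟨κ, Q, D.topTab κ⟩) h2) h1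
      rwa [sub_sub_cancel] at h4
  exact hspan ν key a ha y hy

/-- Highest weight argument. A homogeneous vector `v` of maximal weight `ν` in the factor is
annihilated by `A^{▷ ν}` modulo `N₁`, so `c_S ↦ c_{S T} v` is a module map from `Δ(ν)` to the
factor, and its kernel is the radical. -/
theorem exists_isShiftedFactor {lam : P} {N₁ N₂ : GradedSubmodule A (D.stdGrading lam)}
    (h : N₁ ⋖ N₂) :
    ∃ ν k, IsShiftedFactor (D.stdGrading lam) (D.simpleGrading ν) N₁.1 N₂.1 k := by
  have hg₁ := (D.isGradedSubmodule_iff N₁.1).1 N₁.2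
  have hg₂ := (D.isGradedSubmodule_iff N₂.1).1 N₂.2
  have hle : N₁.1 ≤ N₂.1 := h.le
  -- a maximal weight of the factor
  have hne : {ν : P | ∃ x ∈ N₂.1, D.idem ν • x ∉ N₁.1}.Nonempty := by
    by_contra hc
    have hc' : ∀ ν : P, ∀ x ∈ N₂.1, D.idem ν • x ∈ N₁.1 := by
      intro ν x hx
      by_contra h1
      exact hc ⟨ν, x, hx, h1⟩
    refine h.lt.not_ge fun x hx => ?_
    rw [← sum_idem_smul x]
    exact N₁.1.sum_mem fun ν _ => hc' ν x hx
  obtain ⟨ν, hν⟩ := (Set.toFinite _).exists_maximal hne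
  obtain ⟨⟨x, hx, hx'⟩, hmax⟩ := hν
  have hmax' : ∀ κ, ν < κ → ∀ x ∈ N₂.1, D.idem κ • x ∈ N₁.1 := by
    intro κ hκ x hx
    by_contra h1
    exact hκ.not_ge (hmax ⟨x, hx, h1⟩ hκ.le)
  -- a homogeneous vector of this weight
  obtain ⟨k, hk⟩ : ∃ k, D.proj lam k (D.idem ν • x) ∉ N₁.1 := by
    by_contra hc
    push Not at hc
    apply hx'
    rw [← D.sum_proj lam (D.idem ν • x)]
    exact N₁.1.sum_mem fun z _ => hc z
  set v := D.proj lam k (D.idem ν • x) with hv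
  have hv2 : v ∈ N₂.1 := hg₂ _ (N₂.1.smul_mem _ hx) k
  have hvi : D.idem ν • v = v := by
    rw [hv, idem_smul_proj, ← mul_smul, idem_mul_self]
  have hvp : D.proj lam k v = v := by rw [hv, proj_proj, if_pos rfl]
  have hsmul := D.orbitMap_smul_sub (N := N₁.1) fun a ha => above_smul_mem hmax' ha hv2
  have hmem : ∀ x, D.orbitMap ν v x ∈ N₂.1 := orbitMap_mem hv2
  have hproj := proj_orbitMap (ν := ν) hvp
  -- The factor is simple only among graded submodules. Thus the image of a graded `K` is zero or
  -- everything; this is used for `Δ(ν)` itself and for the radical.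
  have hK : ∀ K : Submodule A (D.Std ν), (∀ x ∈ K, ∀ z, D.proj ν z x ∈ K) →
      (∀ x ∈ K, D.orbitMap ν v x ∈ N₁.1) ∨ ∀ m ∈ N₂.1, ∃ x ∈ K, m - D.orbitMap ν v x ∈ N₁.1 := by
    intro K hK
    let NK : Submodule A (D.Std lam) :=
      { carrier := {m | ∃ x ∈ K, m - D.orbitMap ν v x ∈ N₁.1}
        add_mem' := by
          rintro m m' ⟨x, hx, h1⟩ ⟨x', hx', h1'⟩
          refine ⟨x + x', K.add_mem hx hx', ?_⟩
          rw [map_add, add_sub_add_comm]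
          exact N₁.1.add_mem h1 h1'
        zero_mem' := ⟨0, K.zero_mem, by simp⟩
        smul_mem' := by
          rintro a m ⟨x, hx, h1⟩
          refine ⟨a • x, K.smul_mem a hx, ?_⟩
          have h2 := N₁.1.sub_mem (N₁.1.smul_mem a h1) (hsmul a x)
          rw [smul_sub] at h2
          convert h2 using 1
          abel }
    have hNK : ∀ m, m ∈ NK ↔ ∃ x ∈ K, m - D.orbitMap ν v x ∈ N₁.1 := fun _ => Iff.rfl
    have hgr : IsGradedSubmodule (D.stdGrading lam) NK := by
      rw [isGradedSubmodule_iff]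
      rintro m ⟨x, hx, h1⟩ z
      refine ⟨D.proj ν (z - k) x, hK x hx _, ?_⟩
      rw [← hproj, sub_add_cancel, ← map_sub]
      exact hg₁ _ h1 z
    have hle1 : N₁ ≤ ⟨NK, hgr⟩ := by
      intro m hm
      exact ⟨0, K.zero_mem, by rwa [map_zero, sub_zero]⟩
    have hle2 : ⟨NK, hgr⟩ ≤ N₂ := by
      rintro m ⟨x, hx, h1⟩
      have := N₂.1.add_mem (hle h1) (hmem x)
      rwa [sub_add_cancel] at this
    rcases h.eq_or_eq hle1 hle2 with h1 | h1
    · left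
      intro x hx
      have h2 : D.orbitMap ν v x ∈ NK := ⟨x, hx, by rw [sub_self]; exact N₁.1.zero_mem⟩
      rw [← h1]
      exact h2
    · right
      intro m hm
      rw [← h1] at hm
      exact hm
  have hsurj : ∀ m ∈ N₂.1, ∃ x, m - D.orbitMap ν v x ∈ N₁.1 := by
    rcases hK ⊤ fun _ _ _ => trivial with h1 | h1
    · have h2 := h1 (D.vec ν (D.topTab ν)) trivial
      rw [orbitMap_top ν hvi] at h2
      exact absurd h2 hk
    · intro m hm
      obtain ⟨x, -, hx⟩ := h1 m hm
      exact ⟨x, hx⟩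
  -- The image of the radical cannot be everything, since `v` has weight `ν` and the radical has no
  -- vector of that weight.
  have hrad : ∀ x ∈ D.rad ν, D.orbitMap ν v x ∈ N₁.1 := by
    rcases hK (D.rad ν) fun _ hx z => D.proj_mem_rad hx z with h1 | h1
    · exact h1
    · obtain ⟨x, hx, h2⟩ := h1 v hv2
      exfalso
      apply hk
      have h3 := N₁.1.sub_mem (N₁.1.smul_mem (D.idem ν) h2) (hsmul (D.idem ν) x)
      rw [D.idem_smul_eq_zero_of_mem_rad hx, map_zero, smul_sub, hvi] at h3
      convert h3 using 1
      abel
  refine ⟨ν, k, isShiftedFactor_of_map N₁.2 (D.orbitMap ν v) hmem hsmul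
    (fun x => ⟨fun hx => ?_, hrad x⟩) hsurj hproj⟩
  rw [mem_rad_iff]
  intro S
  by_contra hS
  apply hk
  -- If `x` pairs nontrivially with `c_S`, then `c_{T S}` carries `x` to a nonzero multiple of the
  -- generator, and `v` itself would lie in `N₁`.
  have h1 := N₁.1.add_mem (hsmul (D.c ⟨ν, D.topTab ν, S⟩) x) (N₁.1.smul_mem (D.c ⟨ν, D.topTab ν, S⟩) hx)
  rw [sub_add_cancel, c_top_smul, map_smul, orbitMap_top ν hvi] at h1
  have h2 := N₁.1.smul_of_tower_mem (D.form ν (D.vec ν S) x)⁻¹ h1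
  rwa [smul_smul, inv_mul_cancel₀ hS, one_smul] at h2

/-! ### Existence of graded composition series -/

instance (lam : P) : IsNoetherian A (D.Std lam) := isNoetherian_of_tower ℂ inferInstance

instance (lam : P) : IsArtinian A (D.Std lam) := isArtinian_of_tower ℂ inferInstance

theorem exists_isGradedCompositionSeries (lam : P) :
    ∃ s : GradedChain A (D.stdGrading lam), IsGradedCompositionSeries (D.stdGrading lam) s := by
  have hmono : StrictMono (Subtype.val : GradedSubmodule A (D.stdGrading lam) → _) := fun _ _ h => h
  have hGT : WellFoundedGT (GradedSubmodule A (D.stdGrading lam)) := hmono.wellFoundedGT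
  have hLT : WellFoundedLT (GradedSubmodule A (D.stdGrading lam)) := hmono.wellFoundedLT
  have hbot : IsGradedSubmodule (D.stdGrading lam) (⊥ : Submodule A (D.Std lam)) := by
    rw [isGradedSubmodule_iff]
    intro x hx z
    rw [(Submodule.mem_bot A).1 hx, map_zero]
    exact Submodule.zero_mem _
  have htop : IsGradedSubmodule (D.stdGrading lam) (⊤ : Submodule A (D.Std lam)) := by
    rw [isGradedSubmodule_iff]
    exact fun _ _ _ => trivial
  have key : ∀ N : GradedSubmodule A (D.stdGrading lam), ∃ s : GradedChain A (D.stdGrading lam),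
      s.head.1 = ⊥ ∧ s.last = N := by
    intro N
    induction N using WellFoundedLT.induction with
    | _ N ih =>
      by_cases hN : N = ⟨⊥, hbot⟩
      · exact ⟨RelSeries.singleton _ N, by rw [RelSeries.head_singleton, hN], by simp⟩
      · have hmin : ¬ IsMin N := by
          intro hm
          exact hN (le_antisymm (hm (b := ⟨⊥, hbot⟩) (show (⊥ : Submodule A _) ≤ N.1 from bot_le))
            (show (⊥ : Submodule A _) ≤ N.1 from bot_le))
        obtain ⟨N', hN'⟩ := exists_covBy_of_wellFoundedGT hmin
        obtain ⟨s, hs, hs'⟩ := ih N' hN'.lt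
        exact ⟨s.snoc N (by rw [hs']; exact hN'), by rw [RelSeries.head_snoc, hs], by simp⟩
  obtain ⟨s, hs, hs'⟩ := key ⟨⊤, htop⟩
  exact ⟨s, hs, by rw [hs']⟩

end GradedCellularHW

/-! ### Graded dimensions -/

theorem coeff_T_apply (m k : ℤ) : (T m : ℤ[T;T⁻¹]).coeff k = if m = k then 1 else 0 := by
  classical
  rw [T, AddMonoidAlgebra.coeff_single, Finsupp.single_apply]

theorem coeff_sum_apply {ι : Type*} (s : Finset ι) (f : ι → ℤ[T;T⁻¹]) (k : ℤ) :
    (∑ i ∈ s, f i).coeff k = ∑ i ∈ s, (f i).coeff k := by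
  rw [AddMonoidAlgebra.coeff_sum, Finsupp.finsetSum_apply]

/-- The finite set `s` ensures that the sum has finite support and is not the default value `0`. -/
theorem coeff_finsum_T {f : ℤ → ℤ} {s : Finset ℤ} (hs : ∀ k ∉ s, f k = 0) (k : ℤ) :
    (∑ᶠ i, f i • (T i : ℤ[T;T⁻¹])).coeff k = f k := by
  rw [finsum_eq_sum_of_support_subset (s := s), coeff_sum_apply]
  · simp only [AddMonoidAlgebra.coeff_smul, Finsupp.smul_apply, coeff_T_apply, smul_eq_mul,
      mul_ite, mul_one, mul_zero]
    rw [Finset.sum_ite_eq' s k]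
    split_ifs with h
    · rfl
    · exact (hs k h).symm
  · intro k hk
    by_contra h
    rw [Finset.mem_coe] at h
    rw [Function.mem_support, hs k h, zero_smul] at hk
    exact hk rfl

theorem coeff_gradedDim {V : Type*} [AddCommGroup V] [Module ℂ V] {𝒱 : ℤ → Submodule ℂ V}
    {s : Finset ℤ} (hs : ∀ k ∉ s, 𝒱 k = ⊥) (k : ℤ) :
    (gradedDim 𝒱).coeff k = Module.finrank ℂ (𝒱 k) :=
  coeff_finsum_T (f := fun k => (Module.finrank ℂ (𝒱 k) : ℤ)) (s := s)
    (fun k hk => by rw [hs k hk, finrank_bot, Nat.cast_zero]) k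

/-! ### Graded weight spaces, their additivity and their duality. -/

namespace GradedCellularHW

variable {A : Type*} [Ring A] [Algebra ℂ A] {𝒜 : ℤ → Submodule ℂ A} [GradedAlgebra 𝒜]
variable {P : Type*} [Fintype P] [PartialOrder P] (D : GradedCellularHW 𝒜 P)

/-- The component of weight `μ` and degree `z` of a standard module. -/
def stdWeight (lam μ : P) (z : ℤ) : Submodule ℂ (D.Std lam) where
  carrier := {x | D.idem μ • x = x ∧ D.proj lam z x = x}
  add_mem' {x y} hx hy := ⟨by rw [smul_add, hx.1, hy.1], by rw [map_add, hx.2, hy.2]⟩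
  zero_mem' := ⟨smul_zero _, map_zero _⟩
  smul_mem' w x hx := ⟨by
    rw [smul_algebra_smul_comm w (D.idem μ) x, hx.1], by rw [map_smul, hx.2]⟩

theorem mem_stdWeight_iff {lam μ : P} {z : ℤ} {x : D.Std lam} :
    x ∈ D.stdWeight lam μ z ↔ ∀ S : D.Tabs lam, ¬ (S.1 = μ ∧ D.deg S.2 = z) → x S = 0 := by
  classical
  constructor
  · intro h S hS
    by_cases h1 : S.1 = μ
    · rw [← h.2, proj_apply, if_neg fun h2 => hS ⟨h1, h2⟩]
    · rw [← h.1, idem_smul_apply, if_neg h1]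
  · intro h
    constructor
    · funext S
      rw [idem_smul_apply]
      split_ifs with h1
      · rfl
      · exact (h S fun h2 => h1 h2.1).symm
    · funext S
      rw [proj_apply]
      split_ifs with h1
      · rfl
      · exact (h S fun h2 => h1 h2.2).symm

theorem idem_smul_proj_mem (lam μ : P) (z : ℤ) (x : D.Std lam) :
    D.idem μ • D.proj lam z x ∈ D.stdWeight lam μ z := by
  constructor
  · rw [← mul_smul, idem_mul_self]
  · rw [← idem_smul_proj, proj_proj, if_pos rfl]

theorem stdWeight_eq_bot {lam μ : P} {z : ℤ} (hz : z ∉ D.degrees lam) :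
    D.stdWeight lam μ z = ⊥ := by
  rw [eq_bot_iff]
  intro x hx
  rw [mem_stdWeight_iff] at hx
  rw [Submodule.mem_bot]
  funext S
  refine hx S fun h => hz ?_
  rw [← h.2]
  exact Finset.mem_image_of_mem _ (Finset.mem_univ S)

theorem stdWeight_eq_bot_of_isEmpty {lam μ : P} (h : IsEmpty (D.Tab lam μ)) (z : ℤ) :
    D.stdWeight lam μ z = ⊥ := by
  rw [eq_bot_iff]
  intro x hx
  rw [mem_stdWeight_iff] at hx
  rw [Submodule.mem_bot]
  funext ⟨κ, S⟩
  refine hx ⟨κ, S⟩ ?_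
  rintro ⟨rfl, -⟩
  exact h.false S

/-- `1_μ` has degree zero and commutes with the degree projections, so a homogeneous weight vector
lifts to one in `Δ(ν)`. -/
theorem simpleWeight_eq (ν μ : P) (z : ℤ) : D.simpleWeight ν μ z =
    (D.stdWeight ν μ z).map ((D.rad ν).mkQ.restrictScalars ℂ) := by
  ext y
  constructor
  · rintro ⟨⟨y', rfl⟩, x, hx, hxy⟩
    have h1 : D.idem μ • (D.idem μ • y') = D.idem μ • y' := by rw [← mul_smul, idem_mul_self]
    refine ⟨D.idem μ • D.proj ν z x, D.idem_smul_proj_mem ν μ z x, ?_⟩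
    rw [D.mem_stdGrading_iff.1 hx]
    change (D.rad ν).mkQ (D.idem μ • x) = D.idem μ • y'
    rw [map_smul]
    change (D.rad ν).mkQ x = D.idem μ • y' at hxy
    rw [hxy, h1]
  · rintro ⟨x, hx, rfl⟩
    refine ⟨⟨(D.rad ν).mkQ x, ?_⟩, x, D.mem_stdGrading_iff.2 hx.2, rfl⟩
    change D.idem μ • (D.rad ν).mkQ x = (D.rad ν).mkQ x
    rw [← map_smul, hx.1]

theorem simpleWeight_eq_bot {ν μ : P} {z : ℤ} (hz : z ∉ D.degrees ν) :
    D.simpleWeight ν μ z = ⊥ := by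
  rw [simpleWeight_eq, D.stdWeight_eq_bot hz, Submodule.map_bot]

theorem coeff_simpleCharacter (ν μ : P) (z : ℤ) :
    (D.simpleCharacter ν μ).coeff z = Module.finrank ℂ (D.simpleWeight ν μ z) :=
  coeff_gradedDim (s := D.degrees ν) (fun _ h => D.simpleWeight_eq_bot h) z

theorem nonempty_of_simpleCharacter_ne_zero {ν μ : P} (h : D.simpleCharacter ν μ ≠ 0) :
    Nonempty (D.Tab ν μ) := by
  by_contra hc
  rw [not_nonempty_iff] at hc
  refine h (LaurentPolynomial.ext fun z => ?_)
  have h1 := D.stdWeight_eq_bot_of_isEmpty hc z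
  rw [coeff_simpleCharacter, simpleWeight_eq, h1, Submodule.map_bot]
  simp

/-- The weight space is spanned by the image of `c_T`, of degree zero, which survives since the
radical has no vector of weight `ν`. -/
theorem simpleCharacter_self (ν : P) : D.simpleCharacter ν ν = 1 := by
  refine LaurentPolynomial.ext fun z => ?_
  rw [coeff_simpleCharacter, ← LaurentPolynomial.T_zero, coeff_T_apply, simpleWeight_eq]
  by_cases hz : 0 = z
  · subst hz
    rw [if_pos rfl]
    have h1 : (D.stdWeight ν ν 0).map ((D.rad ν).mkQ.restrictScalars ℂ) =
        Submodule.span ℂ {(D.rad ν).mkQ (D.vec ν (D.topTab ν))} := by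
      apply le_antisymm
      · rintro _ ⟨x, hx, rfl⟩
        have h2 := hx.1
        rw [idem_smul_eq_vec] at h2
        rw [← h2, map_smul]
        exact Submodule.smul_mem _ _ (Submodule.mem_span_singleton_self _)
      · rw [Submodule.span_singleton_le_iff_mem]
        refine ⟨D.vec ν (D.topTab ν), ?_, rfl⟩
        rw [SetLike.mem_coe, mem_stdWeight_iff]
        intro S hS
        rw [vec_apply, if_neg]
        rintro rfl
        exact hS ⟨rfl, D.deg_top ν⟩
    rw [h1, finrank_span_singleton]
    · simp
    · intro h2
      rw [Submodule.mkQ_apply, Submodule.Quotient.mk_eq_zero] at h2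
      have h3 := D.idem_smul_eq_zero_of_mem_rad h2
      rw [idem_smul_eq_vec] at h3
      have h4 := congrFun h3 (D.topTab ν)
      simp [csmul_apply, vec_apply, zero_apply] at h4
  · rw [if_neg hz]
    have h1 : D.stdWeight ν ν z = ⊥ := by
      rw [eq_bot_iff]
      intro x hx
      rw [mem_stdWeight_iff] at hx
      rw [Submodule.mem_bot]
      funext S
      refine hx S ?_
      rintro ⟨h1, h2⟩
      rw [D.eq_topTab h1] at h2
      exact hz ((D.deg_top ν).symm.trans h2)
    rw [h1, Submodule.map_bot]
    simp

/-! ### Characters along composition series -/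

/-- The radical is graded, so the components of `L(ν)` are independent. -/
theorem sum_simpleGrading {ν : P} (k z : ℤ) {s : Finset ℤ} (hz : z ∈ s) {u : ℤ → D.Simple ν}
    (hu : ∀ j, u j ∈ D.simpleGrading ν (j - k))
    (hs : ∑ j ∈ s, u j ∈ D.simpleGrading ν (z - k)) : ∑ j ∈ s, u j = u z := by
  choose x hx hxu using hu
  obtain ⟨y, hy, hyu⟩ := hs
  have h1 : ∀ j, (D.rad ν).mkQ (x j) = u j := hxu
  have h2 : (D.rad ν).mkQ y = ∑ j ∈ s, u j := hyu
  have h3 : (D.rad ν).mkQ (∑ j ∈ s, x j - y) = 0 := by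
    rw [map_sub, map_sum, h2, sub_eq_zero]
    exact Finset.sum_congr rfl fun j _ => h1 j
  rw [Submodule.mkQ_apply, Submodule.Quotient.mk_eq_zero] at h3
  have h4 := D.proj_mem_rad h3 (z - k)
  have h5 : D.proj ν (z - k) (∑ j ∈ s, x j) = x z := by
    rw [map_sum, Finset.sum_eq_single z]
    · exact D.mem_stdGrading_iff.1 (hx z)
    · intro j _ hj
      rw [← D.mem_stdGrading_iff.1 (hx j), proj_proj, if_neg (by omega)]
    · exact fun h => absurd hz h
  rw [map_sub, h5, D.mem_stdGrading_iff.1 hy] at h4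
  rw [← h2, ← h1 z, eq_comm]
  rw [Submodule.mkQ_apply, Submodule.mkQ_apply, Submodule.Quotient.eq]
  exact h4

/-- The graded dimension of the `μ`-weight space of a submodule of a standard module. -/
noncomputable def weightDim {lam : P} (N : Submodule A (D.Std lam)) (μ : P) : ℤ[T;T⁻¹] :=
  gradedDim fun z => N.restrictScalars ℂ ⊓ D.stdWeight lam μ z

theorem coeff_weightDim {lam : P} (N : Submodule A (D.Std lam)) (μ : P) (z : ℤ) :
    (D.weightDim N μ).coeff z =
      Module.finrank ℂ ↥(N.restrictScalars ℂ ⊓ D.stdWeight lam μ z) :=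
  coeff_gradedDim (𝒱 := fun z => N.restrictScalars ℂ ⊓ D.stdWeight lam μ z) (s := D.degrees lam)
    (fun _ h => by rw [D.stdWeight_eq_bot h, inf_bot_eq]) z

/-- Rank-nullity for the restriction of the quotient map to a homogeneous weight component. It is
onto the corresponding component of `L(ν)` because a preimage can be projected to its degree and
weight. -/
theorem finrank_of_isShiftedFactor {lam ν : P} {k : ℤ} {N₁ N₂ : Submodule A (D.Std lam)}
    (hle : N₁ ≤ N₂) (h₂ : IsGradedSubmodule (D.stdGrading lam) N₂)
    (h : IsShiftedFactor (D.stdGrading lam) (D.simpleGrading ν) N₁ N₂ k) (μ : P) (z : ℤ) :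
    Module.finrank ℂ ↥(N₂.restrictScalars ℂ ⊓ D.stdWeight lam μ z) =
      Module.finrank ℂ ↥(N₁.restrictScalars ℂ ⊓ D.stdWeight lam μ z) +
        Module.finrank ℂ (D.simpleWeight ν μ (z - k)) := by
  obtain ⟨φ, hφ⟩ := h
  have hg := (D.isGradedSubmodule_iff N₂).1 h₂
  set W := N₂.restrictScalars ℂ ⊓ D.stdWeight lam μ z with hW
  let Ψ : ↥W →ₗ[ℂ] D.Simple ν :=
    { toFun := fun x => φ (Submodule.Quotient.mk ⟨x.1, x.2.1⟩)
      map_add' := fun x y => by rw [← map_add]; rfl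
      map_smul' := fun w x => by
        exact LinearMap.map_smul_of_tower φ.toLinearMap w
          (Submodule.Quotient.mk ⟨x.1, x.2.1⟩ : ↥N₂ ⧸ N₁.submoduleOf N₂) }
  have hΨ : ∀ x : ↥W, Ψ x = φ (Submodule.Quotient.mk ⟨x.1, x.2.1⟩) := fun _ => rfl
  have hmk : ∀ x : ↥N₂, φ (Submodule.Quotient.mk x) = 0 ↔ x.1 ∈ N₁ := by
    intro x
    rw [LinearEquiv.map_eq_zero_iff, Submodule.Quotient.mk_eq_zero]
    rfl
  have hrange : LinearMap.range Ψ = D.simpleWeight ν μ (z - k) := by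
    apply le_antisymm
    · rintro _ ⟨x, rfl⟩
      refine ⟨⟨Ψ x, ?_⟩, hφ z _ (D.mem_stdGrading_iff.2 x.2.2.2)⟩
      change D.idem μ • Ψ x = Ψ x
      rw [hΨ, ← map_smul, ← Submodule.Quotient.mk_smul]
      congr 2
      exact Subtype.ext x.2.2.1
    · rintro y ⟨⟨y', rfl⟩, hy⟩
      change D.idem μ • y' ∈ D.simpleGrading ν (z - k) at hy
      obtain ⟨q, hq⟩ := φ.surjective (D.idem μ • y')
      obtain ⟨m, rfl⟩ := Submodule.Quotient.mk_surjective _ q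
      -- The index `z` is inserted because the argument needs a term for it even when no `c_S` has
      -- that degree.
      have hsum : ∑ j ∈ insert z (D.degrees lam), D.proj lam j m.1 = m.1 := by
        rw [Finset.sum_insert_of_eq_zero_if_notMem, D.sum_proj]
        intro hz
        funext S
        rw [proj_apply, if_neg, zero_apply]
        rintro rfl
        exact hz (Finset.mem_image_of_mem _ (Finset.mem_univ S))
      have hsum' : ∑ j ∈ insert z (D.degrees lam), φ (Submodule.Quotient.mk
          ⟨D.proj lam j m.1, hg m.1 m.2 j⟩) = D.idem μ • y' := by
        rw [← hq, ← map_sum]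
        congr 1
        have h1 : m = ∑ j ∈ insert z (D.degrees lam), ⟨D.proj lam j m.1, hg m.1 m.2 j⟩ := by
          apply Subtype.ext
          rw [AddSubmonoidClass.coe_finsetSum]
          exact hsum.symm
        conv_rhs => rw [h1]
        exact (map_sum (N₁.submoduleOf N₂).mkQ _ _).symm
      have h2 := D.sum_simpleGrading (ν := ν) k z (Finset.mem_insert_self z (D.degrees lam))
        (u := fun j => φ (Submodule.Quotient.mk ⟨D.proj lam j m.1, hg m.1 m.2 j⟩))
        (fun j => hφ j _ (D.proj_mem lam j m.1)) (by rw [hsum']; exact hy)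
      rw [hsum'] at h2
      refine ⟨⟨D.idem μ • D.proj lam z m.1, N₂.smul_mem _ (hg m.1 m.2 z),
        D.idem_smul_proj_mem lam μ z m.1⟩, ?_⟩
      change _ = D.idem μ • y'
      have h3 : D.idem μ • (D.idem μ • y') = D.idem μ • y' := by rw [← mul_smul, idem_mul_self]
      rw [← h3, h2]
      exact φ.map_smul (D.idem μ) (Submodule.Quotient.mk ⟨D.proj lam z m.1, hg m.1 m.2 z⟩)
  have hker : LinearMap.ker Ψ = (N₁.restrictScalars ℂ ⊓ D.stdWeight lam μ z).submoduleOf W := by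
    ext x
    rw [LinearMap.mem_ker, hΨ, hmk]
    exact ⟨fun h => ⟨h, x.2.2⟩, fun h => h.1⟩
  have h1 := LinearMap.finrank_range_add_finrank_ker Ψ
  have hle' : N₁.restrictScalars ℂ ⊓ D.stdWeight lam μ z ≤ W :=
    inf_le_inf_right (D.stdWeight lam μ z) (show N₁.restrictScalars ℂ ≤ N₂.restrictScalars ℂ from hle)
  rw [hrange, hker, (Submodule.submoduleOfEquivOfLe hle').finrank_eq] at h1
  omega

theorem weightDim_of_isShiftedFactor {lam ν : P} {k : ℤ} {N₁ N₂ : Submodule A (D.Std lam)}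
    (hle : N₁ ≤ N₂) (h₂ : IsGradedSubmodule (D.stdGrading lam) N₂)
    (h : IsShiftedFactor (D.stdGrading lam) (D.simpleGrading ν) N₁ N₂ k) (μ : P) :
    D.weightDim N₂ μ = D.weightDim N₁ μ + T k * D.simpleCharacter ν μ := by
  refine LaurentPolynomial.ext fun z => ?_
  rw [AlcoveGeometry.coeff_add, AlcoveGeometry.coeff_T_mul, coeff_weightDim, coeff_weightDim,
    coeff_simpleCharacter, D.finrank_of_isShiftedFactor hle h₂ h]
  push_cast
  rfl

/-- The factor determines `T k * Dim L_μ(ν)` for every `μ`. The weights `ν` and `ν'` each occur in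
both simple modules, hence bound each other, and the degree of the top weight space gives `k`. -/
theorem isShiftedFactor_unique {lam ν ν' : P} {k k' : ℤ} {N₁ N₂ : Submodule A (D.Std lam)}
    (hle : N₁ ≤ N₂) (h₂ : IsGradedSubmodule (D.stdGrading lam) N₂)
    (h : IsShiftedFactor (D.stdGrading lam) (D.simpleGrading ν) N₁ N₂ k)
    (h' : IsShiftedFactor (D.stdGrading lam) (D.simpleGrading ν') N₁ N₂ k') : ν = ν' ∧ k = k' := by
  have h1 : ∀ μ, T k * D.simpleCharacter ν μ = T k' * D.simpleCharacter ν' μ := fun μ =>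
    add_left_cancel ((D.weightDim_of_isShiftedFactor hle h₂ h μ).symm.trans
      (D.weightDim_of_isShiftedFactor hle h₂ h' μ))
  have hT : ∀ m : ℤ, (T m : ℤ[T;T⁻¹]) ≠ 0 := fun m h0 => by
    have := congrArg (fun q : ℤ[T;T⁻¹] => q.coeff m) h0
    rw [coeff_T_apply, if_pos rfl] at this
    exact one_ne_zero this
  have hle1 : ν ≤ ν' := by
    have h2 := h1 ν
    rw [simpleCharacter_self, mul_one] at h2
    obtain ⟨S⟩ := D.nonempty_of_simpleCharacter_ne_zero (ν := ν') (μ := ν) fun h0 => by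
      rw [h0, mul_zero] at h2
      exact hT k h2
    exact D.le_of_tab S
  have hle2 : ν' ≤ ν := by
    have h2 := h1 ν'
    rw [D.simpleCharacter_self ν', mul_one] at h2
    obtain ⟨S⟩ := D.nonempty_of_simpleCharacter_ne_zero (ν := ν) (μ := ν') fun h0 => by
      rw [h0, mul_zero] at h2
      exact hT k' h2.symm
    exact D.le_of_tab S
  obtain rfl := le_antisymm hle1 hle2
  refine ⟨rfl, ?_⟩
  have h2 := h1 ν
  rw [simpleCharacter_self, mul_one, mul_one] at h2
  have := congrArg (fun q : ℤ[T;T⁻¹] => q.coeff k) h2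
  simp only [coeff_T_apply, if_true] at this
  by_contra hc
  rw [if_neg fun h => hc h.symm] at this
  exact one_ne_zero this

theorem weightDim_bot {lam : P} (μ : P) : D.weightDim (⊥ : Submodule A (D.Std lam)) μ = 0 := by
  refine LaurentPolynomial.ext fun z => ?_
  have h1 : (⊥ : Submodule A (D.Std lam)).restrictScalars ℂ ⊓ D.stdWeight lam μ z = ⊥ := by
    rw [Submodule.restrictScalars_bot, bot_inf_eq]
  rw [coeff_weightDim, h1]
  simp

theorem finrank_stdWeight (lam μ : P) (z : ℤ) : Module.finrank ℂ (D.stdWeight lam μ z) =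
    Nat.card {S : D.Tab lam μ // D.deg S = z} := by
  classical
  have := D.finite_tab lam μ
  let e : D.stdWeight lam μ z ≃ₗ[ℂ] ({S : D.Tab lam μ // D.deg S = z} → ℂ) :=
    { toFun := fun x S => x.1 ⟨μ, S.1⟩
      map_add' := fun x y => rfl
      map_smul' := fun w x => rfl
      invFun := fun f => ⟨fun U => if h : ∃ S : {S : D.Tab lam μ // D.deg S = z}, U = ⟨μ, S.1⟩
          then f h.choose else 0, by
        refine D.mem_stdWeight_iff.2 ?_
        rintro U hU
        refine dif_neg ?_
        rintro ⟨S, rfl⟩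
        exact hU ⟨rfl, S.2⟩⟩
      left_inv := by
        intro x
        apply Subtype.ext
        funext U
        change (if h : ∃ S : {S : D.Tab lam μ // D.deg S = z}, U = ⟨μ, S.1⟩
          then x.1 ⟨μ, h.choose.1⟩ else 0) = x.1 U
        split_ifs with h
        · rw [← h.choose_spec]
        · rw [D.mem_stdWeight_iff.1 x.2]
          rintro ⟨h1, h2⟩
          obtain ⟨κ, U⟩ := U
          obtain rfl : κ = μ := h1
          exact h ⟨⟨U, h2⟩, rfl⟩
      right_inv := by
        intro f
        funext S
        have h : ∃ S' : {S : D.Tab lam μ // D.deg S = z}, (⟨μ, S.1⟩ : D.Tabs lam) = ⟨μ, S'.1⟩ :=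
          ⟨S, rfl⟩
        change (if h : ∃ S' : {S : D.Tab lam μ // D.deg S = z},
          (⟨μ, S.1⟩ : D.Tabs lam) = ⟨μ, S'.1⟩ then f h.choose else 0) = f S
        rw [dif_pos h]
        congr 1
        have h1 := h.choose_spec
        apply Subtype.ext
        exact (eq_of_heq (Sigma.mk.inj h1).2).symm }
  have := Fintype.ofFinite {S : D.Tab lam μ // D.deg S = z}
  rw [e.finrank_eq, Module.finrank_fintype_fun_eq_card, Nat.card_eq_fintype_card]

theorem weightDim_top (lam μ : P) [Fintype (D.Tab lam μ)] :
    D.weightDim (⊤ : Submodule A (D.Std lam)) μ = ∑ S : D.Tab lam μ, T (D.deg S) := by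
  classical
  refine LaurentPolynomial.ext fun z => ?_
  rw [coeff_weightDim, Submodule.restrictScalars_top, top_inf_eq, finrank_stdWeight,
    coeff_sum_apply, Nat.card_eq_fintype_card, Fintype.card_subtype]
  simp only [coeff_T_apply]
  rw [Finset.sum_boole]

end GradedCellularHW

namespace GradedCellularHW

variable {A : Type*} [Ring A] [Algebra ℂ A] {𝒜 : ℤ → Submodule ℂ A} [GradedAlgebra 𝒜]
variable {P : Type*} [Fintype P] [PartialOrder P] (D : GradedCellularHW 𝒜 P)

/-! ### Decomposition numbers and characters -/

theorem fin_sum_sub {R : Type*} [AddCommGroup R] {n : ℕ} (f : Fin (n + 1) → R) :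
    ∑ i : Fin n, (f i.succ - f i.castSucc) = f (Fin.last n) - f 0 := by
  induction n with
  | zero => simp
  | succ n ih =>
    rw [Fin.sum_univ_castSucc]
    have := ih fun i => f i.castSucc
    simp only [Fin.castSucc_zero] at this
    simp only [← Fin.succ_castSucc] at this ⊢
    rw [this]
    simp

open Classical in
/-- The factors of a graded composition series give the decomposition numbers. -/
theorem exists_factors (lam : P) : ∃ (m : ℕ) (ν : Fin m → P) (k : Fin m → ℤ),
    (∀ κ, D.decompositionNumber lam κ = ∑ i, if ν i = κ then T (k i) else 0) ∧
    ∀ μ, D.weightDim (⊤ : Submodule A (D.Std lam)) μ =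
      ∑ i, T (k i) * D.simpleCharacter (ν i) μ := by
  have h := D.exists_isGradedCompositionSeries lam
  obtain ⟨hs0, hs1⟩ := h.choose_spec
  -- This is the very series chosen in `gradedMultiplicity`, so no Jordan-Hölder argument is needed.
  set s := h.choose with hs
  have hstep : ∀ i : Fin s.length, s i.castSucc ⋖ s i.succ := fun i => s.step i
  choose ν k hf using fun i => exists_isShiftedFactor (hstep i)
  have hle : ∀ i : Fin s.length, (s i.castSucc).1 ≤ (s i.succ).1 := fun i => (hstep i).le
  have hiff : ∀ i κ z, IsShiftedFactor (D.stdGrading lam) (D.simpleGrading κ) (s i.castSucc).1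
      (s i.succ).1 z ↔ ν i = κ ∧ k i = z := by
    intro i κ z
    constructor
    · exact fun h1 => D.isShiftedFactor_unique (hle i) (s i.succ).2 (hf i) h1
    · rintro ⟨rfl, rfl⟩
      exact hf i
  refine ⟨s.length, ν, k, fun κ => ?_, fun μ => ?_⟩
  · have hmult : ∀ z, (gradedMultiplicity A (D.stdGrading lam) (D.simpleGrading κ) z : ℤ) =
        ∑ i, if ν i = κ ∧ k i = z then 1 else 0 := by
      intro z
      rw [gradedMultiplicity, dif_pos h, ← hs]
      simp only [hiff]
      rw [Nat.card_eq_fintype_card, Fintype.card_subtype, Finset.sum_boole]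
    refine LaurentPolynomial.ext fun z => ?_
    rw [decompositionNumber, coeff_finsum_T (s := Finset.univ.image k), hmult, coeff_sum_apply]
    · refine Finset.sum_congr rfl fun i _ => ?_
      by_cases h1 : ν i = κ
      · simp only [h1, true_and, if_true, coeff_T_apply]
      · simp [h1]
    · intro z hz
      rw [hmult]
      refine Finset.sum_eq_zero fun i _ => if_neg ?_
      rintro ⟨-, rfl⟩
      exact hz (Finset.mem_image_of_mem k (Finset.mem_univ i))
  · have h1 := fin_sum_sub fun j => D.weightDim (s j).1 μ
    have h2 : (s (Fin.last s.length)).1 = ⊤ := hs1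
    have h3 : (s 0).1 = ⊥ := hs0
    rw [h2, h3, weightDim_bot, sub_zero] at h1
    rw [← h1]
    refine Finset.sum_congr rfl fun i _ => ?_
    rw [D.weightDim_of_isShiftedFactor (hle i) (s i.succ).2 (hf i) μ, add_sub_cancel_left]

/-- The graded dimension of `1_μ Δ(λ)`, counted by basis vectors and by composition factors. -/
theorem sum_T_deg (lam μ : P) [Fintype (D.Tab lam μ)] : ∑ S : D.Tab lam μ, T (D.deg S) =
    ∑ κ, D.decompositionNumber lam κ * D.simpleCharacter κ μ := by
  classical
  obtain ⟨m, ν, k, h1, h2⟩ := D.exists_factors lam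
  rw [← weightDim_top, h2]
  simp only [h1, Finset.sum_mul, ite_mul, zero_mul]
  rw [Finset.sum_comm]
  simp

/-- A factor `L(κ)` contributes its top weight space to `1_κ Δ(λ)`, and contributions of different
factors cannot cancel. -/
theorem nonempty_of_decompositionNumber_ne_zero {lam κ : P}
    (h : D.decompositionNumber lam κ ≠ 0) : Nonempty (D.Tab lam κ) := by
  classical
  by_contra hc
  rw [not_nonempty_iff] at hc
  obtain ⟨m, ν, k, h1, h2⟩ := D.exists_factors lam
  have := D.finite_tab lam κ
  have := Fintype.ofFinite (D.Tab lam κ)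
  have h3 := h2 κ
  rw [weightDim_top, Fintype.sum_empty] at h3
  have h4 : ∀ (i : Fin m) (z : ℤ), 0 ≤ (T (k i) * D.simpleCharacter (ν i) κ).coeff z := by
    intro i z
    rw [AlcoveGeometry.coeff_T_mul, coeff_simpleCharacter]
    positivity
  apply h
  rw [h1]
  refine Finset.sum_eq_zero fun i _ => ?_
  split_ifs with h5
  · exfalso
    have h6 := congrArg (fun q : ℤ[T;T⁻¹] => q.coeff (k i)) h3
    simp only [coeff_sum_apply, AddMonoidAlgebra.coeff_zero, Finsupp.zero_apply] at h6
    have h7 := (Finset.sum_eq_zero_iff_of_nonneg fun j _ => h4 j (k i)).1 h6.symm i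
      (Finset.mem_univ i)
    rw [h5, simpleCharacter_self, mul_one, coeff_T_apply, if_pos rfl] at h7
    exact one_ne_zero h7
  · rfl

theorem decompositionNumber_self (μ : P) : D.decompositionNumber μ μ = 1 := by
  classical
  have := D.finite_tab μ μ
  have := Fintype.ofFinite (D.Tab μ μ)
  have h := D.sum_T_deg μ μ
  have hu : Unique (D.Tab μ μ) := ⟨⟨D.top μ⟩, D.eq_top μ⟩
  rw [Fintype.sum_unique, D.eq_top μ default, deg_top, LaurentPolynomial.T_zero,
    Finset.sum_eq_single μ] at h
  · rw [h, simpleCharacter_self, mul_one]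
  · intro κ _ hκ
    by_contra hc
    obtain ⟨S⟩ := D.nonempty_of_decompositionNumber_ne_zero (left_ne_zero_of_mul hc)
    obtain ⟨U⟩ := D.nonempty_of_simpleCharacter_ne_zero (right_ne_zero_of_mul hc)
    exact hκ (le_antisymm (D.le_of_tab S) (D.le_of_tab U))
  · simp

/-! ### Characters are invariant under `t ↦ t⁻¹` -/

/-- The cellular form as a bilinear map. -/
noncomputable def formMap (lam : P) : D.Std lam →ₗ[ℂ] D.Std lam →ₗ[ℂ] ℂ :=
  LinearMap.mk₂ ℂ (D.form lam)
    (fun x x' y => by simp [form, add_apply, add_mul, Finset.sum_add_distrib])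
    (fun w x y => by simp [form, csmul_apply, Finset.mul_sum, mul_assoc])
    (fun x y y' => by simp [form, add_apply, add_mul, mul_add, Finset.sum_add_distrib])
    (fun w x y => by
      simp only [form, csmul_apply, Finset.mul_sum, smul_eq_mul]
      exact Finset.sum_congr rfl fun S _ => Finset.sum_congr rfl fun U _ => by ring)

theorem finrank_range_flip {V W : Type*} [AddCommGroup V] [Module ℂ V] [AddCommGroup W]
    [Module ℂ W] [FiniteDimensional ℂ W] (f : V →ₗ[ℂ] W →ₗ[ℂ] ℂ) :
    Module.finrank ℂ (LinearMap.range f.flip) = Module.finrank ℂ (LinearMap.range f) := by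
  have h1 : f.flip = (LinearMap.dualMap f) ∘ₗ (Module.evalEquiv ℂ W).toLinearMap := by
    ext w v
    rfl
  rw [h1, LinearMap.range_comp, LinearEquiv.range, Submodule.map_top]
  exact LinearMap.finrank_range_dualMap_eq_finrank_range f

theorem star_idem (μ : P) : D.star (D.idem μ) = D.idem μ := by
  rw [← D.c_topTab, star_c]

/-- The pairing of the homogeneous components of a weight space. -/
noncomputable def weightPairing (lam μ : P) (z z' : ℤ) :
    D.stdWeight lam μ z →ₗ[ℂ] D.stdWeight lam μ z' →ₗ[ℂ] ℂ :=
  (D.formMap lam).domRestrict₁₂ _ _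

/-- `1_μ` is fixed by `*` and the projections to degrees `z` and `-z` are adjoint. A vector of this
component that is orthogonal to the dual component therefore lies in the radical. -/
theorem finrank_range_weightPairing (lam μ : P) {z z' : ℤ} (hz : z + z' = 0) :
    Module.finrank ℂ (LinearMap.range (D.weightPairing lam μ z z')) =
      Module.finrank ℂ (D.simpleWeight lam μ z) := by
  have hker : LinearMap.ker (D.weightPairing lam μ z z') =
      LinearMap.ker (((D.rad lam).mkQ.restrictScalars ℂ) ∘ₗ (D.stdWeight lam μ z).subtype) := by
    ext x
    rw [LinearMap.mem_ker, LinearMap.mem_ker, LinearMap.comp_apply]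
    change _ ↔ (D.rad lam).mkQ x.1 = 0
    rw [Submodule.mkQ_apply, Submodule.Quotient.mk_eq_zero, mem_rad]
    constructor
    · intro h y
      have h1 : D.form lam x.1 (D.idem μ • D.proj lam z' y) = 0 :=
        LinearMap.congr_fun h ⟨_, D.idem_smul_proj_mem lam μ z' y⟩
      rw [← D.star_idem, ← form_smul, x.2.1] at h1
      have h2 : z' = -z := by omega
      rwa [h2, ← form_proj, x.2.2] at h1
    · intro h
      ext y
      exact h y.1
  have h1 := LinearMap.finrank_range_add_finrank_ker (D.weightPairing lam μ z z')
  have h2 := LinearMap.finrank_range_add_finrank_ker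
    (((D.rad lam).mkQ.restrictScalars ℂ) ∘ₗ (D.stdWeight lam μ z).subtype)
  rw [hker] at h1
  rw [LinearMap.range_comp, Submodule.range_subtype, ← simpleWeight_eq] at h2
  exact Nat.add_right_cancel (h1.trans h2.symm)

/-- The pairings of degree `z` with `-z` and of `-z` with `z` are transposes by symmetry of the
form, so they have the same rank. -/
theorem finrank_simpleWeight_neg (lam μ : P) (z : ℤ) :
    Module.finrank ℂ (D.simpleWeight lam μ (-z)) = Module.finrank ℂ (D.simpleWeight lam μ z) := by
  have h : (D.weightPairing lam μ (-z) z).flip = D.weightPairing lam μ z (-z) :=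
    LinearMap.ext fun x => LinearMap.ext fun y => D.form_comm lam y.1 x.1
  rw [← D.finrank_range_weightPairing lam μ (add_neg_cancel z),
    ← D.finrank_range_weightPairing lam μ (neg_add_cancel z), ← finrank_range_flip, h]

theorem invert_simpleCharacter (lam μ : P) :
    LaurentPolynomial.invert (D.simpleCharacter lam μ) = D.simpleCharacter lam μ := by
  refine LaurentPolynomial.ext fun z => ?_
  rw [LaurentPolynomial.invert_apply, coeff_simpleCharacter, coeff_simpleCharacter,
    finrank_simpleWeight_neg]

end GradedCellularHW

namespace AlcoveGeometry

variable {r : ℕ} {G : AlcoveGeometry r}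

/-! ### Linkage -/

theorem Linked.symm {x y : ESpace r} (h : G.Linked x y) : G.Linked y x := by
  obtain ⟨w, hw, rfl⟩ := h
  exact ⟨w⁻¹, G.W.inv_mem hw, by simp⟩

theorem Linked.trans {x y z : ESpace r} (h : G.Linked x y) (h' : G.Linked y z) :
    G.Linked x z := by
  obtain ⟨w, hw, rfl⟩ := h
  obtain ⟨v, hv, rfl⟩ := h'
  exact ⟨v * w, G.W.mul_mem hv hw, rfl⟩

theorem Linked.refl (x : ESpace r) : G.Linked x x := ⟨1, G.W.one_mem, rfl⟩

theorem Linked.regular {x y : ESpace r} (h : G.Linked x y) (hx : G.Regular x) : G.Regular y := by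
  obtain ⟨w, hw, rfl⟩ := h
  exact G.regular_smul ⟨w, hw⟩ hx

theorem PathEquiv.linked {n : ℕ} {ω ω' : Fin (n + 1) → ESpace r} (h : G.PathEquiv ω ω') :
    G.Linked (ω (Fin.last n)) (ω' (Fin.last n)) := by
  induction h with
  | refl => exact Linked.refl _
  | tail _ hstep ih =>
    obtain ⟨κ, hκ, k, -, rfl⟩ := hstep
    refine ih.trans ?_
    rw [reflectAt]
    split_ifs
    · exact Linked.refl _
    · exact ⟨_, G.reflect_mem_W hκ, rfl⟩

theorem wordPath_zero {n : ℕ} (w : Fin n → Fin r) : wordPath w 0 = 0 := by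
  rw [wordPath, Finset.filter_false_of_mem, Finset.sum_empty]
  exact fun i _ => not_lt.2 (Fin.zero_le _)

/-- A combination of Kazhdan-Lusztig basis elements with bar-invariant coefficients is a basis
element if it has the shape of one. -/
theorem eq_single_of_linearCombination {p : G.Alcove → G.Alcove} (hp : G.IsDescent p)
    {F : G.Pattern} (hF : ∀ b, LaurentPolynomial.invert (F b) = F b) {a : G.Alcove}
    (h1 : Finsupp.linearCombination ℤ[T;T⁻¹] (klPattern hp) F a = 1)
    (h2 : ∀ b, b ≠ a → IsPos (Finsupp.linearCombination ℤ[T;T⁻¹] (klPattern hp) F b)) :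
    F = Finsupp.single a 1 := by
  classical
  rw [← sub_eq_zero]
  by_contra hne
  obtain ⟨b, hb, hmax⟩ := G.exists_max_len hne
  set F' := F - Finsupp.single a 1 with hF'
  have hval : ∀ c, Finsupp.linearCombination ℤ[T;T⁻¹] (klPattern hp) F' c =
      Finsupp.linearCombination ℤ[T;T⁻¹] (klPattern hp) F c - klPattern hp a c := by
    intro c
    rw [hF', map_sub, Finsupp.linearCombination_single, one_smul, Finsupp.sub_apply]
  have hpos : IsPos (Finsupp.linearCombination ℤ[T;T⁻¹] (klPattern hp) F' b) := by
    rw [hval]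
    by_cases hba : b = a
    · rw [hba, h1, (klPattern_isKL hp a).self, sub_self]
      exact isPos_zero
    · exact (h2 b hba).sub ((klPattern_isKL hp a).pos b hba)
  -- By triangularity the value at a longest alcove of the support is the coefficient there. It is
  -- self-dual and lies in `t ℤ[t]`, a contradiction.
  have hb' : Finsupp.linearCombination ℤ[T;T⁻¹] (klPattern hp) F' b = F' b := by
    rw [Finsupp.linearCombination_apply, Finsupp.sum, Finsupp.finsetSum_apply,
      Finset.sum_eq_single b]
    · rw [Finsupp.smul_apply, (klPattern_isKL hp b).self, smul_eq_mul, mul_one]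
    · intro d hd hdb
      rw [Finsupp.smul_apply, (klPattern_isKL hp d).lower b hdb.symm
        (hmax d (Finsupp.mem_support_iff.1 hd)), smul_zero]
    · intro h
      rw [Finsupp.notMem_support_iff.1 h, zero_smul, Finsupp.zero_apply]
  rw [hb'] at hpos
  refine hb (eq_zero_of_isPos_of_invert hpos ?_)
  rw [hF', Finsupp.sub_apply, map_sub, hF, Finsupp.single_apply]
  split_ifs <;> simp

theorem isPos_toLaurent (q : Polynomial ℤ) : IsPos (Polynomial.toLaurent (Polynomial.X * q)) := by
  have h : ∀ (q : Polynomial ℤ) (k : ℤ), k < 0 → (Polynomial.toLaurent q).coeff k = 0 := by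
    intro q k hk
    induction q using Polynomial.induction_on' with
    | add p q hp hq => rw [map_add, coeff_add, hp, hq, add_zero]
    | monomial m a =>
      rw [← Polynomial.C_mul_X_pow_eq_monomial, Polynomial.toLaurent_C_mul_X_pow, mul_comm,
        coeff_T_mul, LaurentPolynomial.C_apply, if_neg (by omega)]
  intro k hk
  rw [map_mul, Polynomial.toLaurent_X, coeff_T_mul]
  exact h q _ (by omega)

end AlcoveGeometry

/-! ### Comparison of the representation theory with the algorithms. -/

namespace SoergelPathBasis

open AlcoveGeometry

variable {A : Type*} [Ring A] [Algebra ℂ A] {𝒜 : ℤ → Submodule ℂ A} [GradedAlgebra 𝒜]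
variable {P : Type*} [Fintype P] [PartialOrder P] {D : GradedCellularHW 𝒜 P}
variable {r : ℕ} {G : AlcoveGeometry r} {n : ℕ} (B : SoergelPathBasis D G n)

/-! ### Decomposition numbers by Soergel's algorithm -/

theorem linked_of_tab {lam μ : P} (S : D.Tab lam μ) : G.Linked (B.pt μ) (B.pt lam) := by
  have h := (B.toPath lam μ S).2
  have h1 := PathEquiv.linked h.1
  rwa [h.2, B.word_end] at h1

/-- `𝒯(μ, μ)` has one element, so `ω^μ` is the only path from its class that ends in `μ`; this is
the uniqueness on which transversality depends. -/
theorem isTransversal {μ : P} (hμ : G.Regular (B.pt μ)) :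
    G.IsTransversal (wordPath (B.word μ)) := by
  refine isTransversal_of_admissible (wordPath_zero _) (B.admissible μ hμ)
    (by rwa [B.word_end]) fun ω' h1 h2 => ?_
  rw [B.word_end] at h2
  let x : G.PathsTo (wordPath (B.word μ)) (B.pt μ) := ⟨ω', h1, h2⟩
  have h3 : (B.toPath μ μ).symm x = D.top μ := D.eq_top μ _
  have h4 : x = B.toPath μ μ (D.top μ) := by rw [← h3, Equiv.apply_symm_apply]
  have h5 : x.1 = (B.toPath μ μ (D.top μ)).1 := congrArg Subtype.val h4
  rw [B.toPath_top] at h5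
  exact h5

open Classical in
/-- The alcove of a regular weight. -/
noncomputable def alcove (lam : P) : G.Alcove :=
  if h : G.Regular (B.pt lam) then G.alcoveOf (B.pt lam) h else G.fundamental

theorem alcove_eq {lam : P} (h : G.Regular (B.pt lam)) : B.alcove lam = G.alcoveOf (B.pt lam) h :=
  dif_pos h

theorem pt_mem_alcove {lam : P} (h : G.Regular (B.pt lam)) : B.pt lam ∈ (B.alcove lam).1 := by
  rw [B.alcove_eq h]
  exact G.mem_alcoveOf h

theorem alcove_smul {lam μ : P} (hμ : G.Regular (B.pt μ)) {v : G.W}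
    (hv : v.1 (B.pt μ) = B.pt lam) : B.alcove lam = v • B.alcove μ := by
  have h1 : B.pt lam ∈ (v • B.alcove μ).1 := by
    rw [← hv]
    exact G.smul_mem (B.pt_mem_alcove hμ)
  rw [G.eq_alcoveOf h1, B.alcove_eq]

/-- A weight is determined by its alcove and its linkage class. -/
theorem eq_of_alcove_eq {lam κ : P} (h : G.Linked (B.pt lam) (B.pt κ))
    (hlam : G.Regular (B.pt lam)) (ha : B.alcove κ = B.alcove lam) : κ = lam := by
  obtain ⟨w, hw, hwp⟩ := h
  have h1 := B.alcove_smul hlam (v := ⟨w, hw⟩) hwp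
  rw [ha] at h1
  have h2 := (smul_eq_smul_iff (B.pt_mem_alcove hlam) 1 ⟨w, hw⟩).1 (by rw [one_smul, ← h1])
  apply B.pt.injective
  rw [← hwp]
  exact h2.symm

open Classical in
/-- The weights linked to `μ`. -/
noncomputable def linkage (μ : P) : Finset P :=
  Finset.univ.filter fun lam => G.Linked (B.pt μ) (B.pt lam)

theorem mem_linkage {μ lam : P} : lam ∈ B.linkage μ ↔ G.Linked (B.pt μ) (B.pt lam) := by
  simp [linkage]

theorem linkage_eq {μ κ : P} (h : κ ∈ B.linkage μ) : B.linkage κ = B.linkage μ := by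
  rw [mem_linkage] at h
  ext lam
  rw [mem_linkage, mem_linkage]
  exact ⟨fun h1 => h.trans h1, fun h1 => h.symm.trans h1⟩

/-- The function `f` on the weights linked to `μ`, as a function on alcoves. -/
noncomputable def pattern (μ : P) (f : P → ℤ[T;T⁻¹]) : G.Pattern :=
  ∑ lam ∈ B.linkage μ, Finsupp.single (B.alcove lam) (f lam)

theorem pattern_apply {μ : P} (hμ : G.Regular (B.pt μ)) (f : P → ℤ[T;T⁻¹]) {lam : P}
    (hlam : lam ∈ B.linkage μ) : B.pattern μ f (B.alcove lam) = f lam := by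
  rw [pattern, Finsupp.finsetSum_apply, Finset.sum_eq_single lam]
  · rw [Finsupp.single_eq_same]
  · intro κ hκ hne
    refine Finsupp.single_eq_of_ne fun h => hne ?_
    rw [mem_linkage] at hlam hκ
    exact B.eq_of_alcove_eq (hlam.symm.trans hκ) (hlam.regular hμ) h.symm
  · exact fun h => absurd hlam h

theorem pattern_apply_eq_zero {μ : P} (f : P → ℤ[T;T⁻¹]) {b : G.Alcove}
    (hb : ∀ lam ∈ B.linkage μ, B.alcove lam ≠ b) : B.pattern μ f b = 0 := by
  rw [pattern, Finsupp.finsetSum_apply]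
  exact Finset.sum_eq_zero fun κ hκ => Finsupp.single_eq_of_ne fun h => hb κ hκ h.symm

theorem alcoveSeries_last {μ : P} (hμ : G.Regular (B.pt μ)) {N : ℕ} {g : ℕ → G.Alcove}
    (hs : G.IsAlcoveSeries (wordPath (B.word μ)) N g) : g N = B.alcove μ := by
  rw [(B.isTransversal hμ).eq_alcoveOf_end hs.finish, B.alcove_eq hμ]
  simp only [B.word_end]

/-- The pattern of an alcove series is given by the graded dimensions of the weight spaces of the
standard modules. -/
theorem chainPattern_eq {μ : P} (hμ : G.Regular (B.pt μ)) {N : ℕ} {g : ℕ → G.Alcove}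
    (hs : G.IsAlcoveSeries (wordPath (B.word μ)) N g) (b : G.Alcove) :
    chainPattern G g N b = B.pattern μ
      (fun lam => ∑ κ, D.decompositionNumber lam κ * D.simpleCharacter κ μ) b := by
  have hgN := B.alcoveSeries_last hμ hs
  obtain ⟨v, rfl⟩ := G.exists_smul_eq (g N) b
  -- If the point of this alcove linked to `μ` is not a weight, then no path ends there by
  -- `end_mem`, and both sides vanish.
  by_cases h : ∃ lam, B.pt lam = v.1 (B.pt μ)
  · obtain ⟨lam, hlam⟩ := h
    have h1 : lam ∈ B.linkage μ := B.mem_linkage.2 ⟨v.1, v.2, hlam.symm⟩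
    have h2 := B.alcove_smul hμ hlam.symm
    have := D.finite_tab lam μ
    have := Fintype.ofFinite (D.Tab lam μ)
    rw [hgN, ← h2, B.pattern_apply hμ _ h1, ← D.sum_T_deg, h2, ← hgN,
      ← hs.sum_paths (B.isTransversal hμ) v (y := B.pt lam) (by rw [B.word_end, hlam])
        (B.toPath lam μ)]
    exact Finset.sum_congr rfl fun S _ => congrArg T (B.deg_toPath lam μ S)
  · rw [B.pattern_apply_eq_zero]
    · have hE : IsEmpty {ω' : Fin (n + 1) → ESpace r // G.PathEquiv (wordPath (B.word μ)) ω' ∧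
          ω' (Fin.last n) = v.1 (B.pt μ)} := by
        refine ⟨fun ω' => h ?_⟩
        obtain ⟨lam, hlam⟩ := B.end_mem μ ω'.1 ω'.2.1
        exact ⟨lam, hlam.trans ω'.2.2⟩
      rw [← hs.sum_paths (B.isTransversal hμ) v (y := v.1 (B.pt μ)) (by rw [B.word_end])
        (Equiv.equivOfIsEmpty Empty _), Fintype.sum_empty]
    · intro lam hlam h1
      obtain ⟨w, hw, hwp⟩ := B.mem_linkage.1 hlam
      rw [hgN, B.alcove_smul hμ (v := ⟨w, hw⟩) hwp] at h1
      have h2 := (smul_eq_smul_iff (B.pt_mem_alcove hμ) _ _).1 h1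
      exact h ⟨lam, hwp.symm.trans h2⟩

/-- The sum is regrouped by the simple factor `κ`. Only `κ` linked to `μ` contributes, as a nonzero
`L_μ(κ)` requires a path from `ω^μ` to `κ`. -/
theorem chainPattern_eq_sum {μ : P} (hμ : G.Regular (B.pt μ)) {N : ℕ} {g : ℕ → G.Alcove}
    (hs : G.IsAlcoveSeries (wordPath (B.word μ)) N g) (b : G.Alcove) :
    chainPattern G g N b = (∑ κ ∈ B.linkage μ, D.simpleCharacter κ μ •
      B.pattern κ fun lam => D.decompositionNumber lam κ) b := by
  rw [B.chainPattern_eq hμ hs]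
  congr 1
  have h1 : ∀ κ ∈ B.linkage μ, D.simpleCharacter κ μ •
      B.pattern κ (fun lam => D.decompositionNumber lam κ) = ∑ lam ∈ B.linkage μ,
        Finsupp.single (B.alcove lam) (D.decompositionNumber lam κ * D.simpleCharacter κ μ) := by
    intro κ hκ
    rw [pattern, B.linkage_eq hκ, Finset.smul_sum]
    refine Finset.sum_congr rfl fun lam _ => ?_
    rw [Finsupp.smul_single, smul_eq_mul, mul_comm]
  rw [Finset.sum_congr rfl h1, Finset.sum_comm, pattern]
  refine Finset.sum_congr rfl fun lam _ => ?_
  rw [← Finsupp.single_finsetSum]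
  congr 1
  symm
  refine Finset.sum_subset (Finset.subset_univ _) fun κ _ hκ => ?_
  by_contra hc
  obtain ⟨S⟩ := D.nonempty_of_simpleCharacter_ne_zero (right_ne_zero_of_mul hc)
  exact hκ (B.mem_linkage.2 (B.linked_of_tab S))

/-- One step of the induction along the weights. -/
theorem pattern_eq_klPattern_of_gt {p : G.Alcove → G.Alcove} (hp : G.IsDescent p)
    (hd : ∀ lam κ : P, lam ≠ κ → IsPos (D.decompositionNumber lam κ))
    {μ : P} (hμ : G.Regular (B.pt μ))
    (ih : ∀ κ ∈ B.linkage μ, μ < κ →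
      B.pattern κ (fun lam => D.decompositionNumber lam κ) = klPattern hp (B.alcove κ))
    {N : ℕ} {g : ℕ → G.Alcove} (hs : G.IsAlcoveSeries (wordPath (B.word μ)) N g) :
    B.pattern μ (fun lam => D.decompositionNumber lam μ) = klPattern hp (B.alcove μ) ∧
      ∀ b, G.charE p g N b = B.pattern μ (fun lam => D.simpleCharacter lam μ) b := by
  classical
  have h0 : g 0 = G.fundamental := by cases hs; assumption
  obtain ⟨E, M, hE, hEinv, hM, hME⟩ := exists_charE hp h0 N fun i hi => (hs.adj i hi).1
  have hμμ : μ ∈ B.linkage μ := B.mem_linkage.2 (Linked.refl _)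
  -- The characters of the factors `κ ≠ μ`. Those that do not vanish have `κ > μ`, where the
  -- decomposition numbers are known by induction.
  set R : G.Pattern := ∑ κ ∈ (B.linkage μ).erase μ,
    Finsupp.single (B.alcove κ) (D.simpleCharacter κ μ) with hR
  have hRE : R + Finsupp.single (B.alcove μ) 1 =
      B.pattern μ (fun lam => D.simpleCharacter lam μ) := by
    rw [pattern, ← Finset.sum_erase_add _ _ hμμ, D.simpleCharacter_self]
  have hRinv : ∀ b, LaurentPolynomial.invert (R b) = R b := by
    intro b
    rw [hR, Finsupp.finsetSum_apply, map_sum]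
    refine Finset.sum_congr rfl fun κ _ => ?_
    rw [Finsupp.single_apply]
    split_ifs
    · exact D.invert_simpleCharacter κ μ
    · simp
  have hMR : M = Finsupp.linearCombination ℤ[T;T⁻¹] (klPattern hp) R +
      B.pattern μ (fun lam => D.decompositionNumber lam μ) := by
    have h1 : M = ∑ κ ∈ B.linkage μ, D.simpleCharacter κ μ •
        B.pattern κ fun lam => D.decompositionNumber lam κ :=
      Finsupp.ext fun b => by rw [hM, B.chainPattern_eq_sum hμ hs]
    rw [h1, ← Finset.sum_erase_add _ _ hμμ, D.simpleCharacter_self, one_smul, hR, map_sum]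
    congr 1
    refine Finset.sum_congr rfl fun κ hκ => ?_
    rw [Finset.mem_erase] at hκ
    rw [Finsupp.linearCombination_single]
    by_cases h0 : D.simpleCharacter κ μ = 0
    · rw [h0, zero_smul, zero_smul]
    · obtain ⟨S⟩ := D.nonempty_of_simpleCharacter_ne_zero h0
      rw [ih κ hκ.2 (lt_of_le_of_ne (D.le_of_tab S) hκ.1.symm)]
  have hF : Finsupp.linearCombination ℤ[T;T⁻¹] (klPattern hp) (E - R) =
      B.pattern μ (fun lam => D.decompositionNumber lam μ) := by
    rw [map_sub, ← hME, hMR, add_sub_cancel_left]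
  -- Both `E` and `R` are self-dual, and the expansion of their difference is `d_{·μ}`, whose
  -- entries have the shape of a Kazhdan-Lusztig element.
  have hFs : E - R = Finsupp.single (B.alcove μ) 1 := by
    refine eq_single_of_linearCombination hp (fun b => ?_) ?_ fun b hb => ?_
    · rw [Finsupp.sub_apply, map_sub, hEinv, hRinv]
    · rw [hF, B.pattern_apply hμ _ hμμ, D.decompositionNumber_self]
    · rw [hF]
      by_cases h : ∃ lam ∈ B.linkage μ, B.alcove lam = b
      · obtain ⟨lam, hlam, rfl⟩ := h
        rw [B.pattern_apply hμ _ hlam]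
        exact hd lam μ fun h0 => hb (by rw [h0])
      · rw [B.pattern_apply_eq_zero]
        · exact isPos_zero
        · exact fun lam hlam h0 => h ⟨lam, hlam, h0⟩
  constructor
  · rw [← hF, hFs, Finsupp.linearCombination_single, one_smul]
  · intro b
    rw [← hE, ← hRE, ← hFs]
    simp

/-- Induction from larger to smaller weights. The alcove series may depend on `μ`, as the result
does not refer to it. -/
theorem pattern_eq_klPattern {p : G.Alcove → G.Alcove} (hp : G.IsDescent p)
    (hd : ∀ lam κ : P, lam ≠ κ → IsPos (D.decompositionNumber lam κ)) (μ : P)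
    (hμ : G.Regular (B.pt μ)) :
    B.pattern μ (fun lam => D.decompositionNumber lam μ) = klPattern hp (B.alcove μ) := by
  induction μ using WellFoundedGT.induction with
  | _ μ ih =>
    obtain ⟨N, g, hs⟩ := (B.isTransversal hμ).exists_alcoveSeries
    exact (B.pattern_eq_klPattern_of_gt hp hd hμ
      (fun κ hκ hlt => ih κ hlt ((B.mem_linkage.1 hκ).regular hμ)) hs).1

end SoergelPathBasis

theorem mainTheorem2 {A : Type*} [Ring A] [Algebra ℂ A] {𝒜 : ℤ → Submodule ℂ A}
    [GradedAlgebra 𝒜] {P : Type*} [Fintype P] [PartialOrder P] (D : GradedCellularHW 𝒜 P)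
    {r : ℕ} (G : AlcoveGeometry r) {n : ℕ} (B : SoergelPathBasis D G n)
    (hd : ∀ lam μ : P, lam ≠ μ → ∃ q : Polynomial ℕ,
      D.decompositionNumber lam μ =
        Polynomial.toLaurent ((Polynomial.X * q).map (Nat.castRingHom ℤ))) :
    (∃ p, G.IsDescent p) ∧
    ∀ p, G.IsDescent p → ∀ (lam μ : P) (hlam : G.Regular (B.pt lam)) (hμ : G.Regular (B.pt μ)),
      D.decompositionNumber lam μ = G.pointN p (B.pt μ) (B.pt lam) hμ hlam ∧
      (∃ N g, G.IsAlcoveSeries (AlcoveGeometry.wordPath (B.word μ)) N g) ∧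
      ∀ N g, G.IsAlcoveSeries (AlcoveGeometry.wordPath (B.word μ)) N g →
        g N = G.alcoveOf (B.pt μ) hμ ∧
        D.simpleCharacter lam μ = G.pointE p N g (B.pt μ) (B.pt lam) hlam := by
  refine ⟨G.exists_descent, fun p hp lam μ hlam hμ => ?_⟩
  have hd' : ∀ lam κ : P, lam ≠ κ → AlcoveGeometry.IsPos (D.decompositionNumber lam κ) := by
    intro lam κ hne
    obtain ⟨q, hq⟩ := hd lam κ hne
    rw [hq, Polynomial.map_mul, Polynomial.map_X]
    exact AlcoveGeometry.isPos_toLaurent _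
  refine ⟨?_, (B.isTransversal hμ).exists_alcoveSeries, fun N g hs => ⟨?_, ?_⟩⟩
  · rw [AlcoveGeometry.pointN]
    split_ifs with h
    · rw [← B.alcove_eq hμ, ← B.alcove_eq hlam, ← AlcoveGeometry.klPattern_apply hp,
        ← B.pattern_eq_klPattern hp hd' μ hμ, B.pattern_apply hμ _ (B.mem_linkage.2 h)]
    -- A nonzero decomposition number requires a tableau, hence a path, and its end points are
    -- linked.
    · by_contra h0
      obtain ⟨S⟩ := D.nonempty_of_decompositionNumber_ne_zero h0
      exact h (B.linked_of_tab S)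
  · rw [B.alcoveSeries_last hμ hs, B.alcove_eq hμ]
  · rw [AlcoveGeometry.pointE]
    split_ifs with h
    · rw [← B.alcove_eq hlam, (B.pattern_eq_klPattern_of_gt hp hd' hμ (fun κ hκ _ =>
        B.pattern_eq_klPattern hp hd' κ ((B.mem_linkage.1 hκ).regular hμ)) hs).2,
        B.pattern_apply hμ _ (B.mem_linkage.2 h)]
    · by_contra h0
      obtain ⟨S⟩ := D.nonempty_of_simpleCharacter_ne_zero h0
      exact h (B.linked_of_tab S)
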